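/- Let $(X,\mathcal B,\mu,T)$ be an ergodic, aperiodic, invertible probability measure preserving system. (Aperiodic means: for every $n\ge 1$ and every $E\in\mathcal B$ with $\mu(E)>0$ there is a measurable $F\subseteq E$ with $\mu(F\,\triangle\,T^{-n}F)>0$; on a standard probability space this says that almost every point is non-periodic.) For integers $k\ge 2$ put \[ p_k=\begin{cases}2^k,& k\text{ even},\\ 2^{k-1}+1,& k\text{ odd},\end{cases}\qquad d_k=2^{k^2},\qquad \alpha_k=\frac1{p_k\sqrt{k\log_2 k}} . \] Then there exist measurable functions $\bar f_k:X\to\{-1,0,1\}$, $k\ge 2$, such that (a) for every $k\ge2$, $\{\bar f_k\circ T^j\}_{j=0}^{2d_k+p_k}$ is an i.i.d. sequence with $\mu(\bar f_k=1)=\mu(\bar f_k=-1)=\alpha_k^2/2$; (b) for every $k\ge 2$, the family $\{\bar f_k\circ T^j\}_{j=0}^{2d_k+p_k}$ is independent of the family $\{\bar f_l\circ T^j:\ 2\le l<k,\ 0\le j\le 2d_k+p_k\}$. Moreover, for every such sequence $(\bar f_k)_{k\ge2}$, with \[ f_k=\sum_{i=0}^{p_k-1}\bar f_k\circ T^i-\sum_{i=0}^{p_k-1}\bar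 f_k\circ T^{d_k+i},\qquad f=\sum_{k=2}^\infty f_k,\qquad S_n(f)=\sum_{j=0}^{n-1}f\circ T^j , \] the function $f:X\to\mathbb Z$ (defined as the pointwise sum where only finitely many terms are nonzero, and as $0$ elsewhere) belongs to $L^2(\mu)$, the series $\sum_k f_k$ converges to $f$ in $L^2(\mu)$, and, as $n\to\infty$, \[ \frac{\|S_n(f)\|_2^2}{n}\longrightarrow 2(\ln 2)^2 \qquad\text{and}\qquad \frac{S_n(f)}{\sqrt n}\ \text{ converges in distribution to the normal law }\ \mathcal N\bigl(0,2(\ln 2)^2\bigr). \] -/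

import Mathlib

open MeasureTheory ProbabilityTheory Filter Topology

namespace KosloffVolny

/-- Aperiodicity of a measure preserving transformation: for no `n ≥ 1` is there a set `E` of
positive measure on which `T ^ n` acts trivially, that is, all of whose measurable subsets are
`T ^ n`-invariant modulo null sets. On a standard Borel (or Lebesgue) space this says that the set
of periodic points is a null set. -/
def Aperiodic {X : Type*} [MeasurableSpace X] (T : X → X) (μ : Measure X) : Prop :=
  ∀ n : ℕ, 1 ≤ n → ∀ E : Set X, MeasurableSet E → 0 < μ E →
    ∃ F : Set X, F ⊆ E ∧ MeasurableSet F ∧ 0 < μ (symmDiff F (T^[n] ⁻¹' F))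

/-- `p k = 2 ^ k` for even `k` and `p k = 2 ^ (k - 1) + 1` for odd `k`. -/
def p (k : ℕ) : ℕ := if Even k then 2 ^ k else 2 ^ (k - 1) + 1

/-- `d k = 2 ^ (k ^ 2)`. -/
def d (k : ℕ) : ℕ := 2 ^ (k ^ 2)

/-- `α k = 1 / (p k * √(k * log₂ k))`, meaningful for `k ≥ 2`. -/
noncomputable def α (k : ℕ) : ℝ := 1 / ((p k : ℝ) * √((k : ℝ) * Real.logb 2 (k : ℝ)))

/-- The defining properties of the sequence `fbar k`, `k ≥ 2` (the values at `k = 0, 1` play no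
role). As `T` preserves `μ`, the functions `fbar k ∘ T ^ j` automatically have the same law for
all `j`, so that independence in `j` means that they are i.i.d. -/
structure IsCodingSequence {X : Type*} [MeasurableSpace X] (T : X → X) (μ : Measure X)
    (fbar : ℕ → X → ℤ) : Prop where
  measurable : ∀ k, 2 ≤ k → Measurable (fbar k)
  values : ∀ k, 2 ≤ k → ∀ x, fbar k x = -1 ∨ fbar k x = 0 ∨ fbar k x = 1
  prob_one : ∀ k, 2 ≤ k → μ.real {x | fbar k x = 1} = α k ^ 2 / 2
  prob_neg_one : ∀ k, 2 ≤ k → μ.real {x | fbar k x = -1} = α k ^ 2 / 2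
  /-- `fbar k ∘ T ^ j`, `0 ≤ j ≤ 2 * d k + p k`, are independent. -/
  indep_time : ∀ k, 2 ≤ k →
    iIndepFun (fun (j : Fin (2 * d k + p k + 1)) (x : X) => fbar k (T^[(j : ℕ)] x)) μ
  /-- The family `fbar k ∘ T ^ j`, `0 ≤ j ≤ 2 * d k + p k`, is independent of the family
  `fbar l ∘ T ^ j`, `2 ≤ l < k`, `0 ≤ j ≤ 2 * d k + p k`. -/
  indep_past : ∀ k, 2 ≤ k →
    IndepFun
      (fun (x : X) (j : Fin (2 * d k + p k + 1)) => fbar k (T^[(j : ℕ)] x))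
      (fun (x : X) (q : Set.Ico 2 k × Fin (2 * d k + p k + 1)) =>
        fbar (q.1 : ℕ) (T^[(q.2 : ℕ)] x)) μ

/-- `f_k = ∑_{i < p k} U ^ i fbar_k - U ^ (d k) (∑_{i < p k} U ^ i fbar_k)`, where
`U g = g ∘ T`. -/
def block {X : Type*} (T : X → X) (fbar : ℕ → X → ℤ) (k : ℕ) (x : X) : ℤ :=
  ∑ i ∈ Finset.range (p k), fbar k (T^[i] x)
    - ∑ i ∈ Finset.range (p k), fbar k (T^[i] (T^[d k] x))

/-- `f = ∑_{k ≥ 2} f_k`, as a pointwise sum of integers (`0` at the points at which infinitely many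
terms are nonzero). -/
noncomputable def f {X : Type*} (T : X → X) (fbar : ℕ → X → ℤ) (x : X) : ℤ :=
  ∑' k : ℕ, block T fbar (k + 2) x

/-- The ergodic sum `S_n(f) = ∑_{k < n} f ∘ T ^ k`, as a real random variable. -/
noncomputable def S {X : Type*} (T : X → X) (fbar : ℕ → X → ℤ) (n : ℕ) (x : X) : ℝ :=
  birkhoffSum T (fun y => (f T fbar y : ℝ)) n x

end KosloffVolny

set_option linter.unusedSectionVars false

namespace KosloffVolny

section Nonatomic

variable {X : Type*} [MeasurableSpace X] {μ : Measure X}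

/-- A finite measure in which every set of positive measure has subsets of arbitrarily small
positive measure takes all intermediate values on subsets. -/
theorem exists_subset_measure_eq [IsFiniteMeasure μ]
    (hμ : ∀ E, MeasurableSet E → 0 < μ E → ∀ ε : ENNReal, 0 < ε →
      ∃ F ⊆ E, MeasurableSet F ∧ 0 < μ F ∧ μ F ≤ ε)
    {E : Set X} (hE : MeasurableSet E) {t : ENNReal} (ht : t ≤ μ E) :
    ∃ F ⊆ E, MeasurableSet F ∧ μ F = t := by
  classical
  let A : Type _ := {F : Set X // F ⊆ E ∧ MeasurableSet F ∧ μ F ≤ t}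
  let c : Set X → ENNReal := fun F =>
    ⨆ G : {G : Set X // G ⊆ E \ F ∧ MeasurableSet G ∧ μ G ≤ t - μ F}, μ G.1
  have hstep : ∀ F : A, ∃ F' : A, F.1 ⊆ F'.1 ∧ c F.1 / 2 ≤ μ (F'.1 \ F.1) := by
    rintro ⟨F, hFE, hF, hFt⟩
    have hcle : c F ≤ μ E := iSup_le fun G => measure_mono (G.2.1.trans Set.sdiff_subset)
    have hctop : c F ≠ ⊤ := (hcle.trans_lt (measure_lt_top μ E)).ne
    obtain ⟨G, hGE, hG, hGt, hGc⟩ : ∃ G ⊆ E \ F, MeasurableSet G ∧ μ G ≤ t - μ F ∧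
        c F / 2 ≤ μ G := by
      rcases eq_or_ne (c F) 0 with h0 | h0
      · exact ⟨∅, by simp, MeasurableSet.empty, by simp, by simp [h0]⟩
      · obtain ⟨G, hG⟩ := lt_iSup_iff.1 (ENNReal.half_lt_self h0 hctop)
        exact ⟨G.1, G.2.1, G.2.2.1, G.2.2.2, hG.le⟩
    have hd : Disjoint F G := Set.disjoint_left.2 fun x hx hx' => (hGE hx').2 hx
    refine ⟨⟨F ∪ G, Set.union_subset hFE (hGE.trans Set.sdiff_subset), hF.union hG, ?_⟩,
      Set.subset_union_left, ?_⟩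
    · rw [measure_union hd hG]
      calc μ F + μ G ≤ μ F + (t - μ F) := by gcongr
        _ = t := add_tsub_cancel_of_le hFt
    · simpa [Set.union_sdiff_left, hd.sdiff_eq_right] using hGc
  choose next hnext hnextc using hstep
  let F : ℕ → A := fun n => Nat.rec ⟨∅, by simp, MeasurableSet.empty, by simp⟩
    (fun _ G => next G) n
  have hmono : Monotone fun n => (F n).1 := monotone_nat_of_le_succ fun n => hnext (F n)
  have hUm : MeasurableSet (⋃ n, (F n).1) := MeasurableSet.iUnion fun n => (F n).2.2.1
  have hUE : (⋃ n, (F n).1) ⊆ E := Set.iUnion_subset fun n => (F n).2.1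
  have hUt : μ (⋃ n, (F n).1) ≤ t := by
    rw [hmono.measure_iUnion]
    exact iSup_le fun n => (F n).2.2.2
  refine ⟨_, hUE, hUm, hUt.antisymm ?_⟩
  by_contra! hlt
  have hpos : 0 < μ (E \ ⋃ n, (F n).1) := by
    rw [measure_sdiff hUE hUm.nullMeasurableSet (measure_ne_top _ _)]
    exact tsub_pos_of_lt (hlt.trans_le ht)
  obtain ⟨G, hGE, hG, hG0, hGt⟩ := hμ _ (hE.diff hUm) hpos _ (tsub_pos_of_lt hlt)
  have hc : ∀ n, μ G ≤ c (F n).1 := fun n => by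
    refine le_iSup (fun G : {G : Set X // G ⊆ E \ (F n).1 ∧ MeasurableSet G ∧
      μ G ≤ t - μ (F n).1} => μ G.1) ⟨G, ?_, hG, ?_⟩
    · exact hGE.trans (Set.sdiff_subset_sdiff_right (Set.subset_iUnion (fun n => (F n).1) n))
    · exact hGt.trans (tsub_le_tsub_left (measure_mono (Set.subset_iUnion (fun n => (F n).1) n)) _)
  have hgrow : ∀ n : ℕ, n * (μ G / 2) ≤ μ (F n).1 := by
    intro n
    induction n with
    | zero => simp
    | succ n ih =>
      calc ((n + 1 : ℕ) : ENNReal) * (μ G / 2) = n * (μ G / 2) + μ G / 2 := by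
            push_cast; ring
        _ ≤ μ (F n).1 + μ ((F (n + 1)).1 \ (F n).1) :=
            add_le_add ih ((ENNReal.div_le_div_right (hc n) 2).trans (hnextc (F n)))
        _ = μ ((F n).1 ∪ ((F (n + 1)).1 \ (F n).1)) :=
            (measure_union Set.disjoint_sdiff_right
              ((F (n + 1)).2.2.1.diff (F n).2.2.1)).symm
        _ = μ (F (n + 1)).1 := by rw [Set.union_sdiff_cancel (hnext (F n))]
  obtain ⟨n, hn⟩ := ENNReal.exists_nat_mul_gt (a := μ G / 2) (b := μ E)
    (ENNReal.half_pos hG0.ne').ne' (measure_ne_top _ _)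
  exact absurd (hn.trans_le ((hgrow n).trans (measure_mono (F n).2.1))) (lt_irrefl _)

theorem exists_measurable_finite_law [IsFiniteMeasure μ]
    (hμ : ∀ E, MeasurableSet E → ∀ t ≤ μ E, ∃ F ⊆ E, MeasurableSet F ∧ μ F = t)
    {Ω : Type*} [MeasurableSpace Ω] [MeasurableSingletonClass Ω]
    (s : Finset Ω) (hs : s.Nonempty) (t : Ω → ENNReal) {E : Set X} (hE : MeasurableSet E)
    (ht : ∑ ω ∈ s, t ω = μ E) :
    ∃ w : X → Ω, Measurable w ∧ (∀ x, w x ∈ s) ∧ ∀ ω ∈ s, μ (E ∩ w ⁻¹' {ω}) = t ω := by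
  classical
  induction hs using Finset.Nonempty.cons_induction generalizing E with
  | singleton a =>
    refine ⟨fun _ => a, measurable_const, by simp, fun ω hω => ?_⟩
    obtain rfl := Finset.mem_singleton.1 hω
    simpa [Set.preimage_const] using ht.symm
  | cons a s has hs ih =>
    rw [Finset.sum_cons] at ht
    obtain ⟨F, hFE, hF, hFt⟩ := hμ E hE (t a) (ht ▸ le_self_add)
    have hd : μ (E \ F) = ∑ ω ∈ s, t ω := by
      rw [measure_sdiff hFE hF.nullMeasurableSet (measure_ne_top _ _), ← ht, hFt]
      exact ENNReal.add_sub_cancel_left (hFt ▸ measure_ne_top _ _)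
    obtain ⟨w, hw, hws, hwt⟩ := ih (hE.diff hF) hd.symm
    refine ⟨F.piecewise (fun _ => a) w, measurable_const.piecewise hF hw, fun x => ?_,
      fun ω hω => ?_⟩
    · by_cases hx : x ∈ F <;> simp [hx, hws]
    · rcases Finset.mem_cons.1 hω with rfl | hω
      · rw [← hFt]
        congr 1
        ext x
        by_cases hx : x ∈ F
        · simp [hx, hFE hx]
        · simp only [Set.mem_inter_iff, Set.mem_preimage, Set.piecewise, hx, if_false,
            Set.mem_singleton_iff, iff_false, not_and]
          exact fun _ h => has (h ▸ hws x)
      · rw [← hwt ω hω]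
        congr 1
        ext x
        by_cases hx : x ∈ F
        · have : a ≠ ω := fun h => has (h ▸ hω)
          simp [hx, this]
        · simp [hx]

theorem exists_subset_disjoint_preimages {T : X → X} (hT : MeasurePreserving T μ μ)
    [IsFiniteMeasure μ] (hap : Aperiodic T μ) (N : ℕ) {E : Set X} (hE : MeasurableSet E)
    (hE0 : 0 < μ E) :
    ∃ F ⊆ E, MeasurableSet F ∧ 0 < μ F ∧
      ∀ n, 1 ≤ n → n ≤ N → Disjoint F (T^[n] ⁻¹' F) := by
  induction N with
  | zero => exact ⟨E, subset_rfl, hE, hE0, fun n h1 h2 => by omega⟩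
  | succ N ih =>
    obtain ⟨F, hFE, hF, hF0, hFd⟩ := ih
    obtain ⟨G, hGF, hG, hG0⟩ := hap (N + 1) (by omega) F hF hF0
    have hTm := hT.iterate (N + 1)
    have hTG : MeasurableSet (T^[N + 1] ⁻¹' G) := hTm.measurable hG
    refine ⟨G \ T^[N + 1] ⁻¹' G, Set.sdiff_subset.trans (hGF.trans hFE), hG.diff hTG, ?_, ?_⟩
    · rw [pos_iff_ne_zero]
      intro h0
      have h1 : μ (T^[N + 1] ⁻¹' G \ G) = 0 := by
        have e1 := measure_sdiff_add_inter (μ := μ) G hTG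
        have e2 := measure_sdiff_add_inter (μ := μ) (T^[N + 1] ⁻¹' G) hG
        rw [hTm.measure_preimage hG.nullMeasurableSet, Set.inter_comm, ← e1, h0] at e2
        exact (ENNReal.add_left_inj (measure_ne_top μ _)).1 e2
      rw [Set.symmDiff_def] at hG0
      exact hG0.ne' (measure_union_null h0 h1)
    · intro n h1 h2
      rcases h2.lt_or_eq with h | rfl
      · exact (hFd n h1 (by omega)).mono (Set.sdiff_subset.trans hGF)
          (Set.preimage_mono (Set.sdiff_subset.trans hGF))
      · exact Set.disjoint_left.2 fun x hx hx' => hx.2 hx'.1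

theorem exists_small_subset {T : X → X} (hT : MeasurePreserving T μ μ)
    [IsFiniteMeasure μ] (hap : Aperiodic T μ) {E : Set X} (hE : MeasurableSet E)
    (hE0 : 0 < μ E) {ε : ENNReal} (hε : 0 < ε) :
    ∃ F ⊆ E, MeasurableSet F ∧ 0 < μ F ∧ μ F ≤ ε := by
  obtain ⟨N, hN⟩ := ENNReal.exists_nat_mul_gt (a := ε) (b := μ Set.univ) hε.ne'
    (measure_ne_top _ _)
  obtain ⟨F, hFE, hF, hF0, hFd⟩ := exists_subset_disjoint_preimages hT hap N hE hE0
  refine ⟨F, hFE, hF, hF0, ?_⟩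
  by_contra! hlt
  have hm : ∀ n, MeasurableSet (T^[n] ⁻¹' F) := fun n => (hT.iterate n).measurable hF
  have hdis : ∀ i j, i < j → j < N → Disjoint (T^[i] ⁻¹' F) (T^[j] ⁻¹' F) := by
    intro i j hij hj
    have := (hFd (j - i) (by omega) (by omega)).preimage (T^[i])
    rwa [← Set.preimage_comp, ← Function.iterate_add, Nat.sub_add_cancel hij.le] at this
  have hsum : μ (⋃ i ∈ Finset.range N, T^[i] ⁻¹' F) = N * μ F := by
    rw [measure_biUnion_finset _ fun i _ => hm i]
    · simp [fun i => (hT.iterate i).measure_preimage hF.nullMeasurableSet]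
    · intro i hi j hj hij
      rcases hij.lt_or_gt with h | h
      · exact hdis i j h (by simpa using hj)
      · exact (hdis j i h (by simpa using hi)).symm
  have := hsum ▸ measure_mono (μ := μ) (Set.subset_univ (⋃ i ∈ Finset.range N, T^[i] ⁻¹' F))
  have h2 : (N : ENNReal) * ε ≤ N * μ F := by gcongr
  exact absurd (hN.trans_le (h2.trans this)) (lt_irrefl _)

theorem Aperiodic.exists_subset_measure_eq {T : X → X} (hT : MeasurePreserving T μ μ)
    [IsFiniteMeasure μ] (hap : Aperiodic T μ) (E : Set X) (hE : MeasurableSet E) (t : ENNReal)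
    (ht : t ≤ μ E) : ∃ F ⊆ E, MeasurableSet F ∧ μ F = t :=
  KosloffVolny.exists_subset_measure_eq
    (fun _ hE hE0 _ hε => exists_small_subset hT hap hE hE0 hε) hE ht

end Nonatomic

end KosloffVolny

namespace KosloffVolny

section Cylinders

variable {L : Type*} [Fintype L] [MeasurableSpace L] [MeasurableSingletonClass L]

/-- Label a countable partition of a set by random words with prescribed laws. -/
theorem exists_measurable_cylinder_law {X : Type*} [MeasurableSpace X] {μ : Measure X}
    [IsFiniteMeasure μ] [Nonempty L]
    (hμ : ∀ E, MeasurableSet E → ∀ t ≤ μ E, ∃ F ⊆ E, MeasurableSet F ∧ μ F = t)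
    {κ : Type*} [Countable κ] {q : X → κ} (hq : ∀ c, MeasurableSet (q ⁻¹' {c}))
    {B : Set X} (hB : MeasurableSet B) (ν : κ → Measure (ℕ → L))
    [∀ c, IsProbabilityMeasure (ν c)] (H : κ → ℕ) :
    ∃ w : X → ℕ → L, Measurable w ∧ ∀ c, ∀ A : Set (ℕ → L),
      DependsOn (· ∈ A) (Set.Iio (H c)) →
      μ (B ∩ q ⁻¹' {c} ∩ w ⁻¹' A) = μ (B ∩ q ⁻¹' {c}) * ν c A := by
  classical
  have key : ∀ c, ∃ w : X → ℕ → L, Measurable w ∧ ∀ A : Set (ℕ → L),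
      DependsOn (· ∈ A) (Set.Iio (H c)) →
      μ (B ∩ q ⁻¹' {c} ∩ w ⁻¹' A) = μ (B ∩ q ⁻¹' {c}) * ν c A := by
    intro c
    let r : (ℕ → L) → Fin (H c) → L := fun ω j => ω j
    have hr : Measurable r := by fun_prop
    have hνr : IsProbabilityMeasure ((ν c).map r) := Measure.isProbabilityMeasure_map hr.aemeasurable
    obtain ⟨v, hv, -, hvl⟩ := exists_measurable_finite_law hμ (Finset.univ : Finset (Fin (H c) → L))
      Finset.univ_nonempty (fun v => μ (B ∩ q ⁻¹' {c}) * (ν c).map r {v}) (hB.inter (hq c)) (by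
        rw [← Finset.mul_sum, sum_measure_singleton]
        simp)
    have hlaw : (μ.restrict (B ∩ q ⁻¹' {c})).map v = μ (B ∩ q ⁻¹' {c}) • (ν c).map r := by
      refine Measure.ext_of_singleton fun a => ?_
      rw [Measure.map_apply hv (measurableSet_singleton a),
        Measure.restrict_apply (hv (measurableSet_singleton a)), Set.inter_comm,
        hvl a (Finset.mem_univ a)]
      simp
    let e : (Fin (H c) → L) → ℕ → L := fun a j =>
      if h : j < H c then a ⟨j, h⟩ else Classical.arbitrary L
    have he : Measurable e := measurable_of_countable e
    refine ⟨fun x => e (v x), he.comp hv, fun A hA => ?_⟩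
    have hAm : MeasurableSet (e ⁻¹' A) := MeasurableSet.of_discrete
    have h1 := congrArg (fun m => m (e ⁻¹' A)) hlaw
    simp only [Measure.smul_apply, smul_eq_mul] at h1
    rw [Measure.map_apply hv hAm, Measure.restrict_apply (hv hAm), Set.inter_comm,
      Measure.map_apply hr hAm] at h1
    have h2 : r ⁻¹' (e ⁻¹' A) = A := by
      ext ω
      refine iff_of_eq (hA fun j hj => ?_)
      simp [e, r, Set.mem_Iio.1 hj]
    rw [h2] at h1
    exact h1
  choose w hw hwl using key
  refine ⟨fun x => w (q x) x, fun S hS => ?_, fun c A hA => ?_⟩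
  · have : (fun x => w (q x) x) ⁻¹' S = ⋃ c, q ⁻¹' {c} ∩ w c ⁻¹' S := by
      ext x; simp
    rw [this]
    exact MeasurableSet.iUnion fun c => (hq c).inter (hw c hS)
  · rw [← hwl c A hA]
    congr 1
    ext x
    simp only [Set.mem_inter_iff, Set.mem_preimage, Set.mem_singleton_iff, and_congr_right_iff]
    rintro ⟨-, rfl⟩
    rfl

/-- The set of sequences in which the word `u 0, …, u (n - 1)` is seen at the place `i`. -/
def cyl (n : ℕ) (u : ℕ → L) (i : ℕ) : Set (ℕ → L) := {ω | ∀ j < n, ω (i + j) = u j}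

/-- The set of sequences in which at the place `m` one sees (`b = true`) or does not see
(`b = false`) a block of `n` symbols `z`. -/
def markSet (n : ℕ) (z : L) (b : Bool) (m : ℕ) : Set (ℕ → L) :=
  if b then cyl n (fun _ => z) m else (cyl n (fun _ => z) m)ᶜ

/-- The set of sequences with prescribed marks at the places in `M`. -/
def markSets (n : ℕ) (z : L) (τ : ℕ → Bool) (M : Finset ℕ) : Set (ℕ → L) :=
  {ω | ∀ m ∈ M, ω ∈ markSet n z (τ m) m}

theorem dependsOn_cyl (n : ℕ) (u : ℕ → L) (i : ℕ) :
    DependsOn (· ∈ cyl n u i) (Set.Ico i (i + n)) := by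
  intro ω ω' h
  refine propext (forall₂_congr fun j hj => ?_)
  rw [h (i + j) ⟨by omega, by omega⟩]

theorem dependsOn_markSet (n : ℕ) (z : L) (b : Bool) (m : ℕ) :
    DependsOn (· ∈ markSet n z b m) (Set.Ico m (m + n)) := by
  intro ω ω' h
  have := dependsOn_cyl n (fun _ => z) m h
  cases b <;> simp_all [markSet]

theorem dependsOn_markSets (n : ℕ) (z : L) (τ : ℕ → Bool) (M : Finset ℕ) :
    DependsOn (· ∈ markSets n z τ M) (⋃ m ∈ M, Set.Ico m (m + n)) := by
  intro ω ω' h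
  refine propext (forall₂_congr fun m hm => iff_of_eq (dependsOn_markSet n z (τ m) m ?_))
  exact fun i hi => h i (Set.mem_biUnion hm hi)

theorem measurableSet_cyl (n : ℕ) (u : ℕ → L) (i : ℕ) : MeasurableSet (cyl n u i) := by
  have : cyl n u i = ⋂ j, ⋂ _ : j < n, (fun ω : ℕ → L => ω (i + j)) ⁻¹' {u j} := by
    ext; simp [cyl]
  rw [this]
  exact MeasurableSet.iInter fun j => MeasurableSet.iInter fun _ =>
    measurable_pi_apply _ (measurableSet_singleton _)

theorem measurableSet_markSet (n : ℕ) (z : L) (b : Bool) (m : ℕ) :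
    MeasurableSet (markSet n z b m) := by
  cases b
  · simpa [markSet] using (measurableSet_cyl n (fun _ => z) m).compl
  · simpa [markSet] using measurableSet_cyl n (fun _ => z) m

theorem measurableSet_markSets (n : ℕ) (z : L) (τ : ℕ → Bool) (M : Finset ℕ) :
    MeasurableSet (markSets n z τ M) := by
  have : markSets n z τ M = ⋂ m ∈ M, markSet n z (τ m) m := by ext; simp [markSets]
  rw [this]
  exact M.measurableSet_biInter fun m _ => measurableSet_markSet n z (τ m) m

variable {π : Measure L} [IsProbabilityMeasure π]

theorem infinitePi_inter_of_dependsOn {A A' : Set (ℕ → L)} {S S' : Set ℕ} (hS : S.Finite)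
    (hS' : S'.Finite) (hA : DependsOn (· ∈ A) S) (hA' : DependsOn (· ∈ A') S')
    (hd : Disjoint S S') :
    Measure.infinitePi (fun _ : ℕ => π) (A ∩ A') =
      Measure.infinitePi (fun _ : ℕ => π) A * Measure.infinitePi (fun _ : ℕ => π) A' := by
  lift S to Finset ℕ using hS
  lift S' to Finset ℕ using hS'
  have hind := (iIndepFun_infinitePi (P := fun _ : ℕ => π) (X := fun _ => id)
    (fun _ => measurable_id)).indepFun_finset S S' (by exact_mod_cast hd)
    (fun i => measurable_pi_apply i)
  have hpre : ∀ {A : Set (ℕ → L)} {S : Finset ℕ}, DependsOn (· ∈ A) (S : Set ℕ) →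
      A = (fun (ω : ℕ → L) (i : S) => ω i) ⁻¹' ((fun (ω : ℕ → L) (i : S) => ω i) '' A) := by
    intro A S hA
    refine Set.Subset.antisymm (Set.subset_preimage_image _ _) ?_
    rintro ω ⟨ω', hω', h⟩
    exact (iff_of_eq (hA fun i hi => congrFun h ⟨i, hi⟩)).1 hω'
  have := hind.measure_inter_preimage_eq_mul _ _ 
    (MeasurableSet.of_discrete (s := (fun (ω : ℕ → L) (i : S) => ω i) '' A))
    (MeasurableSet.of_discrete (s := (fun (ω : ℕ → L) (i : S') => ω i) '' A'))
  simp only [id] at this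
  rwa [← hpre hA, ← hpre hA'] at this

theorem infinitePi_cyl (n : ℕ) (u : ℕ → L) (i : ℕ) :
    Measure.infinitePi (fun _ : ℕ => π) (cyl n u i) = ∏ j ∈ Finset.range n, π {u j} := by
  have : cyl n u i = Set.pi ((Finset.Ico i (i + n) : Finset ℕ) : Set ℕ) (fun k => {u (k - i)}) := by
    ext ω
    simp only [cyl, Set.mem_ofPred_eq, Set.mem_pi, Finset.coe_Ico, Set.mem_Ico,
      Set.mem_singleton_iff]
    refine ⟨fun h k hk => ?_, fun h j hj => by simpa using h (i + j) ⟨by omega, by omega⟩⟩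
    have := h (k - i) (by omega)
    rwa [Nat.add_sub_cancel' hk.1] at this
  rw [this, Measure.infinitePi_pi _ fun _ _ => measurableSet_singleton _,
    Finset.prod_Ico_eq_prod_range]
  simp

theorem infinitePi_shift (k : ℕ) {A : Set (ℕ → L)} (hA : MeasurableSet A) :
    Measure.infinitePi (fun _ : ℕ => π) ((fun ω j => ω (j + k)) ⁻¹' A) =
      Measure.infinitePi (fun _ : ℕ => π) A := by
  have h := Measure.map_infinitePi_infinitePi_of_inj (P := fun _ : ℕ => π)
    (f := fun j : ℕ => j + k) (add_left_injective k)
  rw [← Measure.map_apply (by fun_prop) hA]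
  exact congrArg (fun m => m A) h

theorem infinitePi_markSet_pos {n : ℕ} {z : L} (h0 : 0 < π {z} ^ n) (h1 : π {z} ^ n < 1)
    (b : Bool) (m : ℕ) : 0 < Measure.infinitePi (fun _ : ℕ => π) (markSet n z b m) := by
  have h : Measure.infinitePi (fun _ : ℕ => π) (cyl n (fun _ => z) m) = π {z} ^ n := by
    simp [infinitePi_cyl]
  cases b
  · simp only [markSet, Bool.false_eq_true, if_false]
    rw [prob_compl_eq_one_sub (measurableSet_cyl _ _ _), h]
    exact tsub_pos_of_lt h1
  · simp only [markSet, if_true, h, h0]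

theorem cond_cyl_markSet_add {n : ℕ} {z : L} (u : ℕ → L) (i m : ℕ) :
    (Measure.infinitePi (fun _ : ℕ => π))[cyl n u i | markSet n z true m] * π {z} ^ n +
      (Measure.infinitePi (fun _ : ℕ => π))[cyl n u i | markSet n z false m] * (1 - π {z} ^ n) =
      ∏ j ∈ Finset.range n, π {u j} := by
  have h : Measure.infinitePi (fun _ : ℕ => π) (cyl n (fun _ => z) m) = π {z} ^ n := by
    simp [infinitePi_cyl]
  rw [← h, ← prob_compl_eq_one_sub (measurableSet_cyl _ _ _), ← infinitePi_cyl n u i]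
  simpa [markSet] using cond_add_cond_compl_eq (t := cyl n u i) (measurableSet_cyl n (fun _ => z) m)
    (Measure.infinitePi (fun _ : ℕ => π))

theorem cond_cyl_markSet_shift {n : ℕ} {z : L} (b : Bool) (u : ℕ → L) (i m k : ℕ) :
    (Measure.infinitePi (fun _ : ℕ => π))[cyl n u (i + k) | markSet n z b (m + k)] =
      (Measure.infinitePi (fun _ : ℕ => π))[cyl n u i | markSet n z b m] := by
  have hc : ∀ (v : ℕ → L) i, cyl n v (i + k) = (fun ω j => ω (j + k)) ⁻¹' cyl n v i := by
    intro v i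
    ext ω
    simp only [cyl, Set.mem_ofPred_eq, Set.mem_preimage]
    simp only [add_right_comm]
  have hm : markSet n z b (m + k) = (fun ω j => ω (j + k)) ⁻¹' markSet n z b m := by
    cases b <;> simp [markSet, hc]
  rw [cond_apply (measurableSet_markSet _ _ _ _), cond_apply (measurableSet_markSet _ _ _ _),
    hm, hc, ← Set.preimage_inter, infinitePi_shift _ (measurableSet_markSet _ _ _ _),
    infinitePi_shift _ ((measurableSet_markSet _ _ _ _).inter (measurableSet_cyl _ _ _))]

theorem finite_biUnion_Ico (n : ℕ) (M : Finset ℕ) : (⋃ m ∈ M, Set.Ico m (m + n)).Finite :=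
  M.finite_toSet.biUnion fun m _ => Set.finite_Ico m (m + n)

theorem infinitePi_markSets_pos {n : ℕ} {z : L} (h0 : 0 < π {z} ^ n) (h1 : π {z} ^ n < 1)
    (τ : ℕ → Bool) {M : Finset ℕ} (hM : ∀ a ∈ M, ∀ b ∈ M, a < b → a + 2 * n ≤ b) :
    0 < Measure.infinitePi (fun _ : ℕ => π) (markSets n z τ M) := by
  classical
  induction M using Finset.induction_on with
  | empty => simp [markSets]
  | insert a M ha ih =>
    have : markSets n z τ (insert a M) = markSet n z (τ a) a ∩ markSets n z τ M := by
      ext; simp [markSets]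
    rw [this, infinitePi_inter_of_dependsOn (Set.finite_Ico _ _) (finite_biUnion_Ico n M)
      (dependsOn_markSet _ _ _ _) (dependsOn_markSets _ _ _ _)]
    · refine ENNReal.mul_pos (infinitePi_markSet_pos h0 h1 _ _).ne' (ih fun b hb c hc => ?_).ne'
      exact hM b (Finset.mem_insert_of_mem hb) c (Finset.mem_insert_of_mem hc)
    · simp only [Set.disjoint_iUnion_right]
      intro b hb
      rw [Set.disjoint_left]
      rintro x ⟨hx1, hx2⟩ ⟨hx3, hx4⟩
      have hab : a ≠ b := fun h => ha (h ▸ hb)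
      have e1 := hM a (Finset.mem_insert_self _ _) b (Finset.mem_insert_of_mem hb)
      have e2 := hM b (Finset.mem_insert_of_mem hb) a (Finset.mem_insert_self _ _)
      omega

theorem cond_cyl_markSets_of_far {n : ℕ} {z : L} (h0 : 0 < π {z} ^ n) (h1 : π {z} ^ n < 1)
    (τ : ℕ → Bool) {M : Finset ℕ} (hM : ∀ a ∈ M, ∀ b ∈ M, a < b → a + 2 * n ≤ b)
    (u : ℕ → L) (i : ℕ) (hi : ∀ m ∈ M, m + n ≤ i ∨ i + n ≤ m) :
    (Measure.infinitePi (fun _ : ℕ => π))[cyl n u i | markSets n z τ M] =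
      ∏ j ∈ Finset.range n, π {u j} := by
  have hpos := infinitePi_markSets_pos h0 h1 τ hM
  rw [cond_apply (measurableSet_markSets _ _ _ _), infinitePi_inter_of_dependsOn
    (finite_biUnion_Ico n M) (Set.finite_Ico _ _) (dependsOn_markSets _ _ _ _)
    (dependsOn_cyl _ _ _), ← mul_assoc, ENNReal.inv_mul_cancel hpos.ne' (measure_ne_top _ _),
    one_mul, infinitePi_cyl]
  simp only [Set.disjoint_iUnion_left]
  intro b hb
  rw [Set.disjoint_left]
  rintro x ⟨hx1, hx2⟩ ⟨hx3, hx4⟩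
  have := hi b hb
  omega

theorem cond_cyl_markSets_of_near {n : ℕ} {z : L} (h0 : 0 < π {z} ^ n) (h1 : π {z} ^ n < 1)
    (τ : ℕ → Bool) {M : Finset ℕ} (hM : ∀ a ∈ M, ∀ b ∈ M, a < b → a + 2 * n ≤ b)
    (u : ℕ → L) {i m : ℕ} (hm : m ∈ M) (him : i < m + n) (hmi : m < i + n) :
    (Measure.infinitePi (fun _ : ℕ => π))[cyl n u i | markSets n z τ M] =
      (Measure.infinitePi (fun _ : ℕ => π))[cyl n u i | markSet n z (τ m) m] := by
  classical
  set P := Measure.infinitePi (fun _ : ℕ => π)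
  have hE : markSets n z τ M = markSet n z (τ m) m ∩ markSets n z τ (M.erase m) := by
    conv_lhs => rw [← Finset.insert_erase hm]
    ext; simp [markSets]
  have hd : ∀ b ∈ M.erase m, ∀ x, b ≤ x → x < b + n →
      (x < i ∨ i + n ≤ x) ∧ (x < m ∨ m + n ≤ x) := by
    intro b hb x h1 h2
    obtain ⟨hbm, hb⟩ := Finset.mem_erase.1 hb
    have e1 := hM b hb m hm
    have e2 := hM m hm b hb
    omega
  have hM' : ∀ a ∈ M.erase m, ∀ b ∈ M.erase m, a < b → a + 2 * n ≤ b :=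
    fun a ha b hb => hM a (Finset.mem_of_mem_erase ha) b (Finset.mem_of_mem_erase hb)
  have hpos := infinitePi_markSets_pos h0 h1 τ hM'
  have e1 : P (markSets n z τ M) = P (markSet n z (τ m) m) * P (markSets n z τ (M.erase m)) := by
    rw [hE]
    refine infinitePi_inter_of_dependsOn (Set.finite_Ico _ _) (finite_biUnion_Ico n _)
      (dependsOn_markSet _ _ _ _) (dependsOn_markSets _ _ _ _) ?_
    simp only [Set.disjoint_iUnion_right]
    intro b hb
    rw [Set.disjoint_left]
    rintro x ⟨hx1, hx2⟩ ⟨hx3, hx4⟩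
    have := hd b hb x hx3 hx4
    omega
  have e2 : P (markSets n z τ M ∩ cyl n u i) =
      P (markSet n z (τ m) m ∩ cyl n u i) * P (markSets n z τ (M.erase m)) := by
    rw [hE, Set.inter_right_comm]
    refine infinitePi_inter_of_dependsOn (S := Set.Ico m (m + n) ∪ Set.Ico i (i + n))
      ((Set.finite_Ico _ _).union (Set.finite_Ico _ _))
      (finite_biUnion_Ico n _) ?_ (dependsOn_markSets _ _ _ _) ?_
    · intro ω ω' h
      refine propext (and_congr (iff_of_eq ?_) (iff_of_eq ?_))
      · exact dependsOn_markSet n z (τ m) m fun j hj => h j (Or.inl hj)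
      · exact dependsOn_cyl n u i fun j hj => h j (Or.inr hj)
    · simp only [Set.disjoint_iUnion_right]
      intro b hb
      rw [Set.disjoint_left]
      rintro x hx ⟨hx3, hx4⟩
      have := hd b hb x hx3 hx4
      simp only [Set.mem_union, Set.mem_Ico] at hx
      omega
  rw [cond_apply (measurableSet_markSets _ _ _ _), cond_apply (measurableSet_markSet _ _ _ _),
    e1, e2, ENNReal.mul_inv (Or.inr (measure_ne_top _ _)) (Or.inl (measure_ne_top _ _))]
  calc _ = (P (markSet n z (τ m) m))⁻¹ * P (markSet n z (τ m) m ∩ cyl n u i) *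
        ((P (markSets n z τ (M.erase m)))⁻¹ * P (markSets n z τ (M.erase m))) := by ring
    _ = _ := by rw [ENNReal.inv_mul_cancel hpos.ne' (measure_ne_top _ _), mul_one]

end Cylinders

end KosloffVolny

namespace KosloffVolny

section Towers

universe u

variable {X : Type*} [MeasurableSpace X]

/-- The time of the first return to `B`. -/
noncomputable def returnTime (T : X → X) (B : Set X) (y : X) : ℕ :=
  sInf {k | 1 ≤ k ∧ T^[k] y ∈ B}

/-- The time of the last visit to `B`, when `S` is the inverse of the transformation. -/
noncomputable def level (S : X → X) (B : Set X) (x : X) : ℕ :=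
  sInf {i | S^[i] x ∈ B}

theorem measurable_sInf_nat {p : X → ℕ → Prop} (hp : ∀ k, MeasurableSet {x | p x k}) :
    Measurable fun x => sInf {k | p x k} := by
  classical
  refine measurable_to_countable' fun k => ?_
  have : (fun x => sInf {k | p x k}) ⁻¹' {k} =
      ({x | p x k} ∩ ⋂ j, ⋂ _ : j < k, {x | p x j}ᶜ) ∪
        {x | k = 0 ∧ ∀ j, ¬ p x j} := by
    ext x
    simp only [Set.mem_preimage, Set.mem_singleton_iff, Set.mem_union, Set.mem_inter_iff,
      Set.mem_iInter, Set.mem_compl_iff, Set.mem_ofPred_eq]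
    constructor
    · rintro rfl
      by_cases hne : {k | p x k}.Nonempty
      · exact Or.inl ⟨Nat.sInf_mem hne, fun j hj => Nat.notMem_of_lt_sInf hj⟩
      · have h0 := Set.not_nonempty_iff_eq_empty.1 hne
        exact Or.inr ⟨by rw [h0, Nat.sInf_empty], fun j hj => hne ⟨j, hj⟩⟩
    · rintro (⟨h1, h2⟩ | ⟨rfl, h⟩)
      · refine le_antisymm (Nat.sInf_le h1) ?_
        by_contra! hlt
        exact h2 _ hlt (Nat.sInf_mem (s := {k | p x k}) ⟨k, h1⟩)
      · have : {k | p x k} = ∅ := Set.eq_empty_of_forall_notMem h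
        rw [this, Nat.sInf_empty]
  rw [this]
  refine ((hp k).inter (MeasurableSet.iInter fun j => MeasurableSet.iInter fun _ =>
    (hp j).compl)).union ?_
  by_cases hk : k = 0
  · have : {x | k = 0 ∧ ∀ j, ¬ p x j} = ⋂ j, {x | p x j}ᶜ := by ext x; simp [hk]
    rw [this]
    exact MeasurableSet.iInter fun j => (hp j).compl
  · simp [hk]

theorem measurable_returnTime {T : X → X} (hT : Measurable T) {B : Set X} (hB : MeasurableSet B) :
    Measurable (returnTime T B) := by
  refine measurable_sInf_nat (p := fun y k => 1 ≤ k ∧ T^[k] y ∈ B) fun k => ?_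
  by_cases hk : 1 ≤ k
  · simp only [hk, true_and]
    exact (hT.iterate k) hB
  · simp [hk]

theorem measurable_level {S : X → X} (hS : Measurable S) {B : Set X} (hB : MeasurableSet B) :
    Measurable (level S B) :=
  measurable_sInf_nat (p := fun y k => S^[k] y ∈ B) fun k => (hS.iterate k) hB

/-- Almost every point visits a set of positive measure. -/
theorem _root_.Ergodic.ae_exists_iterate_mem {μ : Measure X} [IsFiniteMeasure μ] {T : X → X}
    (hT : Ergodic T μ) {B : Set X} (hB : MeasurableSet B) (hB0 : 0 < μ B) :
    ∀ᵐ x ∂μ, ∃ i, T^[i] x ∈ B := by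
  have hU : MeasurableSet (⋃ i, T^[i] ⁻¹' B) :=
    MeasurableSet.iUnion fun i => (hT.measurable.iterate i) hB
  have hsub : T ⁻¹' (⋃ i, T^[i] ⁻¹' B) ⊆ ⋃ i, T^[i] ⁻¹' B := by
    intro x hx
    simp only [Set.mem_preimage, Set.mem_iUnion] at hx ⊢
    obtain ⟨i, hi⟩ := hx
    exact ⟨i + 1, by simpa using hi⟩
  rcases hT.ae_empty_or_univ_of_preimage_ae_le hU.nullMeasurableSet hsub.eventuallyLE with h | h
  · have h1 : μ B ≤ μ (⋃ i, T^[i] ⁻¹' B) :=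
      measure_mono (Set.subset_iUnion (fun i => T^[i] ⁻¹' B) 0)
    rw [measure_congr h, measure_empty] at h1
    exact absurd h1 hB0.not_ge
  · filter_upwards [eventuallyEq_univ.1 h] with x hx
    simpa using hx

/-- A set inside `Z` that is independent, relative to `Z`, of a countable partition. -/
theorem exists_relative_indep_subset {μ : Measure X} [IsFiniteMeasure μ]
    (hμ : ∀ E, MeasurableSet E → ∀ t ≤ μ E, ∃ F ⊆ E, MeasurableSet F ∧ μ F = t)
    {κ : Type*} [Countable κ] {q : X → κ} (hq : ∀ c, MeasurableSet (q ⁻¹' {c}))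
    {Z : Set X} (hZ : MeasurableSet Z) {ρ : ENNReal} (hρ : ρ ≤ 1) :
    ∃ B ⊆ Z, MeasurableSet B ∧ ∀ s : Set κ, μ (B ∩ q ⁻¹' s) = ρ * μ (Z ∩ q ⁻¹' s) := by
  have key : ∀ c, ∃ F ⊆ Z ∩ q ⁻¹' {c}, MeasurableSet F ∧ μ F = ρ * μ (Z ∩ q ⁻¹' {c}) :=
    fun c => hμ _ (hZ.inter (hq c)) _ (mul_le_of_le_one_left' hρ)
  choose F hFs hF hFm using key
  have hsum : ∀ (G : Set X), MeasurableSet G → ∀ s : Set κ,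
      μ (G ∩ q ⁻¹' s) = ∑' c : s, μ (G ∩ q ⁻¹' {c.1}) := by
    intro G hG s
    rw [← measure_iUnion]
    · congr 1
      ext x
      simp only [Set.mem_inter_iff, Set.mem_preimage, Set.mem_iUnion, Set.mem_singleton_iff]
      exact ⟨fun h => ⟨⟨q x, h.2⟩, h.1, rfl⟩, fun ⟨c, h1, h2⟩ => ⟨h1, h2 ▸ c.2⟩⟩
    · intro c c' hcc
      rw [Function.onFun, Set.disjoint_left]
      rintro x ⟨-, hx⟩ ⟨-, hx'⟩
      exact hcc (Subtype.ext (hx.symm.trans hx'))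
    · exact fun c => hG.inter (hq c)
  have hBm : MeasurableSet (⋃ c, F c) := MeasurableSet.iUnion hF
  refine ⟨⋃ c, F c, Set.iUnion_subset fun c => (hFs c).trans Set.inter_subset_left, hBm,
    fun s => ?_⟩
  rw [hsum _ hBm, hsum _ hZ, ← ENNReal.tsum_mul_left]
  refine tsum_congr fun c => ?_
  rw [← hFm]
  congr 1
  ext x
  simp only [Set.mem_inter_iff, Set.mem_preimage, Set.mem_iUnion, Set.mem_singleton_iff]
  refine ⟨fun ⟨⟨c', h⟩, h'⟩ => ?_, fun h => ⟨⟨c, h⟩, (hFs c h).2⟩⟩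
  rwa [← h', show q x = c' from (hFs c' h).2]

/-- The names of the columns over `B` form a countable partition of `B`. -/
theorem exists_column_names {T : X → X} (hT : Measurable T) {B C : Set X} (hB : MeasurableSet B)
    (hC : MeasurableSet C) {ι : Type u} [Countable ι] {P : X → ι}
    (hP : ∀ a, MeasurableSet (P ⁻¹' {a})) :
    ∃ (κ : Type u) (_ : Countable κ) (q : X → κ) (len : κ → ℕ) (sym : κ → ℕ → Option ι)
      (mk : κ → Set ℕ), (∀ c, MeasurableSet (q ⁻¹' {c})) ∧ (∀ y, len (q y) = returnTime T B y) ∧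
      (∀ y, ∀ j < returnTime T B y, sym (q y) j = some (P (T^[j] y))) ∧
      (∀ y, ∀ j < returnTime T B y, j ∈ mk (q y) ↔ T^[j] y ∈ C) := by
  classical
  let q : X → Σ k : ℕ, (Fin k → ι × Bool) := fun y =>
    ⟨returnTime T B y, fun j => (P (T^[j] y), decide (T^[j] y ∈ C))⟩
  refine ⟨Σ k : ℕ, (Fin k → ι × Bool), inferInstance, q, fun c => c.1,
    fun c j => if h : j < c.1 then some (c.2 ⟨j, h⟩).1 else none,
    fun c => {j | ∃ h : j < c.1, (c.2 ⟨j, h⟩).2 = true}, ?_, fun y => rfl, ?_, ?_⟩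
  · rintro ⟨k, v⟩
    have : q ⁻¹' {⟨k, v⟩} = returnTime T B ⁻¹' {k} ∩ ⋂ j : Fin k,
        (T^[j] ⁻¹' (P ⁻¹' {(v j).1}) ∩ T^[j] ⁻¹' (if (v j).2 = true then C else Cᶜ)) := by
      ext y
      simp only [Set.mem_preimage, Set.mem_singleton_iff, Set.mem_inter_iff, Set.mem_iInter]
      constructor
      · intro h
        obtain ⟨h1, h2⟩ := Sigma.mk.inj h
        subst h1
        obtain rfl := eq_of_heq h2
        refine ⟨rfl, fun j => ⟨rfl, ?_⟩⟩
        by_cases hj : T^[j] y ∈ C <;> simp [hj]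
      · rintro ⟨rfl, h⟩
        refine Sigma.ext rfl (heq_of_eq (funext fun j => Prod.ext (h j).1 ?_))
        have := (h j).2
        change decide (T^[j] y ∈ C) = (v j).2
        by_cases hj : (v j).2 = true <;> simp_all
    rw [this]
    refine (measurable_returnTime hT hB (measurableSet_singleton k)).inter
      (MeasurableSet.iInter fun j => ((hT.iterate j) (hP _)).inter ((hT.iterate j) ?_))
    split_ifs
    exacts [hC, hC.compl]
  · intro y j hj
    simp [q, hj]
  · intro y j hj
    simp [q, hj]

end Towers

end KosloffVolny

namespace KosloffVolny

section Copying

universe u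

variable {X : Type*} [MeasurableSpace X]

theorem measure_inter_eq_mul_of_partition {μ : Measure X} {κ : Type*} [Countable κ]
    {D : κ → Set X} (hD : ∀ c, MeasurableSet (D c)) (hdis : Pairwise (Function.onFun Disjoint D))
    (hcov : ∀ᵐ x ∂μ, ∃ c, x ∈ D c) {V W : Set X} (hV : MeasurableSet V) (hW : MeasurableSet W)
    {K : ENNReal} (h : ∀ c, μ (D c ∩ (V ∩ W)) = μ (D c ∩ V) * K) : μ (V ∩ W) = μ V * K := by
  have key : ∀ Y, MeasurableSet Y → μ Y = ∑' c, μ (D c ∩ Y) := by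
    intro Y hY
    rw [← measure_iUnion _ fun c => (hD c).inter hY]
    · refine measure_congr ?_
      filter_upwards [hcov] with x ⟨c, hc⟩
      refine propext ⟨fun hx => Set.mem_iUnion.2 ⟨c, hc, hx⟩, fun hx => ?_⟩
      obtain ⟨c', hx⟩ := Set.mem_iUnion.1 hx
      exact hx.2
    · exact fun c c' hcc => (hdis hcc).mono Set.inter_subset_left Set.inter_subset_left
  rw [key _ (hV.inter hW), key _ hV, ← ENNReal.tsum_mul_right]
  exact tsum_congr h

section Deterministic

variable {T : X ≃ᵐ X}

theorem iterate_symm_iterate (T : X ≃ᵐ X) (i : ℕ) (x : X) : T^[i] (T.symm^[i] x) = x :=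
  (Function.LeftInverse.iterate T.apply_symm_apply i) x

theorem symm_iterate_iterate (T : X ≃ᵐ X) (i : ℕ) (x : X) : T.symm^[i] (T^[i] x) = x :=
  (Function.LeftInverse.iterate T.symm_apply_apply i) x

theorem iterate_symm_iterate_of_le (T : X ≃ᵐ X) {i k : ℕ} (h : k ≤ i) (x : X) :
    T^[k] (T.symm^[i] x) = T.symm^[i - k] x := by
  obtain ⟨j, rfl⟩ := Nat.exists_eq_add_of_le h
  rw [Function.iterate_add_apply, iterate_symm_iterate, Nat.add_sub_cancel_left]

theorem symm_iterate_iterate_of_le (T : X ≃ᵐ X) {i k : ℕ} (h : k ≤ i) (x : X) :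
    T.symm^[k] (T^[i] x) = T^[i - k] x := by
  obtain ⟨j, rfl⟩ := Nat.exists_eq_add_of_le h
  rw [Function.iterate_add_apply, symm_iterate_iterate, Nat.add_sub_cancel_left]

theorem returnTime_spec {T : X → X} {B : Set X} {y : X} (h : ∃ k, 1 ≤ k ∧ T^[k] y ∈ B) :
    1 ≤ returnTime T B y ∧ T^[returnTime T B y] y ∈ B :=
  Nat.sInf_mem (s := {k | 1 ≤ k ∧ T^[k] y ∈ B}) h

theorem notMem_of_lt_returnTime {T : X → X} {B : Set X} {y : X} {k : ℕ} (h1 : 1 ≤ k)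
    (h : k < returnTime T B y) : T^[k] y ∉ B := fun hk =>
  Nat.notMem_of_lt_sInf (s := {k | 1 ≤ k ∧ T^[k] y ∈ B}) h ⟨h1, hk⟩

theorem level_iterate {B : Set X} {y : X} (hy : y ∈ B) {i : ℕ} (hi : i < returnTime T B y) :
    level T.symm B (T^[i] y) = i := by
  refine le_antisymm (Nat.sInf_le (by simpa [symm_iterate_iterate] using hy)) ?_
  by_contra! hlt
  have hmem : T.symm^[level T.symm B (T^[i] y)] (T^[i] y) ∈ B :=
    Nat.sInf_mem (s := {k | T.symm^[k] (T^[i] y) ∈ B})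
      ⟨i, by simpa [symm_iterate_iterate] using hy⟩
  rw [symm_iterate_iterate_of_le T hlt.le] at hmem
  exact notMem_of_lt_returnTime (by omega) (by omega) hmem

theorem level_lt_returnTime {B : Set X} {x : X} (hx : ∃ i, T.symm^[i] x ∈ B)
    (hy : ∃ k, 1 ≤ k ∧ T^[k] (T.symm^[level T.symm B x] x) ∈ B) :
    T.symm^[level T.symm B x] x ∈ B ∧
      level T.symm B x < returnTime T B (T.symm^[level T.symm B x] x) := by
  refine ⟨Nat.sInf_mem (s := {k | T.symm^[k] x ∈ B}) hx, ?_⟩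
  by_contra! hle
  have h := returnTime_spec hy
  rw [iterate_symm_iterate_of_le T hle] at h
  exact Nat.notMem_of_lt_sInf (s := {k | T.symm^[k] x ∈ B})
    (m := level T.symm B x - returnTime T B (T.symm^[level T.symm B x] x))
    (Nat.sub_lt_self (by omega) hle) h.2

/-- The label of a point, given labels of the columns over `B`. -/
noncomputable def towerLabel {L : Type*} (T : X ≃ᵐ X) (B : Set X) (w : X → ℕ → L) (x : X) : L :=
  w (T.symm^[level T.symm B x] x) (level T.symm B x)

theorem measurable_towerLabel {L : Type*} [MeasurableSpace L] {B : Set X} (hB : MeasurableSet B)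
    {w : X → ℕ → L} (hw : Measurable w) : Measurable (towerLabel T B w) := by
  have h1 : Measurable fun p : X × ℕ => w (T.symm^[p.2] p.1) p.2 :=
    measurable_from_prod_countable_left fun i =>
      (measurable_pi_apply i).comp (hw.comp (T.symm.measurable.iterate i))
  exact h1.comp (measurable_id.prodMk (measurable_level T.symm.measurable hB))

theorem towerLabel_iterate {L : Type*} {B : Set X} {w : X → ℕ → L} {y : X} (hy : y ∈ B) {i : ℕ}
    (hi : i < returnTime T B y) : towerLabel T B w (T^[i] y) = w y i := by
  rw [towerLabel, level_iterate hy hi, symm_iterate_iterate]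

theorem towerLabel_window {L : Type*} {B : Set X} {w : X → ℕ → L} {z : L} {n : ℕ} {y : X}
    (hy : y ∈ B) (hy' : T^[returnTime T B y] y ∈ B)
    (hn : n ≤ returnTime T B (T^[returnTime T B y] y))
    (hz : ∀ j < n, w y (returnTime T B y + j) = z)
    (hz' : ∀ j < n, w (T^[returnTime T B y] y) j = z) {i : ℕ} (hi : i < returnTime T B y) {j : ℕ}
    (hj : j < n) : towerLabel T B w (T^[j] (T^[i] y)) = w y (i + j) := by
  rw [← Function.iterate_add_apply, add_comm j i]
  rcases lt_or_ge (i + j) (returnTime T B y) with h | h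
  · exact towerLabel_iterate hy h
  · obtain ⟨k, hk⟩ := Nat.exists_eq_add_of_le h
    rw [hk, hz k (by omega), add_comm, Function.iterate_add_apply,
      towerLabel_iterate hy' (by omega), hz' k (by omega)]

end Deterministic

theorem exists_separated_set {μ : Measure X} [IsProbabilityMeasure μ] {T : X → X}
    (hT : MeasurePreserving T μ μ) (hap : Aperiodic T μ) (N : ℕ) :
    ∃ Z, MeasurableSet Z ∧ 0 < μ Z ∧
      ∀ x i j, i < j → T^[i] x ∈ Z → T^[j] x ∈ Z → i + N ≤ j := by
  obtain ⟨Z, -, hZ, hZ0, hd⟩ := exists_subset_disjoint_preimages hT hap N MeasurableSet.univ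
    (by simp)
  refine ⟨Z, hZ, hZ0, fun x i j hij hi hj => ?_⟩
  by_contra! hlt
  refine Set.disjoint_left.1 (hd (j - i) (by omega) (by omega)) hi ?_
  rwa [Set.mem_preimage, ← Function.iterate_add_apply, Nat.sub_add_cancel hij.le]

end Copying

end KosloffVolny

namespace KosloffVolny

section Copying

universe u

variable {X : Type*} [MeasurableSpace X]

/-- The places in a column, with top at `l`, that carry a mark. -/
noncomputable def markPlaces (l : ℕ) (s : Set ℕ) : Finset ℕ := by
  classical exact (Finset.range (l + 1)).filter fun m => m = 0 ∨ m = l ∨ m ∈ s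

theorem mem_markPlaces_iff {T : X → X} {Z B : Set X} (hBZ : B ⊆ Z) {y : X} (hy : y ∈ B)
    (hr : ∃ k, 1 ≤ k ∧ T^[k] y ∈ B) {s : Set ℕ}
    (hs : ∀ j < returnTime T B y, j ∈ s ↔ T^[j] y ∈ Z \ B) (m : ℕ) :
    m ∈ markPlaces (returnTime T B y) s ↔ m ≤ returnTime T B y ∧ T^[m] y ∈ Z := by
  have h := returnTime_spec hr
  simp only [markPlaces, Finset.mem_filter, Finset.mem_range, Nat.lt_succ_iff]
  refine and_congr_right fun hm => ⟨?_, fun hmZ => ?_⟩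
  · rintro (rfl | rfl | hms)
    · exact hBZ hy
    · exact hBZ h.2
    · rcases hm.lt_or_eq with hlt | rfl
      · exact ((hs m hlt).1 hms).1
      · exact hBZ h.2
  · rcases Nat.eq_zero_or_pos m with rfl | hm0
    · exact Or.inl rfl
    rcases hm.lt_or_eq with hlt | rfl
    · exact Or.inr (Or.inr ((hs m hlt).2 ⟨hmZ, notMem_of_lt_returnTime hm0 hlt⟩))
    · exact Or.inr (Or.inl rfl)

theorem iterate_mem_iff_eq_zero_or {T : X → X} {B : Set X} {y : X} (hy : y ∈ B)
    (hr : ∃ k, 1 ≤ k ∧ T^[k] y ∈ B) {m : ℕ} (hm : m ≤ returnTime T B y) :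
    T^[m] y ∈ B ↔ m = 0 ∨ m = returnTime T B y := by
  have h := returnTime_spec hr
  refine ⟨fun hmB => ?_, ?_⟩
  · by_contra! hne
    exact notMem_of_lt_returnTime (by omega) (by omega) hmB
  · rintro (rfl | rfl)
    exacts [hy, h.2]

theorem iterate_eq_of_add_eq (T : X ≃ᵐ X) {m n i r : ℕ} {y : X} (h : m + n = i + r) :
    T^[m] y = T^[r] (T.symm^[n] (T^[i] y)) := by
  rcases le_total i n with hin | hin
  · obtain ⟨k, rfl⟩ := Nat.exists_eq_add_of_le hin
    obtain rfl : r = m + k := by omega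
    rw [add_comm i k, Function.iterate_add_apply T.symm k i, symm_iterate_iterate,
      Function.iterate_add_apply, iterate_symm_iterate]
  · rw [symm_iterate_iterate_of_le T hin, ← Function.iterate_add_apply]
    congr 1
    omega

/-- The place of a mark seen from the level `i` of a column. -/
theorem mark_offset {T : X ≃ᵐ X} {Z B : Set X} (hBZ : B ⊆ Z) {n : ℕ}
    (hZ : ∀ x i j, i < j → T^[i] x ∈ Z → T^[j] x ∈ Z → i + 2 * n ≤ j) {y : X} (hy : y ∈ B)
    (hr : ∃ k, 1 ≤ k ∧ T^[k] y ∈ B) {i r : ℕ} (hi : i < returnTime T B y)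
    (hrn : r < 2 * n) (hmem : T^[r] (T.symm^[n] (T^[i] y)) ∈ Z) :
    ∃ m ≤ returnTime T B y, m + n = i + r ∧ T^[m] y = T^[r] (T.symm^[n] (T^[i] y)) := by
  have h := returnTime_spec hr
  rcases lt_or_ge (i + r) n with hlt | hge
  · exfalso
    have e : T^[n - i] (T.symm^[n] (T^[i] y)) = y := by
      rw [iterate_symm_iterate_of_le T (Nat.sub_le n i), Nat.sub_sub_self (by omega),
        symm_iterate_iterate]
    have := hZ (T.symm^[n] (T^[i] y)) r (n - i) (by omega) hmem (by rw [e]; exact hBZ hy)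
    omega
  · obtain ⟨m, hm⟩ := Nat.exists_eq_add_of_le hge
    have e := iterate_eq_of_add_eq T (y := y) (show m + n = i + r by omega)
    refine ⟨m, ?_, by omega, e⟩
    by_contra! hlt
    have := hZ y _ m hlt (hBZ h.2) (e ▸ hmem)
    omega

set_option maxHeartbeats 2000000 in
theorem exists_indep_window {μ : Measure X} [IsProbabilityMeasure μ] {T : X ≃ᵐ X}
    (hT : Ergodic T μ) (hap : Aperiodic T μ) {n : ℕ} (hn : 0 < n)
    {L : Type*} [Fintype L] [MeasurableSpace L] [MeasurableSingletonClass L] (z : L)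
    (π : Measure L) [IsProbabilityMeasure π] (h0 : 0 < π {z}) (h1 : π {z} < 1)
    {ι : Type u} [Countable ι] {P : X → ι} (hP : ∀ a, MeasurableSet (P ⁻¹' {a})) :
    ∃ g : X → L, Measurable g ∧ ∀ (a : ι) (u : ℕ → L),
      μ (P ⁻¹' {a} ∩ {x | ∀ j < n, g (T^[j] x) = u j}) =
        μ (P ⁻¹' {a}) * ∏ j ∈ Finset.range n, π {u j} := by
  classical
  have hTm := hT.toMeasurePreserving
  have hSm : MeasurePreserving T.symm μ μ := hTm.symm
  have hsplit := hap.exists_subset_measure_eq hTm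
  have hρ0 : 0 < π {z} ^ n := by positivity
  have hρ1 : π {z} ^ n < 1 := pow_lt_one₀ zero_le h1 hn.ne'
  set Q := Measure.infinitePi (fun _ : ℕ => π) with hQ
  obtain ⟨Z, hZ, hZ0, hsep⟩ := exists_separated_set hTm hap (2 * n)
  let Φ : X → Fin (2 * n) → ι := fun y r => P (T^[n] (T.symm^[r] y))
  have hΦ : ∀ c, MeasurableSet (Φ ⁻¹' {c}) := by
    intro c
    have : Φ ⁻¹' {c} = ⋂ r : Fin (2 * n), T.symm^[r] ⁻¹' (T^[n] ⁻¹' (P ⁻¹' {c r})) := by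
      ext y; simp [Φ, funext_iff]
    rw [this]
    exact MeasurableSet.iInter fun r =>
      (hSm.measurable.iterate r) ((hTm.measurable.iterate n) (hP _))
  obtain ⟨B, hBZ, hB, hBρ⟩ := exists_relative_indep_subset hsplit hΦ hZ hρ1.le
  have hB0 : 0 < μ B := by
    have := hBρ Set.univ
    simp only [Set.preimage_univ, Set.inter_univ] at this
    rw [this]
    exact ENNReal.mul_pos hρ0.ne' hZ0.ne'
  obtain ⟨κ, hκ, q, len, sym, mk, hq, hlen, hsym, hmk⟩ :=
    exists_column_names hTm.measurable hB (hZ.diff hB) hP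
  let τ : κ → ℕ → Bool := fun c m => decide (m = 0 ∨ m = len c)
  let M : κ → Finset ℕ := fun c => markPlaces (len c) (mk c)
  let E : κ → Set (ℕ → L) := fun c => markSets n z (τ c) (M c)
  have hEm : ∀ c, MeasurableSet (E c) := fun c => measurableSet_markSets n z (τ c) (M c)
  let ν : κ → Measure (ℕ → L) := fun c => if Q (E c) = 0 then Q else Q[|E c]
  have hν : ∀ c, IsProbabilityMeasure (ν c) := by
    intro c
    by_cases hc : Q (E c) = 0
    · simp only [ν, hc, if_true]; infer_instance
    · simp only [ν, hc, if_false]; exact cond_isProbabilityMeasure hc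
  have : Nonempty L := ⟨z⟩
  obtain ⟨w, hw, hwl⟩ := exists_measurable_cylinder_law hsplit hq hB ν (fun c => len c + n)
  have hEdep : ∀ c, DependsOn (· ∈ E c) (Set.Iio (len c + n)) := by
    intro c
    refine (dependsOn_markSets n z (τ c) (M c)).mono ?_
    refine Set.iUnion₂_subset fun m hm => ?_
    intro x hx
    simp only [M, markPlaces, Finset.mem_filter, Finset.mem_range] at hm
    simp only [Set.mem_Ico, Set.mem_Iio] at hx ⊢
    omega
  set G₀ : Set X := {x | (∃ i, T.symm^[i] x ∈ B) ∧ (∃ k, 1 ≤ k ∧ T^[k] x ∈ B) ∧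
      (x ∈ B → Q (E (q x)) ≠ 0 → w x ∈ E (q x))} with hG₀
  have hgood : ∀ᵐ x ∂μ, x ∈ G₀ := by
    have hw' : ∀ᵐ x ∂μ, ∀ c, ¬ (x ∈ B ∩ q ⁻¹' {c} ∩ w ⁻¹' (E c)ᶜ ∧ Q (E c) ≠ 0) := by
      rw [ae_all_iff]
      intro c
      by_cases hc : Q (E c) = 0
      · simp [hc]
      · have hdep : DependsOn (· ∈ (E c)ᶜ) (Set.Iio (len c + n)) := by
          intro x y hxy
          exact congrArg Not (hEdep c hxy)
        have := hwl c (E c)ᶜ hdep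
        have hz : ν c (E c)ᶜ = 0 := by
          simp only [ν, hc, if_false]
          rw [cond_apply (hEm c), Set.inter_compl_self, measure_empty, mul_zero]
        rw [hz, mul_zero] at this
        filter_upwards [measure_eq_zero_iff_ae_notMem.1 this] with x hx using fun h => hx h.1
    have hf1 := hT.ae_exists_iterate_mem hB hB0
    have hf2 := hTm.quasiMeasurePreserving.ae hf1
    filter_upwards [hT.symm.ae_exists_iterate_mem hB hB0, hf2, hw'] with x hx1 hx2 hx3
    refine ⟨hx1, ?_, fun hxB hx0 => ?_⟩
    · obtain ⟨k, hk⟩ := hx2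
      exact ⟨k + 1, by omega, hk⟩
    · by_contra hne
      exact hx3 (q x) ⟨⟨⟨hxB, rfl⟩, hne⟩, hx0⟩
  set G : Set X := {x | ∀ i k, T^[k] (T.symm^[i] x) ∈ G₀} with hGdef
  have hG : ∀ᵐ x ∂μ, x ∈ G := by
    refine ae_all_iff.2 fun i => ae_all_iff.2 fun k => ?_
    exact (hSm.iterate i).quasiMeasurePreserving.ae
      ((hTm.iterate k).quasiMeasurePreserving.ae hgood)
  have hMmem : ∀ y ∈ B, y ∈ G₀ → ∀ m, m ∈ M (q y) ↔ m ≤ returnTime T B y ∧ T^[m] y ∈ Z := by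
    intro y hy hyG m
    simp only [M, hlen]
    exact mem_markPlaces_iff hBZ hy hyG.2.1 (hmk y) m
  have hMsep : ∀ y ∈ B, y ∈ G₀ → ∀ a ∈ M (q y), ∀ b ∈ M (q y), a < b → a + 2 * n ≤ b := by
    intro y hy hyG a ha b hb hab
    exact hsep y a b hab ((hMmem y hy hyG a).1 ha).2 ((hMmem y hy hyG b).1 hb).2
  have hτ : ∀ y ∈ B, y ∈ G₀ → ∀ m ≤ returnTime T B y, τ (q y) m = true ↔ T^[m] y ∈ B := by
    intro y hy hyG m hm
    rw [iterate_mem_iff_eq_zero_or hy hyG.2.1 hm]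
    simp [τ, hlen]
  have hQE : ∀ y ∈ B, y ∈ G₀ → Q (E (q y)) ≠ 0 := fun y hy hyG =>
    (infinitePi_markSets_pos hρ0 hρ1 (τ (q y)) (hMsep y hy hyG)).ne'
  have hzero : ∀ y ∈ B, y ∈ G₀ → ∀ m ≤ returnTime T B y, T^[m] y ∈ B → ∀ j < n,
      w y (m + j) = z := by
    intro y hy hyG m hm hmB
    have h1 := hyG.2.2 hy (hQE y hy hyG) m ((hMmem y hy hyG m).2 ⟨hm, hBZ hmB⟩)
    rw [(hτ y hy hyG m hm).2 hmB] at h1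
    exact h1
  have hwin : ∀ y ∈ B, (∀ k, T^[k] y ∈ G₀) → ∀ i < returnTime T B y, ∀ j < n,
      towerLabel T B w (T^[j] (T^[i] y)) = w y (i + j) := by
    intro y hy hyG i hi j hj
    have hr := returnTime_spec (hyG 0).2.1
    have hr' := returnTime_spec (hyG (returnTime T B y)).2.1
    refine towerLabel_window (z := z) hy hr.2 ?_ (hzero y hy (hyG 0) _ le_rfl hr.2) ?_ hi hj
    · have := hsep (T^[returnTime T B y] y) 0 _ hr'.1 (hBZ hr.2) (hBZ hr'.2)
      omega
    · intro j hj
      simpa using hzero _ hr.2 (hyG _) 0 (Nat.zero_le _) hr.2 j hj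
  let D : ℕ × κ → Set X := fun p =>
    {x | T.symm^[p.1] x ∈ B ∧ q (T.symm^[p.1] x) = p.2 ∧ p.1 < len p.2}
  have hDeq : ∀ p : ℕ × κ, p.1 < len p.2 → D p = T.symm^[p.1] ⁻¹' (B ∩ q ⁻¹' {p.2}) := by
    intro p hp
    ext x
    simp [D, hp]
  have hDm : ∀ p, MeasurableSet (D p) := by
    intro p
    by_cases hp : p.1 < len p.2
    · rw [hDeq p hp]
      exact (hSm.measurable.iterate _) (hB.inter (hq _))
    · simp [D, hp]
  have hDG : ∀ p, ∀ x ∈ D p, ∃ y ∈ B, T.symm^[p.1] x = y ∧ x = T^[p.1] y ∧ q y = p.2 ∧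
      p.1 < returnTime T B y := by
    rintro p x ⟨h1, h2, h3⟩
    refine ⟨_, h1, rfl, (iterate_symm_iterate T _ _).symm, h2, ?_⟩
    rwa [← hlen, h2]
  have hdis : Pairwise (Function.onFun Disjoint D) := by
    intro p p' hpp
    refine Set.disjoint_left.2 fun x hx hx' => hpp ?_
    obtain ⟨y, hy, hxy, rfl, hqy, hi⟩ := hDG p x hx
    obtain ⟨y', hy', hxy', hyy', hqy', hi'⟩ := hDG p' _ hx'
    have e1 := level_iterate hy hi
    have e2 := level_iterate hy' hi'
    rw [← hyy', e1] at e2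
    refine Prod.ext e2 ?_
    rw [e2] at hyy'
    rw [← hqy, ← hqy', show y = y' from hxy.symm.trans (e2 ▸ hxy')]
  have hcov : ∀ᵐ x ∂μ, ∃ p, x ∈ D p := by
    filter_upwards [hG] with x hx
    have h0 := hx 0 0
    obtain ⟨h1, h2⟩ := level_lt_returnTime h0.1 (hx (level T.symm B x) 0).2.1
    exact ⟨(level T.symm B x, q (T.symm^[level T.symm B x] x)), h1, rfl, by rwa [hlen]⟩
  have hg := measurable_towerLabel (T := T) hB hw
  refine ⟨towerLabel T B w, hg, fun a u => ?_⟩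
  set W : Set X := {x | ∀ j < n, towerLabel T B w (T^[j] x) = u j} with hWdef
  have hW : MeasurableSet W := by
    have : W = ⋂ j, ⋂ _ : j < n, (fun x => towerLabel T B w (T^[j] x)) ⁻¹' {u j} := by
      ext x; simp [W]
    rw [this]
    exact MeasurableSet.iInter fun j => MeasurableSet.iInter fun _ =>
      (hg.comp (hTm.measurable.iterate j)) (measurableSet_singleton _)
  have hmain : ∀ (V : Set X) (K : ENNReal), MeasurableSet V →
      (∀ p, ∀ x ∈ G, ∀ x' ∈ G, x ∈ D p → x' ∈ D p → x ∈ V → x' ∈ V) →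
      (∀ p, ∀ x ∈ G, x ∈ D p → x ∈ V → Q[cyl n u p.1 | E p.2] = K) → μ (V ∩ W) = μ V * K := by
    intro V K hV hV1 hV2
    refine measure_inter_eq_mul_of_partition hDm hdis hcov hV hW fun p => ?_
    by_cases hex : ∃ x ∈ G, x ∈ D p ∧ x ∈ V
    · obtain ⟨x, hxG, hxD, hxV⟩ := hex
      have hK := hV2 p x hxG hxD hxV
      have hp := hxD.2.2
      have hνK : ν p.2 (cyl n u p.1) = K := by
        obtain ⟨y, hy, hxy, -, hqy, -⟩ := hDG p x hxD
        have := hQE y hy (hxy ▸ hxG p.1 0)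
        rw [hqy] at this
        simp only [ν, this, if_false, hK]
      have e1 : μ (D p ∩ V) = μ (B ∩ q ⁻¹' {p.2}) := by
        rw [← (hSm.iterate p.1).measure_preimage (hB.inter (hq _)).nullMeasurableSet, ← hDeq p hp]
        refine measure_congr ?_
        filter_upwards [hG] with x' hx'
        exact propext ⟨fun h => h.1, fun h => ⟨h, hV1 p x hxG x' hx' hxD h hxV⟩⟩
      have e2 : μ (D p ∩ (V ∩ W)) = μ (B ∩ q ⁻¹' {p.2} ∩ w ⁻¹' (cyl n u p.1)) := by
        rw [← (hSm.iterate p.1).measure_preimage ((hB.inter (hq _)).inter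
          (hw (measurableSet_cyl _ _ _))).nullMeasurableSet, Set.preimage_inter, ← hDeq p hp]
        refine measure_congr ?_
        filter_upwards [hG] with x' hx'
        have hiff : x' ∈ D p → (x' ∈ W ↔ x' ∈ T.symm^[p.1] ⁻¹' (w ⁻¹' (cyl n u p.1))) := by
          intro h
          obtain ⟨y, hy, hxy, hx'y, hqy, hi⟩ := hDG p x' h
          have hyG : ∀ k, T^[k] y ∈ G₀ := fun k => hxy ▸ hx' p.1 k
          simp only [W, cyl, Set.mem_ofPred_eq, Set.mem_preimage, hxy]
          refine forall₂_congr fun j hj => ?_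
          rw [hx'y, hwin y hy hyG p.1 hi j hj]
        refine propext ⟨fun h => ⟨h.1, (hiff h.1).1 h.2.2⟩, fun h =>
          ⟨h.1, hV1 p x hxG x' hx' hxD h.1 hxV, (hiff h.1).2 h.2⟩⟩
      rw [e1, e2, hwl p.2 _ ((dependsOn_cyl n u p.1).mono fun j hj => ?_), hνK]
      simp only [Set.mem_Ico, Set.mem_Iio] at hj ⊢
      omega
    · have e : ∀ᵐ x ∂μ, x ∉ D p ∩ V := by
        filter_upwards [hG] with x hx h
        exact hex ⟨x, hx, h.1, h.2⟩
      have e1 := measure_eq_zero_iff_ae_notMem.2 e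
      rw [e1, zero_mul]
      exact measure_mono_null (Set.inter_subset_inter_right _ Set.inter_subset_left) e1
  have hPD : ∀ p, ∀ x ∈ D p, ∀ x' ∈ D p, P x = P x' := by
    intro p x hx x' hx'
    obtain ⟨y, hy, -, rfl, hqy, hi⟩ := hDG p x hx
    obtain ⟨y', hy', -, rfl, hqy', hi'⟩ := hDG p _ hx'
    have e1 := hsym y p.1 hi
    have e2 := hsym y' p.1 hi'
    rw [hqy] at e1
    rw [hqy', e1] at e2
    exact Option.some_injective _ e2
  let V : ℕ → Bool → Set X := fun r b =>
    {x | T^[r] (T.symm^[n] x) ∈ if b = true then B else Z \ B}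
  let V₀ : Set X := {x | ∀ r, 0 < r → r < 2 * n → T^[r] (T.symm^[n] x) ∉ Z}
  have hpt : ∀ r, MeasurePreserving (fun x => T^[r] (T.symm^[n] x)) μ μ := fun r =>
    (hTm.iterate r).comp (hSm.iterate n)
  have hVm : ∀ r b, MeasurableSet (V r b) := by
    intro r b
    refine (hpt r).measurable ?_
    cases b
    exacts [hZ.diff hB, hB]
  have hV₀m : MeasurableSet V₀ := by
    have : V₀ = ⋂ r, ⋂ _ : 0 < r, ⋂ _ : r < 2 * n, ((fun x => T^[r] (T.symm^[n] x)) ⁻¹' Z)ᶜ := by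
      ext x; simp [V₀]
    rw [this]
    exact MeasurableSet.iInter fun r => MeasurableSet.iInter fun _ =>
      MeasurableSet.iInter fun _ => ((hpt r).measurable hZ).compl
  have hVZ : ∀ r b, ∀ x ∈ V r b, T^[r] (T.symm^[n] x) ∈ Z := by
    intro r b x hx
    cases b
    · exact hx.1
    · exact hBZ hx
  have hViff : ∀ r b, r < 2 * n → ∀ p, ∀ x ∈ G, x ∈ D p →
      (x ∈ V r b ↔ ∃ m ∈ M p.2, m + n = p.1 + r ∧ τ p.2 m = b) := by
    intro r b hr p x hxG hxD
    obtain ⟨y, hy, hxy, rfl, hqy, hi⟩ := hDG p x hxD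
    have hyG : y ∈ G₀ := hxy ▸ hxG p.1 0
    rw [← hqy]
    have hbτ : ∀ m ≤ returnTime T B y, T^[m] y ∈ Z →
        (T^[m] y ∈ (if b = true then B else Z \ B) ↔ τ (q y) m = b) := by
      intro m hm hmZ
      have := hτ y hy hyG m hm
      cases b
      · refine ⟨fun h => ?_, fun h => ⟨hmZ, fun hmB => ?_⟩⟩
        · exact Bool.eq_false_iff.2 fun h' => h.2 (this.1 h')
        · exact Bool.eq_false_iff.1 h (this.2 hmB)
      · exact this.symm
    constructor
    · intro hx
      obtain ⟨m, hm, hmn, he⟩ := mark_offset hBZ hsep hy hyG.2.1 hi hr (hVZ r b _ hx)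
      have hmZ : T^[m] y ∈ Z := he ▸ hVZ r b _ hx
      refine ⟨m, (hMmem y hy hyG m).2 ⟨hm, hmZ⟩, hmn, (hbτ m hm hmZ).1 ?_⟩
      rw [he]
      exact hx
    · rintro ⟨m, hmM, hmn, hmb⟩
      obtain ⟨hm, hmZ⟩ := (hMmem y hy hyG m).1 hmM
      have := (hbτ m hm hmZ).2 hmb
      rw [iterate_eq_of_add_eq T hmn] at this
      exact this
  have hV₀iff : ∀ p, ∀ x ∈ G, x ∈ D p →
      (x ∈ V₀ ↔ ∀ m ∈ M p.2, m + n ≤ p.1 ∨ p.1 + n ≤ m) := by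
    intro p x hxG hxD
    obtain ⟨y, hy, hxy, rfl, hqy, hi⟩ := hDG p x hxD
    have hyG : y ∈ G₀ := hxy ▸ hxG p.1 0
    rw [← hqy]
    constructor
    · intro hx m hmM
      by_contra! hne
      refine hx (m + n - p.1) (by omega) (by omega) ?_
      rw [← iterate_eq_of_add_eq T (show m + n = p.1 + (m + n - p.1) by omega)]
      exact ((hMmem y hy hyG m).1 hmM).2
    · intro h r hr0 hr hmem
      obtain ⟨m, hm, hmn, he⟩ := mark_offset hBZ hsep hy hyG.2.1 hi hr hmem
      have := h m ((hMmem y hy hyG m).2 ⟨hm, he ▸ hmem⟩)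
      omega
  have hsepD : ∀ p, ∀ x ∈ G, x ∈ D p → ∀ a ∈ M p.2, ∀ b ∈ M p.2, a < b → a + 2 * n ≤ b := by
    intro p x hxG hxD
    obtain ⟨y, hy, hxy, rfl, hqy, hi⟩ := hDG p x hxD
    rw [← hqy]
    exact hMsep y hy (hxy ▸ hxG p.1 0)
  set R : ENNReal := ∏ j ∈ Finset.range n, π {u j} with hR
  have hPa := hP a
  have hfar : μ (P ⁻¹' {a} ∩ V₀ ∩ W) = μ (P ⁻¹' {a} ∩ V₀) * R := by
    refine hmain _ _ (hPa.inter hV₀m) ?_ ?_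
    · rintro p x hxG x' hxG' hxD hxD' ⟨h1, h2⟩
      exact ⟨(hPD p x hxD x' hxD').symm.trans h1,
        (hV₀iff p x' hxG' hxD').2 ((hV₀iff p x hxG hxD).1 h2)⟩
    · rintro p x hxG hxD ⟨-, h2⟩
      exact cond_cyl_markSets_of_far hρ0 hρ1 _ (hsepD p x hxG hxD) u p.1
        ((hV₀iff p x hxG hxD).1 h2)
  have hnear : ∀ r b, 0 < r → r < 2 * n → μ (P ⁻¹' {a} ∩ V r b ∩ W) =
      μ (P ⁻¹' {a} ∩ V r b) * Q[cyl n u n | markSet n z b r] := by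
    intro r b hr0 hr
    refine hmain _ _ (hPa.inter (hVm r b)) ?_ ?_
    · rintro p x hxG x' hxG' hxD hxD' ⟨h1, h2⟩
      exact ⟨(hPD p x hxD x' hxD').symm.trans h1,
        (hViff r b hr p x' hxG' hxD').2 ((hViff r b hr p x hxG hxD).1 h2)⟩
    · rintro p x hxG hxD ⟨-, h2⟩
      obtain ⟨m, hmM, hmn, hmb⟩ := (hViff r b hr p x hxG hxD).1 h2
      rw [cond_cyl_markSets_of_near hρ0 hρ1 (τ p.2) (hsepD p x hxG hxD) u hmM (by omega)
        (by omega), hmb, ← cond_cyl_markSet_shift b u p.1 m n, hmn, add_comm p.1 n,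
        add_comm p.1 r, cond_cyl_markSet_shift]
  have hVρ : ∀ r, r < 2 * n → μ (P ⁻¹' {a} ∩ V r true) =
      π {z} ^ n * μ (P ⁻¹' {a} ∩ {x | T^[r] (T.symm^[n] x) ∈ Z}) := by
    intro r hr
    have e : ∀ Y : Set X, MeasurableSet Y → μ (P ⁻¹' {a} ∩ {x | T^[r] (T.symm^[n] x) ∈ Y}) =
        μ (Y ∩ Φ ⁻¹' {v | v ⟨r, hr⟩ = a}) := by
      intro Y hY
      have hm : MeasurableSet (Φ ⁻¹' {v | v ⟨r, hr⟩ = a}) :=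
        (hSm.measurable.iterate r) ((hTm.measurable.iterate n) hPa)
      rw [← (hpt r).measure_preimage (hY.inter hm).nullMeasurableSet]
      congr 1
      ext x
      simp only [Set.mem_inter_iff, Set.mem_preimage, Set.mem_singleton_iff, Set.mem_ofPred_eq, Φ,
        symm_iterate_iterate, iterate_symm_iterate]
      exact and_comm
    rw [e Z hZ, ← hBρ, ← e B hB]
    rfl
  have hnear' : ∀ r, 0 < r → r < 2 * n →
      μ (P ⁻¹' {a} ∩ {x | T^[r] (T.symm^[n] x) ∈ Z} ∩ W) =
        μ (P ⁻¹' {a} ∩ {x | T^[r] (T.symm^[n] x) ∈ Z}) * R := by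
    intro r hr0 hr
    set Y := P ⁻¹' {a} ∩ {x | T^[r] (T.symm^[n] x) ∈ Z} with hY
    have hu : P ⁻¹' {a} ∩ V r true ∪ P ⁻¹' {a} ∩ V r false = Y := by
      rw [← Set.inter_union_distrib_left, hY]
      congr 1
      ext x
      simp only [V, Set.mem_union, Set.mem_ofPred_eq, if_true, Bool.false_eq_true, if_false]
      refine ⟨?_, fun h => ?_⟩
      · rintro (h | h)
        exacts [hBZ h, h.1]
      · by_cases hb : T^[r] (T.symm^[n] x) ∈ B
        exacts [Or.inl hb, Or.inr ⟨h, hb⟩]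
    have hd : Disjoint (P ⁻¹' {a} ∩ V r true) (P ⁻¹' {a} ∩ V r false) :=
      Set.disjoint_left.2 fun x hx hx' => hx'.2.2 hx.2
    have e1 : μ (P ⁻¹' {a} ∩ V r true) = π {z} ^ n * μ Y := hVρ r hr
    have e2 : μ (P ⁻¹' {a} ∩ V r false) = (1 - π {z} ^ n) * μ Y := by
      have := measure_union (μ := μ) hd (hPa.inter (hVm r false))
      rw [hu, e1] at this
      rw [ENNReal.sub_mul fun _ _ => measure_ne_top _ _, one_mul]
      refine ENNReal.eq_sub_of_add_eq (ENNReal.mul_ne_top (by finiteness) (measure_ne_top _ _)) ?_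
      rw [add_comm, ← this]
    rw [← hu, Set.union_inter_distrib_right, measure_union
      (hd.mono Set.inter_subset_left Set.inter_subset_left)
      ((hPa.inter (hVm r false)).inter hW), hnear r true hr0 hr, hnear r false hr0 hr, hu, e1, e2,
      hR, ← cond_cyl_markSet_add u n r]
    ring
  have hsplitP : ∀ Y : Set X, MeasurableSet Y → μ (P ⁻¹' {a} ∩ Y) = μ (P ⁻¹' {a} ∩ V₀ ∩ Y) +
      ∑ r ∈ Finset.Ioo 0 (2 * n), μ (P ⁻¹' {a} ∩ {x | T^[r] (T.symm^[n] x) ∈ Z} ∩ Y) := by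
    intro Y hY
    have hm : ∀ r, MeasurableSet (P ⁻¹' {a} ∩ {x | T^[r] (T.symm^[n] x) ∈ Z} ∩ Y) := fun r =>
      (hPa.inter ((hpt r).measurable hZ)).inter hY
    rw [← measure_biUnion_finset _ fun r _ => hm r, ← measure_union]
    · congr 1
      ext x
      simp only [V₀, Set.mem_union, Set.mem_inter_iff, Set.mem_iUnion, Set.mem_ofPred_eq,
        Finset.mem_Ioo, exists_prop]
      constructor
      · rintro ⟨h1, h2⟩
        by_cases h : ∀ r, 0 < r → r < 2 * n → T^[r] (T.symm^[n] x) ∉ Z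
        · exact Or.inl ⟨⟨h1, h⟩, h2⟩
        · push Not at h
          obtain ⟨r, hr0, hr, hrZ⟩ := h
          exact Or.inr ⟨r, ⟨hr0, hr⟩, ⟨h1, hrZ⟩, h2⟩
      · rintro (⟨⟨h1, -⟩, h2⟩ | ⟨r, -, ⟨h1, -⟩, h2⟩)
        exacts [⟨h1, h2⟩, ⟨h1, h2⟩]
    · refine Set.disjoint_left.2 fun x hx hx' => ?_
      simp only [Set.mem_iUnion, Finset.mem_Ioo, exists_prop] at hx'
      obtain ⟨r, ⟨hr0, hr⟩, hx'⟩ := hx'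
      exact hx.1.2 r hr0 hr hx'.1.2
    · exact Finset.measurableSet_biUnion _ fun r _ => hm r
    · intro r hr r' hr' hne
      refine Set.disjoint_left.2 fun x hx hx' => ?_
      simp only [Finset.coe_Ioo, Set.mem_Ioo] at hr hr'
      rcases hne.lt_or_gt with h | h
      · have := hsep _ r r' h hx.1.2 hx'.1.2
        omega
      · have := hsep _ r' r h hx'.1.2 hx.1.2
        omega
  rw [hsplitP W hW, hfar, ← Set.inter_univ (P ⁻¹' {a}), hsplitP Set.univ MeasurableSet.univ,
    add_mul, Finset.sum_mul]
  simp only [Set.inter_univ]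
  congr 1
  refine Finset.sum_congr rfl fun r hr => ?_
  rw [Finset.mem_Ioo] at hr
  exact hnear' r hr.1 hr.2

end Copying

end KosloffVolny

namespace KosloffVolny

theorem two_pow_le_p {k : ℕ} (hk : 1 ≤ k) : 2 ^ (k - 1) ≤ p k := by
  unfold p
  split_ifs
  · exact Nat.pow_le_pow_right (by norm_num) (by omega)
  · omega

theorem p_le_two_pow {k : ℕ} (hk : 2 ≤ k) : p k ≤ 2 ^ k := by
  unfold p
  split_ifs
  · exact le_rfl
  · have : 2 ^ k = 2 * 2 ^ (k - 1) := by
      rw [← pow_succ']; congr 1; omega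
    have h1 : 0 < 2 ^ (k - 1) := by positivity
    omega

theorem p_pos (k : ℕ) : 0 < p k := by
  unfold p
  split_ifs <;> positivity

theorem one_le_logb {k : ℕ} (hk : 2 ≤ k) : 1 ≤ Real.logb 2 (k : ℝ) := by
  rw [Real.le_logb_iff_rpow_le (by norm_num) (by positivity)]
  simpa using (by exact_mod_cast hk : (2 : ℝ) ≤ k)

theorem two_le_mul_logb {k : ℕ} (hk : 2 ≤ k) : 2 ≤ (k : ℝ) * Real.logb 2 (k : ℝ) := by
  have h1 := one_le_logb hk
  have h2 : (2 : ℝ) ≤ k := by exact_mod_cast hk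
  nlinarith

theorem α_nonneg (k : ℕ) : 0 ≤ α k := by unfold α; positivity

theorem p_sq_mul_α_sq {k : ℕ} (hk : 2 ≤ k) :
    (p k : ℝ) ^ 2 * α k ^ 2 = 1 / ((k : ℝ) * Real.logb 2 (k : ℝ)) := by
  have h := two_le_mul_logb hk
  have hp : (0 : ℝ) < p k := by exact_mod_cast p_pos k
  unfold α
  rw [div_pow, mul_pow, Real.sq_sqrt (by linarith)]
  field_simp

theorem α_sq_pos {k : ℕ} (hk : 2 ≤ k) : 0 < α k ^ 2 := by
  have h := two_le_mul_logb hk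
  have hp : (0 : ℝ) < p k := by exact_mod_cast p_pos k
  have := p_sq_mul_α_sq hk
  have h3 : 0 < 1 / ((k : ℝ) * Real.logb 2 (k : ℝ)) := by positivity
  rw [← this] at h3
  exact pos_of_mul_pos_right h3 (by positivity)

theorem α_sq_lt_one {k : ℕ} (hk : 2 ≤ k) : α k ^ 2 < 1 := by
  have h := two_le_mul_logb hk
  have hp : (1 : ℝ) ≤ p k := by exact_mod_cast p_pos k
  have := p_sq_mul_α_sq hk
  have h3 : 1 / ((k : ℝ) * Real.logb 2 (k : ℝ)) ≤ 1 / 2 := by gcongr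
  nlinarith [α_sq_pos hk, mul_le_mul_of_nonneg_right (one_le_pow₀ hp (n := 2)) (α_sq_pos hk).le]

section Existence

variable {X : Type*} [MeasurableSpace X] {μ : Measure X} [IsProbabilityMeasure μ]

/-- The law of a symmetric variable with values `-1`, `0`, `1`, coded as `0`, `1`, `2`. -/
theorem exists_symmetric_law {t : ℝ} (h0 : 0 < t) (h1 : t < 1) :
    ∃ π : Measure (Fin 3), IsProbabilityMeasure π ∧ π {0} = ENNReal.ofReal (t / 2) ∧
      0 < π {1} ∧ π {1} < 1 ∧ π {2} = ENNReal.ofReal (t / 2) := by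
  let m : PMF (Fin 3) := PMF.ofFintype
    ![ENNReal.ofReal (t / 2), ENNReal.ofReal (1 - t), ENNReal.ofReal (t / 2)] (by
      simp only [Fin.sum_univ_three, Matrix.cons_val_zero, Matrix.cons_val_one, Matrix.cons_val]
      rw [← ENNReal.ofReal_add (by linarith) (by linarith),
        ← ENNReal.ofReal_add (by linarith) (by linarith),
        show t / 2 + (1 - t) + t / 2 = 1 by ring, ENNReal.ofReal_one])
  refine ⟨m.toMeasure, inferInstance, ?_, ?_, ?_, ?_⟩
  · rw [PMF.toMeasure_apply_singleton _ _ (measurableSet_singleton _)]; rfl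
  · rw [PMF.toMeasure_apply_singleton _ _ (measurableSet_singleton _)]
    exact ENNReal.ofReal_pos.2 (by linarith)
  · rw [PMF.toMeasure_apply_singleton _ _ (measurableSet_singleton _)]
    exact ENNReal.ofReal_lt_one.2 (by linarith)
  · rw [PMF.toMeasure_apply_singleton _ _ (measurableSet_singleton _)]; rfl

theorem exists_coding_step {T : X ≃ᵐ X} (hT : Ergodic T μ) (hap : Aperiodic T μ) {n : ℕ}
    (hn : 0 < n) {t : ℝ} (h0 : 0 < t) (h1 : t < 1) {ι : Type*} [Countable ι]
    [MeasurableSpace ι] [MeasurableSingletonClass ι] {P : X → ι} (hP : Measurable P) :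
    ∃ g : X → ℤ, Measurable g ∧ (∀ x, g x = -1 ∨ g x = 0 ∨ g x = 1) ∧
      μ.real {x | g x = 1} = t / 2 ∧ μ.real {x | g x = -1} = t / 2 ∧
      iIndepFun (fun (j : Fin n) (x : X) => g (T^[(j : ℕ)] x)) μ ∧
      IndepFun (fun (x : X) (j : Fin n) => g (T^[(j : ℕ)] x)) P μ := by
  obtain ⟨π, hπ, hπ0, hπ1, hπ1', hπ2⟩ := exists_symmetric_law h0 h1
  obtain ⟨g, hg, hgl⟩ := exists_indep_window hT hap hn (1 : Fin 3) π hπ1 hπ1'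
    (fun a => hP (measurableSet_singleton a))
  let W : X → Fin n → Fin 3 := fun x j => g (T^[(j : ℕ)] x)
  have hgT : ∀ j : ℕ, Measurable fun x => g (T^[j] x) := fun j =>
    hg.comp (hT.measurable.iterate j)
  have hW : Measurable W := measurable_pi_lambda _ fun j => hgT j
  have hlaw : ∀ a v, μ (P ⁻¹' {a} ∩ W ⁻¹' {v}) = μ (P ⁻¹' {a}) * Measure.pi (fun _ => π) {v} := by
    intro a v
    have := hgl a (fun j => if h : j < n then v ⟨j, h⟩ else 0)
    rw [Measure.pi_singleton, Finset.prod_fin_eq_prod_range]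
    convert this using 2
    · congr 1
      ext x
      simp only [W, Set.mem_preimage, Set.mem_singleton_iff, Set.mem_ofPred_eq, funext_iff]
      refine ⟨fun h j hj => by simpa [hj] using h ⟨j, hj⟩, fun h j => by simpa using h j j.2⟩
    · refine Finset.prod_congr rfl fun j hj => ?_
      have := Finset.mem_range.1 hj
      simp [this]
  have hprod : μ.map (fun x => (P x, W x)) = (μ.map P).prod (Measure.pi fun _ => π) := by
    refine Measure.ext_of_singleton fun ⟨a, v⟩ => ?_
    rw [Measure.map_apply (hP.prodMk hW) (measurableSet_singleton _), ← Set.singleton_prod_singleton,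
      Measure.prod_prod, Measure.map_apply hP (measurableSet_singleton _), ← hlaw]
    rfl
  have hPprob : IsProbabilityMeasure (μ.map P) := Measure.isProbabilityMeasure_map hP.aemeasurable
  have hWlaw : μ.map W = Measure.pi fun _ => π := by
    have := congrArg (fun m => m.map Prod.snd) hprod
    simp only [Measure.map_snd_prod, measure_univ, one_smul] at this
    rwa [Measure.map_map measurable_snd (hP.prodMk hW)] at this
  have hind : IndepFun W P μ := by
    refine ((indepFun_iff_map_prod_eq_prod_map_map hP.aemeasurable hW.aemeasurable).2 ?_).symm
    rw [hWlaw, hprod]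
  have hgj : ∀ j : Fin n, μ.map (fun x => g (T^[(j : ℕ)] x)) = π := by
    intro j
    have := congrArg (fun m => Measure.map (Function.eval j) m) hWlaw
    rw [Measure.map_map (measurable_pi_apply j) hW,
      (measurePreserving_eval (fun _ : Fin n => π) j).map_eq] at this
    exact this
  have hiind : iIndepFun (fun (j : Fin n) (x : X) => g (T^[(j : ℕ)] x)) μ := by
    rw [iIndepFun_iff_map_fun_eq_pi_map fun j : Fin n => (hgT j).aemeasurable]
    simp only [hgj]
    exact hWlaw
  have hgπ : μ.map g = π := hgj ⟨0, hn⟩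
  let e : Fin 3 → ℤ := fun i => (i : ℕ) - 1
  have he : Measurable e := measurable_of_countable e
  have hreal : ∀ (i : Fin 3), π {i} = ENNReal.ofReal (t / 2) →
      μ.real {x | e (g x) = e i} = t / 2 := by
    intro i hi
    have : {x | e (g x) = e i} = g ⁻¹' {i} := by
      ext x
      simp only [Set.mem_ofPred_eq, Set.mem_preimage, Set.mem_singleton_iff]
      refine ⟨fun h => ?_, fun h => by rw [h]⟩
      simp only [e] at h
      omega
    rw [this, measureReal_def, ← Measure.map_apply hg (measurableSet_singleton _), hgπ, hi,
      ENNReal.toReal_ofReal (by linarith)]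
  refine ⟨fun x => e (g x), he.comp hg, fun x => ?_, hreal 2 hπ2, hreal 0 hπ0,
    hiind.comp (fun _ => e) fun _ => he, ?_⟩
  · have : ∀ i : Fin 3, e i = -1 ∨ e i = 0 ∨ e i = 1 := by decide
    exact this _
  · exact hind.comp (φ := fun v j => e (v j)) (ψ := id) (by fun_prop) measurable_id

theorem exists_isCodingSequence {T : X ≃ᵐ X} (hT : Ergodic T μ) (hap : Aperiodic T μ) :
    ∃ fbar : ℕ → X → ℤ, IsCodingSequence T μ fbar := by
  have hstep : ∀ (k : ℕ) (prev : ∀ l < k, {h : X → ℤ // Measurable h}),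
      ∃ g : {h : X → ℤ // Measurable h}, 2 ≤ k →
        (∀ x, g.1 x = -1 ∨ g.1 x = 0 ∨ g.1 x = 1) ∧
        μ.real {x | g.1 x = 1} = α k ^ 2 / 2 ∧ μ.real {x | g.1 x = -1} = α k ^ 2 / 2 ∧
        iIndepFun (fun (j : Fin (2 * d k + p k + 1)) (x : X) => g.1 (T^[(j : ℕ)] x)) μ ∧
        IndepFun (fun (x : X) (j : Fin (2 * d k + p k + 1)) => g.1 (T^[(j : ℕ)] x))
          (fun (x : X) (q : Set.Ico 2 k × Fin (2 * d k + p k + 1)) =>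
            (prev q.1.1 q.1.2.2).1 (T^[(q.2 : ℕ)] x)) μ := by
    intro k prev
    by_cases hk : 2 ≤ k
    · obtain ⟨g, hg, hrest⟩ := exists_coding_step hT hap (n := 2 * d k + p k + 1) (by omega)
        (α_sq_pos hk) (α_sq_lt_one hk)
        (P := fun (x : X) (q : Set.Ico 2 k × Fin (2 * d k + p k + 1)) =>
            (prev q.1.1 q.1.2.2).1 (T^[(q.2 : ℕ)] x))
        (measurable_pi_lambda _ fun q => (prev q.1.1 q.1.2.2).2.comp (hT.measurable.iterate _))
      exact ⟨⟨g, hg⟩, fun _ => hrest⟩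
    · exact ⟨⟨0, measurable_zero⟩, fun h => absurd h hk⟩
  choose step hstep using hstep
  let F : ℕ → {h : X → ℤ // Measurable h} := wellFounded_lt.fix step
  have hF : ∀ k, F k = step k fun l _ => F l := fun k => wellFounded_lt.fix_eq step k
  have hall : ∀ k, _ := fun k => hstep k fun l _ => F l
  simp only [← hF] at hall
  exact ⟨fun k => (F k).1, fun k _ => (F k).2, fun k hk => (hall k hk).1,
    fun k hk => (hall k hk).2.1, fun k hk => (hall k hk).2.2.1, fun k hk => (hall k hk).2.2.2.1,
    fun k hk => (hall k hk).2.2.2.2⟩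

end Existence

end KosloffVolny

namespace KosloffVolny

section L2

variable {X : Type*} [MeasurableSpace X] {μ : Measure X}

/-- The function `F` is in `L²` with norm at most `c`. -/
structure L2Le (μ : Measure X) (F : X → ℝ) (c : ℝ) : Prop where
  aestronglyMeasurable : AEStronglyMeasurable F μ
  norm_le : eLpNorm F 2 μ ≤ ENNReal.ofReal c

namespace L2Le

variable {F G : X → ℝ} {a b : ℝ}

theorem memLp (h : L2Le μ F a) : MemLp F 2 μ :=
  ⟨h.1, h.2.trans_lt ENNReal.ofReal_lt_top⟩

theorem mono (h : L2Le μ F a) (hab : a ≤ b) : L2Le μ F b :=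
  ⟨h.1, h.2.trans (ENNReal.ofReal_le_ofReal hab)⟩

theorem congr (h : L2Le μ F a) (hFG : F =ᵐ[μ] G) : L2Le μ G a :=
  ⟨h.1.congr hFG, (eLpNorm_congr_ae hFG) ▸ h.2⟩

theorem add (hF : L2Le μ F a) (hG : L2Le μ G b) (ha : 0 ≤ a) (hb : 0 ≤ b) :
    L2Le μ (fun x => F x + G x) (a + b) := by
  refine ⟨hF.1.add hG.1, (eLpNorm_add_le hF.1 hG.1 (by norm_num)).trans ?_⟩
  rw [ENNReal.ofReal_add ha hb]
  exact add_le_add hF.2 hG.2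

theorem sub (hF : L2Le μ F a) (hG : L2Le μ G b) (ha : 0 ≤ a) (hb : 0 ≤ b) :
    L2Le μ (fun x => F x - G x) (a + b) := by
  refine ⟨hF.1.sub hG.1, (eLpNorm_sub_le hF.1 hG.1 (by norm_num)).trans ?_⟩
  rw [ENNReal.ofReal_add ha hb]
  exact add_le_add hF.2 hG.2

theorem sum {ι : Type*} {s : Finset ι} {F : ι → X → ℝ} {c : ι → ℝ}
    (h : ∀ i ∈ s, L2Le μ (F i) (c i)) (hc : ∀ i ∈ s, 0 ≤ c i) :
    L2Le μ (fun x => ∑ i ∈ s, F i x) (∑ i ∈ s, c i) := by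
  have e : (fun x => ∑ i ∈ s, F i x) = ∑ i ∈ s, F i := by ext x; simp
  refine ⟨s.aestronglyMeasurable_fun_sum fun i hi => (h i hi).1, ?_⟩
  rw [e, ENNReal.ofReal_sum_of_nonneg hc]
  exact (eLpNorm_sum_le (fun i hi => (h i hi).1) (by norm_num)).trans
    (Finset.sum_le_sum fun i hi => (h i hi).2)

theorem comp {T : X → X} (hT : MeasurePreserving T μ μ) (hF : L2Le μ F a) :
    L2Le μ (fun x => F (T x)) a := by
  refine ⟨hF.1.comp_measurePreserving hT, ?_⟩
  exact (eLpNorm_comp_measurePreserving hF.1 hT).trans_le hF.2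

theorem const_mul (hF : L2Le μ F a) {c : ℝ} (hc : 0 ≤ c) : L2Le μ (fun x => c * F x) (c * a) := by
  refine ⟨hF.1.const_mul c, ?_⟩
  have := eLpNorm_const_smul c F 2 μ
  rw [ENNReal.ofReal_mul hc]
  refine (le_of_eq this).trans ?_
  rw [Real.enorm_of_nonneg hc]
  gcongr
  exact hF.2

end L2Le

theorem eLpNorm_two_eq {F : X → ℝ} (hF : MemLp F 2 μ) :
    eLpNorm F 2 μ = ENNReal.ofReal (√(∫ x, F x ^ 2 ∂μ)) := by
  rw [hF.eLpNorm_eq_integral_rpow_norm (by norm_num) (by norm_num)]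
  congr 1
  simp only [ENNReal.toReal_ofNat, Real.rpow_ofNat, Real.norm_eq_abs, sq_abs]
  rw [Real.sqrt_eq_rpow, one_div]

theorem L2Le.of_integral_sq_le {F : X → ℝ} (hF : MemLp F 2 μ) {c : ℝ} (h0 : 0 ≤ c)
    (hc : ∫ x, F x ^ 2 ∂μ ≤ c ^ 2) : L2Le μ F c := by
  refine ⟨hF.1, ?_⟩
  rw [eLpNorm_two_eq hF]
  exact ENNReal.ofReal_le_ofReal ((Real.sqrt_le_left h0).2 hc)

theorem L2Le.integral_sq_le {F : X → ℝ} {c : ℝ} (hF : L2Le μ F c) (h0 : 0 ≤ c) :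
    ∫ x, F x ^ 2 ∂μ ≤ c ^ 2 := by
  have := hF.2
  rw [eLpNorm_two_eq hF.memLp, ENNReal.ofReal_le_ofReal_iff h0] at this
  exact (Real.sqrt_le_left h0).1 this

theorem integral_sq_sum_of_orthogonal {ι : Type*} {s : Finset ι} {F : ι → X → ℝ}
    (hF : ∀ i ∈ s, MemLp (F i) 2 μ)
    (ho : ∀ i ∈ s, ∀ j ∈ s, i ≠ j → ∫ x, F i x * F j x ∂μ = 0) :
    ∫ x, (∑ i ∈ s, F i x) ^ 2 ∂μ = ∑ i ∈ s, ∫ x, F i x ^ 2 ∂μ := by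
  classical
  have hint : ∀ i ∈ s, ∀ j ∈ s, Integrable (fun x => F i x * F j x) μ := fun i hi j hj =>
    (hF i hi).integrable_mul (hF j hj)
  simp_rw [sq, Finset.sum_mul_sum]
  rw [integral_finsetSum _ fun i hi => integrable_finsetSum _ fun j hj => hint i hi j hj]
  refine Finset.sum_congr rfl fun i hi => ?_
  rw [integral_finsetSum _ fun j hj => hint i hi j hj]
  exact Finset.sum_eq_single_of_mem i hi fun j hj hji => ho i hi j hj hji.symm

/-- The second moment is stable under small perturbations in `L²`. -/
theorem tendsto_integral_sq_of_L2Le {F G : ℕ → X → ℝ} {ε : ℕ → ℝ} {v : ℝ}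
    (hF : ∀ n, MemLp (F n) 2 μ) (hG : ∀ n, MemLp (G n) 2 μ)
    (hε : Tendsto ε atTop (𝓝 0)) (h : ∀ᶠ n in atTop, L2Le μ (fun x => F n x - G n x) (ε n))
    (hv : Tendsto (fun n => ∫ x, G n x ^ 2 ∂μ) atTop (𝓝 v)) :
    Tendsto (fun n => ∫ x, F n x ^ 2 ∂μ) atTop (𝓝 v) := by
  have hnn : ∀ F : X → ℝ, 0 ≤ ∫ x, F x ^ 2 ∂μ := fun F => integral_nonneg fun x => sq_nonneg _
  have htri : ∀ A B : X → ℝ, MemLp A 2 μ → MemLp B 2 μ →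
      √(∫ x, (A x + B x) ^ 2 ∂μ) ≤ √(∫ x, A x ^ 2 ∂μ) + √(∫ x, B x ^ 2 ∂μ) := by
    intro A B hA hB
    have h1 := eLpNorm_add_le hA.1 hB.1 (p := 2) (by norm_num)
    rw [eLpNorm_two_eq hA, eLpNorm_two_eq hB, eLpNorm_two_eq (hA.add hB),
      ← ENNReal.ofReal_add (Real.sqrt_nonneg _) (Real.sqrt_nonneg _),
      ENNReal.ofReal_le_ofReal_iff (by positivity)] at h1
    exact h1
  have hsq : Tendsto (fun n => √(∫ x, G n x ^ 2 ∂μ)) atTop (𝓝 (√v)) :=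
    (Real.continuous_sqrt.tendsto v).comp hv
  have hbd : ∀ᶠ n in atTop, |√(∫ x, F n x ^ 2 ∂μ) - √(∫ x, G n x ^ 2 ∂μ)| ≤ |ε n| := by
    filter_upwards [h] with n hn
    have hn' := (hn.mono (le_abs_self _)).integral_sq_le (abs_nonneg _)
    have h0 := hn.memLp
    have e1 := htri _ _ h0 (hG n)
    have e2 := htri _ _ h0.neg (hF n)
    simp only [sub_add_cancel, Pi.neg_apply, neg_sub] at e1 e2
    have e3 : √(∫ x, (F n x - G n x) ^ 2 ∂μ) ≤ |ε n| := (Real.sqrt_le_left (abs_nonneg _)).2 hn'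
    have e4 : √(∫ x, (G n x - F n x) ^ 2 ∂μ) ≤ |ε n| := by
      simpa only [sub_sq_comm] using e3
    rw [abs_le]
    constructor <;> linarith
  have hd : Tendsto (fun n => √(∫ x, F n x ^ 2 ∂μ) - √(∫ x, G n x ^ 2 ∂μ)) atTop (𝓝 0) :=
    squeeze_zero_norm' hbd (by simpa using hε.abs)
  have hs := hd.add hsq
  simp only [sub_add_cancel, zero_add] at hs
  have := hs.pow 2
  simp only [Real.sq_sqrt (hnn _)] at this
  rwa [Real.sq_sqrt (ge_of_tendsto' hv fun n => hnn _)] at this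

end L2

end KosloffVolny

namespace KosloffVolny

/-- The real random variable `fbar k ∘ T ^ j`. -/
def xr {X : Type*} (T : X → X) (fbar : ℕ → X → ℤ) (k j : ℕ) (x : X) : ℝ := fbar k (T^[j] x)

/-- The ergodic sums of `block`, written in terms of `xr`. -/
def blockSum {X : Type*} (T : X → X) (fbar : ℕ → X → ℤ) (k n : ℕ) (x : X) : ℝ :=
  ∑ j ∈ Finset.range n, (∑ i ∈ Finset.range (p k), xr T fbar k (i + j) x -
    ∑ i ∈ Finset.range (p k), xr T fbar k (i + j + d k) x)

theorem p_le_d {k : ℕ} (hk : 2 ≤ k) : p k ≤ d k :=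
  (p_le_two_pow hk).trans (Nat.pow_le_pow_right (by norm_num) (by nlinarith))

theorem d_le_d {l k : ℕ} (hlk : l ≤ k) : d l ≤ d k :=
  Nat.pow_le_pow_right (by norm_num) (Nat.pow_le_pow_left hlk 2)

section Coding

variable {X : Type*} [MeasurableSpace X] {μ : Measure X} [IsProbabilityMeasure μ]
  {T : X → X} {fbar : ℕ → X → ℤ}

theorem xr_iterate (k j a : ℕ) (x : X) : xr T fbar k j (T^[a] x) = xr T fbar k (j + a) x := by
  simp only [xr, ← Function.iterate_add_apply]

theorem block_eq (k j : ℕ) (x : X) : (block T fbar k (T^[j] x) : ℝ) =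
    ∑ i ∈ Finset.range (p k), xr T fbar k (i + j) x -
      ∑ i ∈ Finset.range (p k), xr T fbar k (i + j + d k) x := by
  simp only [block, xr, ← Function.iterate_add_apply]
  push_cast
  simp only [add_assoc, add_comm, add_left_comm]

theorem birkhoffSum_block (k n : ℕ) (x : X) :
    birkhoffSum T (fun y => (block T fbar k y : ℝ)) n x = blockSum T fbar k n x := by
  simp only [birkhoffSum, blockSum, block_eq]

variable (hT : MeasurePreserving T μ μ) (h : IsCodingSequence T μ fbar)
include hT h

theorem measurable_xr {k : ℕ} (hk : 2 ≤ k) (j : ℕ) : Measurable (xr T fbar k j) :=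
  (measurable_of_countable (fun z : ℤ => (z : ℝ))).comp
    ((h.measurable k hk).comp (hT.measurable.iterate j))

theorem abs_xr_le {k : ℕ} (hk : 2 ≤ k) (j : ℕ) (x : X) : |xr T fbar k j x| ≤ 1 := by
  rcases h.values k hk (T^[j] x) with h | h | h <;> simp [xr, h]

theorem memLp_xr {k : ℕ} (hk : 2 ≤ k) (j : ℕ) : MemLp (xr T fbar k j) 2 μ :=
  MemLp.of_bound (measurable_xr hT h hk j).aestronglyMeasurable 1
    (Eventually.of_forall fun x => abs_xr_le hT h hk j x)

/-- The expectation of a function of `fbar k ∘ T ^ j`. -/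
theorem integral_comp_fbar {E : Type*} [NormedAddCommGroup E] [NormedSpace ℝ E] [CompleteSpace E]
    {k : ℕ} (hk : 2 ≤ k) (j : ℕ) (φ : ℤ → E) :
    ∫ x, φ (fbar k (T^[j] x)) ∂μ =
      (1 - α k ^ 2) • φ 0 + (α k ^ 2 / 2) • (φ 1 + φ (-1)) := by
  have hm := h.measurable k hk
  have h1 : MeasurableSet {x | fbar k x = 1} := hm (measurableSet_singleton 1)
  have h2 : MeasurableSet {x | fbar k x = -1} := hm (measurableSet_singleton (-1))
  have e : (fun x => φ (fbar k x)) = fun x => φ 0 +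
      ({x | fbar k x = 1}.indicator (fun _ => φ 1 - φ 0) x +
        {x | fbar k x = -1}.indicator (fun _ => φ (-1) - φ 0) x) := by
    ext x
    rcases h.values k hk x with h | h | h <;> simp [Set.indicator, h]
  have hinv : ∫ x, φ (fbar k (T^[j] x)) ∂μ = ∫ x, φ (fbar k x) ∂μ := by
    have hsm : AEStronglyMeasurable (fun x => φ (fbar k x)) μ := by
      rw [e]
      exact aestronglyMeasurable_const.add ((aestronglyMeasurable_const.indicator h1).add
        (aestronglyMeasurable_const.indicator h2))
    have hmap := (hT.iterate j).map_eq
    rw [← integral_map (φ := T^[j]) (f := fun y => φ (fbar k y))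
      (hT.measurable.iterate j).aemeasurable (by rwa [hmap]), hmap]
  rw [hinv, e, integral_add (integrable_const _) (((integrable_const _).indicator h1).add
    ((integrable_const _).indicator h2)), integral_add ((integrable_const _).indicator h1)
    ((integrable_const _).indicator h2), integral_indicator_const _ h1,
    integral_indicator_const _ h2, h.prob_one k hk, h.prob_neg_one k hk]
  simp only [integral_const, probReal_univ, one_smul, smul_sub, smul_add, sub_smul]
  module

theorem integral_xr {k : ℕ} (hk : 2 ≤ k) (j : ℕ) : ∫ x, xr T fbar k j x ∂μ = 0 := by
  simpa [xr] using integral_comp_fbar hT h hk j (fun z : ℤ => (z : ℝ))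

theorem integral_xr_sq {k : ℕ} (hk : 2 ≤ k) (j : ℕ) :
    ∫ x, xr T fbar k j x ^ 2 ∂μ = α k ^ 2 := by
  have := integral_comp_fbar hT h hk j (fun z : ℤ => (z : ℝ) ^ 2)
  simp only [xr, this]
  norm_num

theorem indepFun_xr_past {k : ℕ} (hk : 2 ≤ k) :
    IndepFun (fun x (j : ℕ) => if j < 2 * d k + p k + 1 then xr T fbar k j x else 0)
      (fun x (q : ℕ × ℕ) => if (2 ≤ q.1 ∧ q.1 < k) ∧ q.2 < 2 * d k + p k + 1 then
        xr T fbar q.1 q.2 x else 0) μ := by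
  have hc : Measurable fun z : ℤ => (z : ℝ) := measurable_of_countable _
  have := (h.indep_past k hk).comp
    (φ := fun v (j : ℕ) => if hj : j < 2 * d k + p k + 1 then ((v ⟨j, hj⟩ : ℤ) : ℝ) else 0)
    (ψ := fun v (q : ℕ × ℕ) => if hq : (2 ≤ q.1 ∧ q.1 < k) ∧ q.2 < 2 * d k + p k + 1 then
      ((v (⟨q.1, hq.1⟩, ⟨q.2, hq.2⟩) : ℤ) : ℝ) else 0)
    (measurable_pi_lambda _ fun j => by
      by_cases hj : j < 2 * d k + p k + 1
      · simp only [hj, dif_pos]; exact hc.comp (measurable_pi_apply _)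
      · simp only [hj, dif_neg, not_false_eq_true]; exact measurable_const)
    (measurable_pi_lambda _ fun q => by
      by_cases hq : (2 ≤ q.1 ∧ q.1 < k) ∧ q.2 < 2 * d k + p k + 1
      · simp only [hq, dif_pos, and_self]; exact hc.comp (measurable_pi_apply _)
      · simp only [hq, dif_neg, not_false_eq_true]; exact measurable_const)
  exact this

theorem iIndepFun_xr {k : ℕ} (hk : 2 ≤ k) :
    iIndepFun (fun j : Fin (2 * d k + p k + 1) => xr T fbar k j) μ :=
  (h.indep_time k hk).comp (fun _ (z : ℤ) => (z : ℝ)) fun _ => measurable_of_countable _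

theorem integral_xr_mul_xr {k : ℕ} (hk : 2 ≤ k) {i j : ℕ} (hi : i < 2 * d k + p k + 1)
    (hj : j < 2 * d k + p k + 1) (hij : i ≠ j) :
    ∫ x, xr T fbar k i x * xr T fbar k j x ∂μ = 0 := by
  have := (iIndepFun_xr hT h hk).indepFun (i := ⟨i, hi⟩) (j := ⟨j, hj⟩) (by simpa using hij)
  rw [this.integral_fun_mul_eq_mul_integral (measurable_xr hT h hk i).aestronglyMeasurable
    (measurable_xr hT h hk j).aestronglyMeasurable, integral_xr hT h hk, zero_mul]

theorem integral_xr_mul_xr_of_lt {k l : ℕ} (hl : 2 ≤ l) (hlk : l < k) {i j : ℕ}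
    (hi : i < 2 * d k + p k + 1) (hj : j < 2 * d k + p k + 1) :
    ∫ x, xr T fbar k i x * xr T fbar l j x ∂μ = 0 := by
  have hk : 2 ≤ k := hl.trans hlk.le
  have m1 : Measurable fun v : ℕ → ℝ => v i := measurable_pi_apply i
  have m2 : Measurable fun v : ℕ × ℕ → ℝ => v (l, j) := measurable_pi_apply (l, j)
  have := (indepFun_xr_past hT h hk).comp m1 m2
  simp only [Function.comp_def, hi, hj, hl, hlk, and_self, if_true] at this
  rw [this.integral_fun_mul_eq_mul_integral (measurable_xr hT h hk i).aestronglyMeasurable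
    (measurable_xr hT h hl j).aestronglyMeasurable, integral_xr hT h hk, zero_mul]

theorem integral_sum_xr_sq {k : ℕ} (hk : 2 ≤ k) {J : Finset ℕ}
    (hJ : ∀ j ∈ J, j < 2 * d k + p k + 1) (c : ℕ → ℝ) :
    ∫ x, (∑ j ∈ J, c j * xr T fbar k j x) ^ 2 ∂μ = (∑ j ∈ J, c j ^ 2) * α k ^ 2 := by
  rw [integral_sq_sum_of_orthogonal fun j _ => (memLp_xr hT h hk j).const_mul (c j),
    Finset.sum_mul]
  · refine Finset.sum_congr rfl fun j _ => ?_
    simp only [mul_pow]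
    rw [integral_const_mul, integral_xr_sq hT h hk]
  · intro i hi j hj hij
    have : ∀ x, c i * xr T fbar k i x * (c j * xr T fbar k j x) =
      c i * c j * (xr T fbar k i x * xr T fbar k j x) := fun x => by ring
    simp only [this]
    rw [integral_const_mul, integral_xr_mul_xr hT h hk (hJ i hi) (hJ j hj) hij, mul_zero]

/-- A finite linear combination of the `xr k i` is orthogonal to one of the `xr l j`, `l < k`. -/
theorem integral_sum_xr_mul_sum_xr {k l : ℕ} (hl : 2 ≤ l) (hlk : l < k) {I J : Finset ℕ}
    (hI : ∀ i ∈ I, i < 2 * d k + p k + 1) (hJ : ∀ j ∈ J, j < 2 * d k + p k + 1) (a b : ℕ → ℝ) :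
    ∫ x, (∑ i ∈ I, a i * xr T fbar k i x) * (∑ j ∈ J, b j * xr T fbar l j x) ∂μ = 0 := by
  have hk : 2 ≤ k := hl.trans hlk.le
  have hint : ∀ i j, Integrable (fun x => a i * xr T fbar k i x * (b j * xr T fbar l j x)) μ :=
    fun i j => ((memLp_xr hT h hk i).const_mul (a i)).integrable_mul
      ((memLp_xr hT h hl j).const_mul (b j))
  simp_rw [Finset.sum_mul_sum]
  rw [integral_finsetSum _ fun i hi => integrable_finsetSum _ fun j hj => hint i j]
  refine Finset.sum_eq_zero fun i hi => ?_
  rw [integral_finsetSum _ fun j hj => hint i j]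
  refine Finset.sum_eq_zero fun j hj => ?_
  have : ∀ x, a i * xr T fbar k i x * (b j * xr T fbar l j x) =
    a i * b j * (xr T fbar k i x * xr T fbar l j x) := fun x => by ring
  simp only [this]
  rw [integral_const_mul, integral_xr_mul_xr_of_lt hT h hl hlk (hI i hi) (hJ j hj), mul_zero]

theorem L2Le_sum_range_xr {k : ℕ} (hk : 2 ≤ k) {m : ℕ} (hm : m ≤ 2 * d k + p k + 1) (a : ℕ) :
    L2Le μ (fun x => ∑ j ∈ Finset.range m, xr T fbar k (j + a) x) (√m * α k) := by
  have h1 : L2Le μ (fun x => ∑ j ∈ Finset.range m, xr T fbar k j x) (√m * α k) := by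
    refine L2Le.of_integral_sq_le (memLp_finsetSum _ fun j _ => memLp_xr hT h hk j)
      (mul_nonneg (Real.sqrt_nonneg _) (α_nonneg k)) (le_of_eq ?_)
    have := integral_sum_xr_sq hT h hk (J := Finset.range m)
      (fun j hj => (Finset.mem_range.1 hj).trans_le hm) 1
    simp only [Pi.one_apply, one_mul, one_pow, Finset.sum_const, Finset.card_range,
      nsmul_eq_mul, mul_one] at this
    rw [this, mul_pow, Real.sq_sqrt (Nat.cast_nonneg m)]
  have := h1.comp (hT.iterate a)
  simpa only [xr_iterate] using this

/-- Windows `j < m` of the moving sums of length `p k`. -/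
theorem L2Le_sum_sum_xr {k : ℕ} (hk : 2 ≤ k) {m : ℕ} (hm : m ≤ 2 * d k + p k + 1) (a : ℕ) :
    L2Le μ (fun x => ∑ j ∈ Finset.range m, ∑ i ∈ Finset.range (p k), xr T fbar k (i + j + a) x)
      (p k * (√m * α k)) := by
  have := L2Le.sum (s := Finset.range (p k)) (fun i _ => L2Le_sum_range_xr hT h hk hm (i + a))
    (fun i _ => mul_nonneg (Real.sqrt_nonneg _) (α_nonneg k))
  rw [Finset.sum_const, Finset.card_range, nsmul_eq_mul] at this
  refine this.congr (Eventually.of_forall fun x => ?_)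
  simp only
  rw [Finset.sum_comm]
  exact Finset.sum_congr rfl fun j _ => Finset.sum_congr rfl fun i _ => by
    congr 1; omega

theorem L2Le_blockSum_of_le {k n : ℕ} (hk : 2 ≤ k) (hn : n ≤ d k) :
    L2Le μ (blockSum T fbar k n) (2 * (p k * (√n * α k))) := by
  have hc : 0 ≤ p k * (√n * α k) :=
    mul_nonneg (by positivity) (mul_nonneg (Real.sqrt_nonneg _) (α_nonneg k))
  have := (L2Le_sum_sum_xr hT h hk (m := n) (by omega) 0).sub
    (L2Le_sum_sum_xr hT h hk (m := n) (by omega) (d k)) hc hc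
  rw [← two_mul] at this
  refine this.congr (Eventually.of_forall fun x => ?_)
  simp [blockSum, Finset.sum_sub_distrib]

theorem L2Le_blockSum {k : ℕ} (hk : 2 ≤ k) (n : ℕ) :
    L2Le μ (blockSum T fbar k n) (2 * (p k * (√(d k) * α k))) := by
  have hc : 0 ≤ p k * (√(d k) * α k) :=
    mul_nonneg (by positivity) (mul_nonneg (Real.sqrt_nonneg _) (α_nonneg k))
  have := (L2Le_sum_sum_xr hT h hk (m := d k) (by omega) 0).sub
    (L2Le_sum_sum_xr hT h hk (m := d k) (by omega) n) hc hc
  rw [← two_mul] at this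
  refine this.congr (Eventually.of_forall fun x => ?_)
  set F : ℕ → ℝ := fun j => ∑ i ∈ Finset.range (p k), xr T fbar k (i + j) x with hF
  have e1 : blockSum T fbar k n x = ∑ j ∈ Finset.range n, F j - ∑ j ∈ Finset.range n, F (d k + j) := by
    simp only [blockSum, Finset.sum_sub_distrib, hF]
    congr 1
    exact Finset.sum_congr rfl fun j _ => Finset.sum_congr rfl fun i _ => by congr 1; omega
  have e2 : ∑ j ∈ Finset.range (d k), F j + ∑ j ∈ Finset.range n, F (d k + j) =
      ∑ j ∈ Finset.range n, F j + ∑ j ∈ Finset.range (d k), F (n + j) := by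
    rw [← Finset.sum_range_add F (d k) n, ← Finset.sum_range_add F n (d k), add_comm n]
  have e3 : ∑ j ∈ Finset.range (d k), ∑ i ∈ Finset.range (p k), xr T fbar k (i + j + n) x =
      ∑ j ∈ Finset.range (d k), F (n + j) :=
    Finset.sum_congr rfl fun j _ => Finset.sum_congr rfl fun i _ => by congr 1; omega
  simp only [add_zero]
  rw [e1, e3]
  linarith

end Coding

end KosloffVolny

namespace KosloffVolny

@[to_additive]
theorem prod_range_of_two_windows {M : Type*} [CommMonoid M] {n d N : ℕ} (hn : n ≤ d)
    (hN : d + n ≤ N) {f : ℕ → M} (h1 : ∀ j, n ≤ j → j < d → f j = 1)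
    (h2 : ∀ j, d + n ≤ j → f j = 1) :
    ∏ j ∈ Finset.range N, f j =
      (∏ j ∈ Finset.range n, f j) * ∏ j ∈ Finset.range n, f (j + d) := by
  have e1 : ∏ j ∈ Finset.range N, f j = ∏ j ∈ Finset.range (d + n), f j :=
    (Finset.prod_subset (Finset.range_mono hN) fun j _ hj => h2 j (by simpa using hj)).symm
  have e2 : ∏ j ∈ Finset.range d, f j = ∏ j ∈ Finset.range n, f j :=
    (Finset.prod_subset (Finset.range_mono hn) fun j hj hj' =>
      h1 j (by simpa using hj') (by simpa using hj)).symm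
  rw [e1, Finset.prod_range_add, e2]
  simp only [add_comm d]

/-- The principal part of `blockSum`. -/
def mainSum {X : Type*} (T : X → X) (fbar : ℕ → X → ℤ) (k n : ℕ) (x : X) : ℝ :=
  p k * (∑ j ∈ Finset.range n, xr T fbar k j x - ∑ j ∈ Finset.range n, xr T fbar k (j + d k) x)

/-- The coefficients of `mainSum`. -/
def mainCoeff (k n j : ℕ) : ℝ :=
  if j < n then p k else if d k ≤ j ∧ j < d k + n then -p k else 0

theorem mainCoeff_of_lt {k n j : ℕ} (hj : j < n) : mainCoeff k n j = p k := if_pos hj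

theorem mainCoeff_add {k n j : ℕ} (hn : n ≤ d k) (hj : j < n) : mainCoeff k n (j + d k) = -p k := by
  rw [mainCoeff, if_neg (by omega), if_pos (by omega)]

theorem mainCoeff_between {k n j : ℕ} (h1 : n ≤ j) (h2 : j < d k) : mainCoeff k n j = 0 := by
  rw [mainCoeff, if_neg (by omega), if_neg (by omega)]

theorem mainCoeff_beyond {k n j : ℕ} (h1 : d k + n ≤ j) : mainCoeff k n j = 0 := by
  rw [mainCoeff, if_neg (by omega), if_neg (by omega)]

theorem mainSum_eq {X : Type*} (T : X → X) (fbar : ℕ → X → ℤ) {k n N : ℕ} (hn : n ≤ d k)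
    (hN : d k + n ≤ N) (x : X) :
    mainSum T fbar k n x = ∑ j ∈ Finset.range N, mainCoeff k n j * xr T fbar k j x := by
  rw [sum_range_of_two_windows hn hN (fun j h1 h2 => by rw [mainCoeff_between h1 h2, zero_mul])
    (fun j h1 => by rw [mainCoeff_beyond h1, zero_mul]), mainSum, mul_sub, sub_eq_add_neg,
    ← mul_neg, ← Finset.sum_neg_distrib, Finset.mul_sum, Finset.mul_sum]
  congr 1
  · exact Finset.sum_congr rfl fun j hj => by rw [mainCoeff_of_lt (Finset.mem_range.1 hj)]
  · exact Finset.sum_congr rfl fun j hj => by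
      rw [mainCoeff_add hn (Finset.mem_range.1 hj)]; ring

/-- `F` is a linear combination of the `xr k j`, `j < N`. -/
def IsComb {X : Type*} (T : X → X) (fbar : ℕ → X → ℤ) (k N : ℕ) (F : X → ℝ) : Prop :=
  ∃ a : ℕ → ℝ, ∀ x, F x = ∑ j ∈ Finset.range N, a j * xr T fbar k j x

section IsComb

variable {X : Type*} {T : X → X} {fbar : ℕ → X → ℤ} {k N : ℕ} {F G : X → ℝ}

theorem isComb_xr {j : ℕ} (hj : j < N) : IsComb T fbar k N (xr T fbar k j) :=
  ⟨fun i => if i = j then 1 else 0, fun x => by simp [hj]⟩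

theorem IsComb.sub (hF : IsComb T fbar k N F) (hG : IsComb T fbar k N G) :
    IsComb T fbar k N fun x => F x - G x := by
  obtain ⟨a, ha⟩ := hF
  obtain ⟨b, hb⟩ := hG
  exact ⟨fun j => a j - b j, fun x => by simp only [ha, hb, sub_mul, Finset.sum_sub_distrib]⟩

theorem IsComb.sum {ι : Type*} {s : Finset ι} {F : ι → X → ℝ}
    (hF : ∀ i ∈ s, IsComb T fbar k N (F i)) : IsComb T fbar k N fun x => ∑ i ∈ s, F i x := by
  choose! a ha using hF
  refine ⟨fun j => ∑ i ∈ s, a i j, fun x => ?_⟩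
  simp only [Finset.sum_mul]
  rw [Finset.sum_comm]
  exact Finset.sum_congr rfl fun i hi => ha i hi x

theorem isComb_blockSum {n : ℕ} (hN : n + p k + d k ≤ N) :
    IsComb T fbar k N (blockSum T fbar k n) := by
  refine IsComb.sum fun j hj => IsComb.sub (IsComb.sum fun i hi => ?_) (IsComb.sum fun i hi => ?_)
  all_goals
    rw [Finset.mem_range] at hi hj
    exact isComb_xr (by omega)

end IsComb

section Coding

variable {X : Type*} [MeasurableSpace X] {μ : Measure X} [IsProbabilityMeasure μ]
  {T : X → X} {fbar : ℕ → X → ℤ}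

variable (hT : MeasurePreserving T μ μ) (h : IsCodingSequence T μ fbar)
include hT h

theorem IsComb.integral_mul_eq_zero {k l N : ℕ} (hl : 2 ≤ l) (hlk : l < k)
    (hN : N ≤ 2 * d k + p k + 1) {F G : X → ℝ} (hF : IsComb T fbar k N F)
    (hG : IsComb T fbar l N G) : ∫ x, F x * G x ∂μ = 0 := by
  obtain ⟨a, ha⟩ := hF
  obtain ⟨b, hb⟩ := hG
  simp only [ha, hb]
  refine integral_sum_xr_mul_sum_xr hT h hl hlk (fun j hj => ?_) (fun j hj => ?_) a b <;>
  exact (Finset.mem_range.1 hj).trans_le hN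

/-- For `n ≤ d k`, the ergodic sums of different blocks from `k` on are orthogonal. -/
theorem integral_blockSum_mul_blockSum {k l n : ℕ} (hl : 2 ≤ l) (hk : 2 ≤ k) (hlk : l ≠ k)
    (hnl : n ≤ d l) (hnk : n ≤ d k) :
    ∫ x, blockSum T fbar l n x * blockSum T fbar k n x ∂μ = 0 := by
  have key : ∀ l k, 2 ≤ l → l < k → n ≤ d l →
      ∫ x, blockSum T fbar k n x * blockSum T fbar l n x ∂μ = 0 := by
    intro l k hl hlk hn
    have hk := hl.trans hlk.le
    have h1 : d l ≤ d k := d_le_d hlk.le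
    have h2 : d l + p l ≤ d k + p k := by
      have := p_le_d hl
      have h3 : 2 * d l ≤ d k := by
        unfold d
        rw [← pow_succ']
        exact Nat.pow_le_pow_right (by norm_num) (by nlinarith)
      omega
    exact IsComb.integral_mul_eq_zero hT h hl hlk (N := n + p k + d k) (by omega)
      (isComb_blockSum le_rfl) (isComb_blockSum (by omega))
  rcases hlk.lt_or_gt with hlt | hlt
  · simpa only [mul_comm] using key l k hl hlt hnl
  · exact key k l hk hlt hnk

theorem L2Le_block {k : ℕ} (hk : 2 ≤ k) :
    L2Le μ (fun x => (block T fbar k x : ℝ)) (2 * (√(p k) * α k)) := by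
  have hc : 0 ≤ √(p k) * α k := mul_nonneg (Real.sqrt_nonneg _) (α_nonneg k)
  have := (L2Le_sum_range_xr hT h hk (m := p k) (by omega) 0).sub
    (L2Le_sum_range_xr hT h hk (m := p k) (by omega) (d k)) hc hc
  rw [← two_mul] at this
  refine this.congr (Eventually.of_forall fun x => ?_)
  exact (block_eq k 0 x).symm

theorem L2Le_blockSum_sub_mainSum {k : ℕ} (hk : 2 ≤ k) (n : ℕ) :
    L2Le μ (fun x => blockSum T fbar k n x - mainSum T fbar k n x)
      (4 * (p k * (√(p k) * α k))) := by
  have hα := α_nonneg k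
  have hc : ∀ m : ℕ, 0 ≤ √(m : ℝ) * α k := fun m => mul_nonneg (Real.sqrt_nonneg _) hα
  have hshift : ∀ i < p k, ∀ a : ℕ, L2Le μ (fun x => ∑ j ∈ Finset.range n, xr T fbar k (i + j + a) x -
      ∑ j ∈ Finset.range n, xr T fbar k (j + a) x) (2 * (√(p k) * α k)) := by
    intro i hi a
    have h1 := ((L2Le_sum_range_xr hT h hk (m := i) (by omega) (n + a)).sub
      (L2Le_sum_range_xr hT h hk (m := i) (by omega) a) (hc i) (hc i)).mono
      (b := 2 * (√(p k) * α k)) (by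
        rw [← two_mul]
        gcongr)
    refine h1.congr (Eventually.of_forall fun x => ?_)
    have e := Finset.sum_range_add (fun j => xr T fbar k (j + a) x) i n
    rw [add_comm i n, Finset.sum_range_add] at e
    have e1 : ∑ j ∈ Finset.range i, xr T fbar k (n + j + a) x =
        ∑ j ∈ Finset.range i, xr T fbar k (j + (n + a)) x :=
      Finset.sum_congr rfl fun j _ => by congr 1; omega
    simp only
    linarith
  have hsum : ∀ a : ℕ, L2Le μ (fun x => ∑ i ∈ Finset.range (p k),
      (∑ j ∈ Finset.range n, xr T fbar k (i + j + a) x -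
      ∑ j ∈ Finset.range n, xr T fbar k (j + a) x)) (p k * (2 * (√(p k) * α k))) := by
    intro a
    have := L2Le.sum (s := Finset.range (p k)) (fun i hi => hshift i (Finset.mem_range.1 hi) a)
      (fun i _ => mul_nonneg zero_le_two (hc _))
    rwa [Finset.sum_const, Finset.card_range, nsmul_eq_mul] at this
  have hc' : 0 ≤ p k * (2 * (√(p k) * α k)) :=
    mul_nonneg (Nat.cast_nonneg _) (mul_nonneg zero_le_two (hc _))
  have := (hsum 0).sub (hsum (d k)) hc' hc'
  refine (this.mono (le_of_eq (by ring))).congr (Eventually.of_forall fun x => ?_)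
  simp only [blockSum, mainSum, Finset.sum_sub_distrib, Finset.sum_const, Finset.card_range,
    nsmul_eq_mul, add_zero]
  rw [Finset.sum_comm, Finset.sum_comm (s := Finset.range n) (t := Finset.range (p k))
    (f := fun j i => xr T fbar k (i + j + d k) x)]
  ring

theorem memLp_mainSum {k : ℕ} (hk : 2 ≤ k) (n : ℕ) : MemLp (mainSum T fbar k n) 2 μ :=
  ((memLp_finsetSum _ fun j _ => memLp_xr hT h hk j).sub
    (memLp_finsetSum _ fun j _ => memLp_xr hT h hk (j + d k))).const_mul _

theorem integral_mainSum_sq {k n : ℕ} (hk : 2 ≤ k) (hn : n ≤ d k) :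
    ∫ x, mainSum T fbar k n x ^ 2 ∂μ = n * (2 * (p k ^ 2 * α k ^ 2)) := by
  simp only [mainSum_eq T fbar hn (N := d k + n) le_rfl]
  rw [integral_sum_xr_sq hT h hk fun j hj => by have := Finset.mem_range.1 hj; omega,
    sum_range_of_two_windows hn le_rfl (fun j h1 h2 => by rw [mainCoeff_between h1 h2]; simp)
    (fun j h1 => by rw [mainCoeff_beyond h1]; simp),
    Finset.sum_congr rfl fun j hj => by rw [mainCoeff_of_lt (Finset.mem_range.1 hj)],
    Finset.sum_congr (s₁ := Finset.range n) (f := fun j => mainCoeff k n (j + d k) ^ 2) rfl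
      fun j hj => by rw [mainCoeff_add hn (Finset.mem_range.1 hj)]]
  simp only [Finset.sum_const, Finset.card_range, nsmul_eq_mul]
  ring

theorem integral_sum_mainSum_sq {n : ℕ} {s : Finset ℕ} (hs : ∀ k ∈ s, 2 ≤ k ∧ n ≤ d k) :
    ∫ x, (∑ k ∈ s, mainSum T fbar k n x) ^ 2 ∂μ = n * ∑ k ∈ s, 2 * (p k ^ 2 * α k ^ 2) := by
  have key : ∀ l ∈ s, ∀ k ∈ s, l < k →
      ∫ x, mainSum T fbar k n x * mainSum T fbar l n x ∂μ = 0 := by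
    intro l hl k hk hlk
    have h1 : d l ≤ d k := d_le_d hlk.le
    have h2 := (hs l hl).2
    exact IsComb.integral_mul_eq_zero hT h (hs l hl).1 hlk (N := d k + n) (by omega)
      ⟨_, mainSum_eq T fbar (hs k hk).2 le_rfl⟩ ⟨_, mainSum_eq T fbar h2 (by omega)⟩
  rw [integral_sq_sum_of_orthogonal fun k hk => memLp_mainSum hT h (hs k hk).1 n, Finset.mul_sum]
  · exact Finset.sum_congr rfl fun k hk => integral_mainSum_sq hT h (hs k hk).1 (hs k hk).2
  · intro k hk l hl hkl
    rcases hkl.lt_or_gt with hlt | hlt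
    · simpa only [mul_comm] using key k hk l hl hlt
    · exact key l hl k hk hlt

theorem charFun_const_mul_xr {k : ℕ} (hk : 2 ≤ k) (j : ℕ) (c t : ℝ) :
    charFun (μ.map fun x => c * xr T fbar k j x) t =
      ((1 - α k ^ 2 * (1 - Real.cos (t * c)) : ℝ) : ℂ) := by
  have hm : Measurable fun x => c * xr T fbar k j x := (measurable_xr hT h hk j).const_mul c
  rw [charFun_apply_real, integral_map hm.aemeasurable (by fun_prop)]
  have := integral_comp_fbar hT h hk j
    (fun z : ℤ => Complex.exp ((t : ℂ) * ((c * (z : ℝ) : ℝ) : ℂ) * Complex.I))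
  simp only [xr]
  rw [this]
  have hc : Complex.exp ((t : ℂ) * ((c * ((1 : ℤ) : ℝ) : ℝ) : ℂ) * Complex.I) +
      Complex.exp ((t : ℂ) * ((c * ((-1 : ℤ) : ℝ) : ℝ) : ℂ) * Complex.I) =
      2 * (Real.cos (t * c) : ℂ) := by
    push_cast
    rw [Complex.cos, mul_div_cancel₀ _ two_ne_zero]
    congr 2 <;> ring_nf
  rw [hc]
  simp only [Int.cast_zero, mul_zero, Complex.ofReal_zero, zero_mul, Complex.exp_zero,
    Complex.real_smul]
  push_cast
  ring

theorem charFun_const_mul_mainSum {k n : ℕ} (hk : 2 ≤ k) (hn : n ≤ d k) (c t : ℝ) :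
    charFun (μ.map fun x => c * mainSum T fbar k n x) t =
      (((1 - α k ^ 2 * (1 - Real.cos (t * c * p k))) ^ (2 * n) : ℝ) : ℂ) := by
  have e : (fun x => c * mainSum T fbar k n x) = fun x => ∑ j : Fin (2 * d k + p k + 1),
      c * mainCoeff k n j * xr T fbar k j x := by
    ext x
    rw [mainSum_eq T fbar hn (N := 2 * d k + p k + 1) (by omega),
      Fin.sum_univ_eq_sum_range (fun j => c * mainCoeff k n j * xr T fbar k j x), Finset.mul_sum]
    simp only [mul_assoc]
  have hind : iIndepFun (fun (j : Fin (2 * d k + p k + 1)) x =>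
      c * mainCoeff k n j * xr T fbar k j x) μ :=
    (iIndepFun_xr hT h hk).comp (fun j y => c * mainCoeff k n j * y)
      (fun j => measurable_const_mul _)
  rw [e, iIndepFun.charFun_map_fun_sum_eq_prod (fun j : Fin (2 * d k + p k + 1) =>
    ((measurable_xr hT h hk j).const_mul _).aemeasurable) hind, Finset.prod_apply]
  simp only [charFun_const_mul_xr hT h hk]
  rw [Fin.prod_univ_eq_prod_range (fun j =>
    ((1 - α k ^ 2 * (1 - Real.cos (t * (c * mainCoeff k n j))) : ℝ) : ℂ)),
    prod_range_of_two_windows (n := n) (d := d k) hn (by omega)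
      (fun j h1 h2 => by rw [mainCoeff_between h1 h2]; simp)
      (fun j h1 => by rw [mainCoeff_beyond h1]; simp),
    Finset.prod_congr rfl fun j hj => by rw [mainCoeff_of_lt (Finset.mem_range.1 hj)],
    Finset.prod_congr (s₁ := Finset.range n) (f := fun j => ((1 - α k ^ 2 *
      (1 - Real.cos (t * (c * mainCoeff k n (j + d k)))) : ℝ) : ℂ)) rfl
      fun j hj => by rw [mainCoeff_add hn (Finset.mem_range.1 hj), mul_neg, mul_neg, Real.cos_neg]]
  simp only [Finset.prod_const, Finset.card_range]
  push_cast
  rw [← pow_add, two_mul, mul_assoc (t : ℂ)]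

theorem charFun_const_mul_sum_mainSum {n : ℕ} {a b : ℕ} (ha : 2 ≤ a) (hn : n ≤ d a) (c t : ℝ) :
    charFun (μ.map fun x => c * ∑ k ∈ Finset.Ico a b, mainSum T fbar k n x) t =
      ((∏ k ∈ Finset.Ico a b,
        (1 - α k ^ 2 * (1 - Real.cos (t * c * p k))) ^ (2 * n) : ℝ) : ℂ) := by
  have hm : ∀ k, 2 ≤ k → Measurable (mainSum T fbar k n) := by
    intro k hk
    have := measurable_xr hT h hk
    unfold mainSum
    fun_prop
  rcases le_or_gt b a with hab | hab
  · simp [Finset.Ico_eq_empty_of_le hab]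
  induction b, hab.le using Nat.le_induction with
  | base => simp
  | succ b hb ih =>
    rcases hb.eq_or_lt with rfl | hb'
    · simp only [Nat.Ico_succ_singleton, Finset.sum_singleton, Finset.prod_singleton]
      exact charFun_const_mul_mainSum hT h ha hn c t
    have hb2 : 2 ≤ b := ha.trans hb
    have hnb : n ≤ d b :=
      hn.trans (d_le_d hb)
    have hind : IndepFun (fun x => c * ∑ k ∈ Finset.Ico a b, mainSum T fbar k n x)
        (fun x => c * mainSum T fbar b n x) μ := by
      have := (indepFun_xr_past hT h hb2).comp
        (φ := fun v => c * ∑ j ∈ Finset.range (d b + n), mainCoeff b n j * v j)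
        (ψ := fun v => c * ∑ k ∈ Finset.Ico a b, ∑ j ∈ Finset.range (d b + n),
          mainCoeff k n j * v (k, j)) (by fun_prop) (by fun_prop)
      refine (this.congr (ae_of_all _ fun x => ?_) (ae_of_all _ fun x => ?_)).symm
      · simp only [Function.comp_apply]
        rw [mainSum_eq T fbar hnb le_rfl]
        congr 1
        refine Finset.sum_congr rfl fun j hj => ?_
        rw [if_pos (by have := Finset.mem_range.1 hj; omega)]
      · simp only [Function.comp_apply]
        congr 1
        refine Finset.sum_congr rfl fun k hk => ?_
        rw [Finset.mem_Ico] at hk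
        have hnk : n ≤ d k :=
          hn.trans (d_le_d hk.1)
        have hkb : d k ≤ d b :=
          d_le_d hk.2.le
        rw [mainSum_eq T fbar hnk (N := d b + n) (by omega)]
        refine Finset.sum_congr rfl fun j hj => ?_
        rw [if_pos (by have := Finset.mem_range.1 hj; omega)]
    have hsm : Measurable fun x => c * ∑ k ∈ Finset.Ico a b, mainSum T fbar k n x :=
      (Finset.measurable_fun_sum _ fun k hk => hm k (ha.trans (Finset.mem_Ico.1 hk).1)).const_mul c
    simp only [Finset.sum_Ico_succ_top hb, Finset.prod_Ico_succ_top hb, mul_add]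
    rw [hind.charFun_map_fun_add_eq_mul hsm.aemeasurable ((hm b hb2).const_mul c).aemeasurable,
      Pi.mul_apply, ih hb', charFun_const_mul_mainSum hT h hb2 hnb]
    push_cast
    rfl

end Coding

end KosloffVolny

namespace KosloffVolny

/-- The variance weights `1 / (k log₂ k)`. -/
noncomputable def weight (k : ℕ) : ℝ := 1 / ((k : ℝ) * Real.logb 2 (k : ℝ))

theorem p_mul_α_sq {k : ℕ} (hk : 2 ≤ k) : (p k * α k) ^ 2 = weight k := by
  rw [mul_pow, p_sq_mul_α_sq hk, weight]

theorem weight_le {k : ℕ} (hk : 2 ≤ k) : weight k ≤ 1 / k := by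
  have h1 := one_le_logb hk
  have h2 : (2 : ℝ) ≤ k := by exact_mod_cast hk
  unfold weight
  gcongr
  nlinarith

theorem p_mul_α_le {k K : ℕ} (hK : 2 ≤ K) (hk : K ≤ k) : p k * α k ≤ 1 / √K := by
  have hK0 : (0 : ℝ) < K := by exact_mod_cast (show 0 < K by omega)
  refine le_of_sq_le_sq ?_ (by positivity)
  rw [p_mul_α_sq (hK.trans hk), div_pow, Real.sq_sqrt hK0.le, one_pow]
  refine (weight_le (hK.trans hk)).trans ?_
  gcongr

theorem sqrt_half_le : √(1 / 2 : ℝ) ≤ 3 / 4 := by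
  rw [Real.sqrt_le_left (by norm_num)]
  norm_num

theorem sqrt_p_mul_α_le {k K : ℕ} (hK : 2 ≤ K) (hk : K ≤ k) :
    √(p k) * α k ≤ 3 / 2 * √(1 / 2) ^ k / √K := by
  have hK0 : (0 : ℝ) < K := by exact_mod_cast (show 0 < K by omega)
  have hp : (0 : ℝ) < p k := by exact_mod_cast p_pos k
  have h1 := p_mul_α_le hK hk
  have h2 : √(p k) * α k = p k * α k * (1 / √(p k)) := by
    have := Real.mul_self_sqrt hp.le
    have h0 : √(p k : ℝ) ≠ 0 := (Real.sqrt_pos.2 hp).ne'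
    field_simp
    linear_combination (α k) * this
  have h3 : 1 / √(p k : ℝ) ≤ 3 / 2 * √(1 / 2) ^ k := by
    rw [div_le_iff₀ (Real.sqrt_pos.2 hp)]
    refine le_of_sq_le_sq ?_ (by positivity)
    rw [mul_pow, mul_pow, Real.sq_sqrt hp.le, ← pow_mul, mul_comm k 2, pow_mul,
      Real.sq_sqrt (by norm_num)]
    have h4 : (2 : ℝ) ^ (k - 1) ≤ p k := by exact_mod_cast two_pow_le_p (by omega)
    have h5 : (2 : ℝ) ^ k = 2 * 2 ^ (k - 1) := by rw [← pow_succ']; congr 1; omega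
    have h6 : (1 / 2 : ℝ) ^ k * 2 ^ k = 1 := by rw [← mul_pow]; norm_num
    have h7 : (0 : ℝ) < (1 / 2) ^ k := by positivity
    rw [one_pow]
    calc (1 : ℝ) = (1 / 2) ^ k * (2 * 2 ^ (k - 1)) := by rw [← h5, h6]
      _ ≤ (1 / 2) ^ k * (2 * p k) := by gcongr
      _ ≤ (3 / 2) ^ 2 * (1 / 2) ^ k * p k := by nlinarith [mul_pos h7 hp]
  rw [h2]
  calc p k * α k * (1 / √(p k)) ≤ 1 / √K * (3 / 2 * √(1 / 2) ^ k) := by gcongr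
    _ = _ := by ring

section Coding

variable {X : Type*} [MeasurableSpace X] {μ : Measure X} [IsProbabilityMeasure μ]
  {T : X → X} {fbar : ℕ → X → ℤ}

variable (hT : MeasurePreserving T μ μ) (h : IsCodingSequence T μ fbar)
include hT h

theorem L2Le_sum_block {K : ℕ} (hK : 2 ≤ K) (m : ℕ) :
    L2Le μ (fun x => ∑ k ∈ Finset.Ico K m, (block T fbar k x : ℝ)) (12 * √(1 / 2) ^ K / √K) := by
  refine (L2Le.sum (s := Finset.Ico K m) (fun k hk => L2Le_block hT h
    (hK.trans (Finset.mem_Ico.1 hk).1)) fun k _ => mul_nonneg zero_le_two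
    (mul_nonneg (Real.sqrt_nonneg _) (α_nonneg k))).mono ?_
  have hq0 : 0 ≤ √(1 / 2 : ℝ) := Real.sqrt_nonneg _
  have hq := sqrt_half_le
  calc ∑ k ∈ Finset.Ico K m, 2 * (√(p k) * α k)
      ≤ ∑ k ∈ Finset.Ico K m, (3 / √K) * √(1 / 2) ^ k := by
        refine Finset.sum_le_sum fun k hk => ?_
        have := sqrt_p_mul_α_le hK (Finset.mem_Ico.1 hk).1
        calc 2 * (√(p k) * α k) ≤ 2 * (3 / 2 * √(1 / 2) ^ k / √K) := by gcongr
          _ = _ := by ring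
    _ = (3 / √K) * ∑ k ∈ Finset.Ico K m, √(1 / 2) ^ k := by rw [Finset.mul_sum]
    _ ≤ (3 / √K) * (√(1 / 2) ^ K / (1 - √(1 / 2))) := by
        gcongr
        exact geom_sum_Ico_le_of_lt_one hq0 (by linarith)
    _ ≤ (3 / √K) * (√(1 / 2) ^ K / (1 / 4)) := by
        gcongr
        linarith
    _ = _ := by ring

/-- Almost everywhere the series defining `f` is a finite sum. -/
theorem ae_eventually_f_eq : ∀ᵐ x ∂μ, ∀ᶠ m in atTop,
    (f T fbar x : ℝ) = ∑ k ∈ Finset.Ico 2 m, (block T fbar k x : ℝ) := by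
  have hmeas : ∀ k, μ {x | block T fbar (k + 2) x ≠ 0} ≤ ENNReal.ofReal (9 * (1 / 2) ^ k) := by
    intro k
    have hB := L2Le_block hT h (k := k + 2) (by omega)
    have h1 := meas_ge_le_mul_pow_eLpNorm_enorm μ (p := 2) (by norm_num) (by norm_num) hB.1
      (ε := 1) (by norm_num) (by norm_num)
    have h2 : {x | block T fbar (k + 2) x ≠ 0} ⊆
        {x | (1 : ENNReal) ≤ ‖(block T fbar (k + 2) x : ℝ)‖ₑ} := by
      intro x hx
      have : (1 : ℝ) ≤ |(block T fbar (k + 2) x : ℝ)| := by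
        exact_mod_cast Int.one_le_abs hx
      rw [Set.mem_ofPred_eq, ← ENNReal.ofReal_one, ← ofReal_norm]
      exact ENNReal.ofReal_le_ofReal this
    refine (measure_mono h2).trans (h1.trans ?_)
    simp only [inv_one, ENNReal.toReal_ofNat, ENNReal.rpow_ofNat, one_pow, one_mul]
    calc eLpNorm (fun x => (block T fbar (k + 2) x : ℝ)) 2 μ ^ 2
        ≤ ENNReal.ofReal (2 * (√(p (k + 2)) * α (k + 2))) ^ 2 := by gcongr; exact hB.2
      _ = ENNReal.ofReal ((2 * (√(p (k + 2)) * α (k + 2))) ^ 2) := by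
          rw [ENNReal.ofReal_pow (mul_nonneg zero_le_two
            (mul_nonneg (Real.sqrt_nonneg _) (α_nonneg _)))]
      _ ≤ _ := by
          refine ENNReal.ofReal_le_ofReal ?_
          have h3 := sqrt_p_mul_α_le (le_refl 2) (show 2 ≤ k + 2 by omega)
          have h4 : 0 ≤ √(p (k + 2) : ℝ) * α (k + 2) :=
            mul_nonneg (Real.sqrt_nonneg _) (α_nonneg _)
          have h5 : (√(p (k + 2) : ℝ) * α (k + 2)) ^ 2 ≤
              (3 / 2 * √(1 / 2) ^ (k + 2) / √((2 : ℕ) : ℝ)) ^ 2 := by gcongr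
          have h6 : (3 / 2 * √(1 / 2) ^ (k + 2) / √((2 : ℕ) : ℝ)) ^ 2 =
              9 / 8 * (1 / 2) ^ (k + 2) := by
            rw [div_pow, mul_pow, Real.sq_sqrt (by positivity), ← pow_mul, mul_comm (k + 2) 2,
              pow_mul, Real.sq_sqrt (by norm_num)]
            push_cast
            ring
          rw [mul_pow]
          rw [h6] at h5
          have h7 : (0 : ℝ) < (1 / 2) ^ k := by positivity
          rw [pow_add] at h5
          nlinarith
  have hsum : ∑' k, μ {x | block T fbar (k + 2) x ≠ 0} ≠ ⊤ := by
    refine ne_top_of_le_ne_top ?_ (ENNReal.tsum_le_tsum hmeas)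
    rw [← ENNReal.ofReal_tsum_of_nonneg (fun k => by positivity)
      (summable_geometric_two.mul_left 9)]
    exact ENNReal.ofReal_ne_top
  filter_upwards [ae_eventually_notMem hsum] with x hx
  obtain ⟨M, hM⟩ := eventually_atTop.1 hx
  filter_upwards [eventually_ge_atTop (M + 2)] with m hm
  have : f T fbar x = ∑ k ∈ Finset.range (m - 2), block T fbar (k + 2) x := by
    refine tsum_eq_sum fun k hk => ?_
    by_contra hne
    exact hM k (by have := Finset.mem_range.not.1 hk; omega) hne
  rw [this, Finset.sum_Ico_eq_sum_range]
  push_cast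
  simp only [add_comm]

theorem L2Le_f_sub {K : ℕ} (hK : 2 ≤ K) :
    L2Le μ (fun x => (f T fbar x : ℝ) - ∑ k ∈ Finset.Ico 2 K, (block T fbar k x : ℝ))
      (12 * √(1 / 2) ^ K / √K) := by
  have hlim : ∀ᵐ x ∂μ, Tendsto (fun m => ∑ k ∈ Finset.Ico K m, (block T fbar k x : ℝ)) atTop
      (𝓝 ((f T fbar x : ℝ) - ∑ k ∈ Finset.Ico 2 K, (block T fbar k x : ℝ))) := by
    filter_upwards [ae_eventually_f_eq hT h] with x hx
    refine tendsto_const_nhds.congr' ?_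
    filter_upwards [hx, eventually_ge_atTop K] with m hm hKm
    rw [hm, ← Finset.sum_Ico_consecutive _ hK hKm, add_sub_cancel_left]
  have hm : ∀ m, AEStronglyMeasurable
      (fun x => ∑ k ∈ Finset.Ico K m, (block T fbar k x : ℝ)) μ := fun m =>
    (L2Le_sum_block hT h hK m).1
  exact ⟨aestronglyMeasurable_of_tendsto_ae atTop hm hlim,
    Lp.eLpNorm_le_of_ae_tendsto (Eventually.of_forall fun m => (L2Le_sum_block hT h hK m).2) hm
      hlim⟩

theorem memLp_f : MemLp (fun x => (f T fbar x : ℝ)) 2 μ := by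
  simpa using (L2Le_f_sub hT h le_rfl).memLp

theorem tendsto_eLpNorm_f_sub : Tendsto (fun K : ℕ => eLpNorm (fun x => (f T fbar x : ℝ)
    - ∑ k ∈ Finset.Ico 2 K, (block T fbar k x : ℝ)) 2 μ) atTop (𝓝 0) := by
  have h1 : Tendsto (fun K : ℕ => ENNReal.ofReal (12 * √(1 / 2) ^ K)) atTop (𝓝 0) := by
    rw [← ENNReal.ofReal_zero]
    refine ENNReal.tendsto_ofReal ?_
    have := (tendsto_pow_atTop_nhds_zero_of_lt_one (Real.sqrt_nonneg (1 / 2))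
      (by linarith [sqrt_half_le])).const_mul 12
    simpa using this
  refine tendsto_of_tendsto_of_tendsto_of_le_of_le' tendsto_const_nhds h1
    (Eventually.of_forall fun _ => zero_le) ?_
  filter_upwards [eventually_ge_atTop 2] with K hK
  refine (L2Le_f_sub hT h hK).2.trans (ENNReal.ofReal_le_ofReal ?_)
  refine div_le_self (by positivity) ?_
  rw [Real.one_le_sqrt]
  exact_mod_cast (by omega : 1 ≤ K)

theorem memLp_S (n : ℕ) : MemLp (S T fbar n) 2 μ := by
  change MemLp (fun x => ∑ j ∈ Finset.range n, (f T fbar (T^[j] x) : ℝ)) 2 μ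
  exact memLp_finsetSum _ fun j _ => (memLp_f hT h).comp_measurePreserving (hT.iterate j)

theorem L2Le_S_sub {K : ℕ} (hK : 2 ≤ K) (n : ℕ) :
    L2Le μ (fun x => S T fbar n x - ∑ k ∈ Finset.Ico 2 K, blockSum T fbar k n x)
      (n * (12 * √(1 / 2) ^ K / √K)) := by
  have := L2Le.sum (s := Finset.range n) (fun j _ => (L2Le_f_sub hT h hK).comp (hT.iterate j))
    (fun j _ => by positivity)
  rw [Finset.sum_const, Finset.card_range, nsmul_eq_mul] at this
  refine this.congr (Eventually.of_forall fun x => ?_)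
  simp only [S, ← birkhoffSum_block, birkhoffSum, Finset.sum_sub_distrib]
  rw [Finset.sum_comm]

end Coding

end KosloffVolny

namespace KosloffVolny

section Sums

theorem weight_eq (k : ℕ) : weight k = Real.log 2 * (1 / (k * Real.log k)) := by
  unfold weight Real.logb
  rw [← mul_div_assoc, one_div_div, mul_one_div]

theorem weight_nonneg (k : ℕ) : 0 ≤ weight k := by
  rw [weight_eq]
  have := Real.log_natCast_nonneg k
  have := Real.log_nonneg one_le_two
  positivity

theorem log_log_succ_sub_le {x : ℝ} (hx : 1 < x) :
    Real.log (Real.log (x + 1)) - Real.log (Real.log x) ≤ 1 / (x * Real.log x) := by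
  have h0 : 0 < Real.log x := Real.log_pos hx
  have h1 : 0 < Real.log (x + 1) := Real.log_pos (by linarith)
  have h2 : Real.log (x + 1) - Real.log x ≤ 1 / x := by
    rw [← Real.log_div (by linarith) (by linarith)]
    refine (Real.log_le_sub_one_of_pos (by positivity)).trans (le_of_eq ?_)
    field_simp
    ring
  rw [← Real.log_div h1.ne' h0.ne']
  calc Real.log (Real.log (x + 1) / Real.log x)
      ≤ Real.log (x + 1) / Real.log x - 1 := Real.log_le_sub_one_of_pos (by positivity)
    _ = (Real.log (x + 1) - Real.log x) / Real.log x := by field_simp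
    _ ≤ (1 / x) / Real.log x := by gcongr
    _ = _ := by rw [div_div]

theorem le_log_log_succ_sub {x : ℝ} (hx : 1 < x) :
    1 / ((x + 1) * Real.log (x + 1)) ≤ Real.log (Real.log (x + 1)) - Real.log (Real.log x) := by
  have h0 : 0 < Real.log x := Real.log_pos hx
  have h1 : 0 < Real.log (x + 1) := Real.log_pos (by linarith)
  have h2 : Real.log x - Real.log (x + 1) ≤ -(1 / (x + 1)) := by
    rw [← Real.log_div (by linarith) (by linarith)]
    refine (Real.log_le_sub_one_of_pos (by positivity)).trans (le_of_eq ?_)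
    field_simp
    ring
  have h3 : Real.log (Real.log x) - Real.log (Real.log (x + 1)) ≤
      -(1 / ((x + 1) * Real.log (x + 1))) := by
    rw [← Real.log_div h0.ne' h1.ne']
    calc Real.log (Real.log x / Real.log (x + 1))
        ≤ Real.log x / Real.log (x + 1) - 1 := Real.log_le_sub_one_of_pos (by positivity)
      _ = (Real.log x - Real.log (x + 1)) / Real.log (x + 1) := by field_simp
      _ ≤ (-(1 / (x + 1))) / Real.log (x + 1) := by gcongr
      _ = _ := by rw [neg_div, div_div]
  linarith

theorem le_sum_weight {a b : ℕ} (ha : 2 ≤ a) (hab : a ≤ b) :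
    Real.log 2 * (Real.log (Real.log b) - Real.log (Real.log a)) ≤
      ∑ k ∈ Finset.Ico a b, weight k := by
  induction b, hab using Nat.le_induction with
  | base => simp
  | succ b hb ih =>
    rw [Finset.sum_Ico_succ_top hb, weight_eq b]
    have h1 := log_log_succ_sub_le (x := b) (by exact_mod_cast (by omega : 1 < b))
    have h2 := mul_le_mul_of_nonneg_left h1 (Real.log_nonneg one_le_two)
    push_cast
    linarith

theorem sum_weight_le {a b : ℕ} (ha : 2 ≤ a) (hab : a ≤ b) :
    ∑ k ∈ Finset.Ico (a + 1) (b + 1), weight k ≤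
      Real.log 2 * (Real.log (Real.log b) - Real.log (Real.log a)) := by
  induction b, hab using Nat.le_induction with
  | base => simp
  | succ b hb ih =>
    rw [Finset.sum_Ico_succ_top (by omega), weight_eq (b + 1)]
    have h1 := le_log_log_succ_sub (x := b) (by exact_mod_cast (by omega : 1 < b))
    have h2 := mul_le_mul_of_nonneg_left h1 (Real.log_nonneg one_le_two)
    push_cast
    linarith

theorem tendsto_nat_sqrt : Tendsto Nat.sqrt atTop atTop :=
  tendsto_atTop.2 fun b => (eventually_ge_atTop (b * b)).mono fun _ hn => Nat.le_sqrt.2 hn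

theorem tendsto_log_two : Tendsto (Nat.log 2) atTop atTop :=
  tendsto_atTop.2 fun b => (eventually_ge_atTop (2 ^ b)).mono fun _ hn =>
    Nat.le_log_of_pow_le one_lt_two hn

theorem tendsto_sum_weight_main : Tendsto (fun L : ℕ =>
    ∑ k ∈ Finset.Ico (Nat.sqrt L + 2) (L / 3 + 1), weight k) atTop (𝓝 (Real.log 2 ^ 2)) := by
  have hlog2 : 0 < Real.log 2 := Real.log_pos one_lt_two
  have hs : Tendsto (fun L : ℕ => ((Nat.sqrt L + 2 : ℕ) : ℝ)) atTop atTop :=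
    tendsto_natCast_atTop_atTop.comp ((tendsto_add_atTop_nat 2).comp tendsto_nat_sqrt)
  have hlow : Tendsto (fun L : ℕ => Real.log 2 *
      Real.log (2 - Real.log 12 / Real.log ((Nat.sqrt L + 2 : ℕ) : ℝ))) atTop
      (𝓝 (Real.log 2 ^ 2)) := by
    have h1 : Tendsto (fun L : ℕ => 2 - Real.log 12 / Real.log ((Nat.sqrt L + 2 : ℕ) : ℝ)) atTop
        (𝓝 (2 - 0)) :=
      tendsto_const_nhds.sub ((Real.tendsto_log_atTop.comp hs).const_div_atTop _)
    rw [sub_zero] at h1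
    rw [pow_two]
    exact (h1.log two_ne_zero).const_mul _
  refine tendsto_of_tendsto_of_tendsto_of_le_of_le' hlow tendsto_const_nhds ?_ ?_
  · filter_upwards [eventually_ge_atTop 100] with L hL
    obtain ⟨r, hr⟩ : ∃ r, Nat.sqrt L = r := ⟨_, rfl⟩
    have h1 : r * r ≤ L := hr ▸ Nat.sqrt_le L
    have h10 : 10 ≤ r := hr ▸ Nat.le_sqrt.2 (by omega)
    rw [hr]
    refine le_trans ?_ (le_sum_weight (by omega) ?_)
    swap
    · have : 3 * (r + 2) ≤ r * r := by nlinarith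
      omega
    have hK : ((r + 2 : ℕ) : ℝ) ^ 2 / 12 ≤ ((L / 3 + 1 : ℕ) : ℝ) := by
      have h2 : L ≤ 3 * (L / 3 + 1) := by omega
      have h3 : (r : ℝ) * r ≤ 3 * ((L / 3 + 1 : ℕ) : ℝ) := by exact_mod_cast h1.trans h2
      have h4 : (10 : ℝ) ≤ r := by exact_mod_cast h10
      push_cast at h3 ⊢
      nlinarith
    have hr2 : (12 : ℝ) ≤ ((r + 2 : ℕ) : ℝ) := by exact_mod_cast (by omega : 12 ≤ r + 2)
    have h5 : 0 < Real.log ((r + 2 : ℕ) : ℝ) := Real.log_pos (by linarith)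
    have h12 : Real.log 12 ≤ Real.log ((r + 2 : ℕ) : ℝ) := Real.log_le_log (by norm_num) hr2
    have h6 : Real.log (((r + 2 : ℕ) : ℝ) ^ 2 / 12) =
        2 * Real.log ((r + 2 : ℕ) : ℝ) - Real.log 12 := by
      rw [Real.log_div (by positivity) (by norm_num), Real.log_pow]
      norm_num
    refine mul_le_mul_of_nonneg_left ?_ hlog2.le
    have h7 : 2 - Real.log 12 / Real.log ((r + 2 : ℕ) : ℝ) =
        Real.log (((r + 2 : ℕ) : ℝ) ^ 2 / 12) / Real.log ((r + 2 : ℕ) : ℝ) := by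
      rw [h6]
      field_simp
    have h8 : 0 < Real.log (((r + 2 : ℕ) : ℝ) ^ 2 / 12) := by rw [h6]; linarith
    rw [h7, Real.log_div h8.ne' h5.ne']
    refine sub_le_sub_right (Real.log_le_log h8 (Real.log_le_log (by positivity) hK)) _
  · filter_upwards [eventually_ge_atTop 1] with L hL
    obtain ⟨r, hr⟩ : ∃ r, Nat.sqrt L = r := ⟨_, rfl⟩
    have h1 : L < (r + 1) * (r + 1) := hr ▸ Nat.lt_succ_sqrt L
    have h10 : 1 ≤ r := hr ▸ Nat.le_sqrt.2 (by omega)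
    rw [hr]
    rcases lt_or_ge (L / 3) (r + 1) with h2 | h2
    · rw [Finset.Ico_eq_empty (by omega), Finset.sum_empty]
      positivity
    refine (sum_weight_le (by omega) h2).trans ?_
    rw [pow_two]
    refine mul_le_mul_of_nonneg_left ?_ hlog2.le
    have hr2 : (1 : ℝ) < ((r + 1 : ℕ) : ℝ) := by exact_mod_cast (by omega : 1 < r + 1)
    have h5 : 0 < Real.log ((r + 1 : ℕ) : ℝ) := Real.log_pos hr2
    have h3 : ((L / 3 : ℕ) : ℝ) ≤ ((r + 1 : ℕ) : ℝ) ^ 2 := by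
      rw [pow_two]
      exact_mod_cast (Nat.div_le_self L 3).trans h1.le
    have h4 : (1 : ℝ) < ((L / 3 : ℕ) : ℝ) := by exact_mod_cast (by omega : 1 < L / 3)
    have h6 : Real.log (Real.log ((L / 3 : ℕ) : ℝ)) ≤
        Real.log (2 * Real.log ((r + 1 : ℕ) : ℝ)) := by
      refine Real.log_le_log (Real.log_pos h4) ?_
      refine (Real.log_le_log (by linarith) h3).trans_eq ?_
      rw [Real.log_pow]
      norm_num
    rw [Real.log_mul two_ne_zero h5.ne'] at h6
    linarith

theorem tendsto_sum_weight_tail : Tendsto (fun L : ℕ =>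
    ∑ k ∈ Finset.Ico (L / 3 + 1) (L + 1), weight k) atTop (𝓝 0) := by
  have h1 : Tendsto (fun L : ℕ => 2 * Real.log 2 / Real.log ((L / 3 + 1 : ℕ) : ℝ)) atTop (𝓝 0) :=
    (Real.tendsto_log_atTop.comp (tendsto_natCast_atTop_atTop.comp ((tendsto_add_atTop_nat 1).comp
      (Nat.tendsto_div_const_atTop three_ne_zero)))).const_div_atTop _
  refine tendsto_of_tendsto_of_tendsto_of_le_of_le' tendsto_const_nhds h1
    (Eventually.of_forall fun L => Finset.sum_nonneg fun k _ => weight_nonneg k) ?_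
  filter_upwards [eventually_ge_atTop 3] with L hL
  have hK : (1 : ℝ) < ((L / 3 + 1 : ℕ) : ℝ) := by exact_mod_cast (by omega : 1 < L / 3 + 1)
  have h5 : 0 < Real.log ((L / 3 + 1 : ℕ) : ℝ) := Real.log_pos hK
  calc ∑ k ∈ Finset.Ico (L / 3 + 1) (L + 1), weight k
      ≤ ∑ k ∈ Finset.Ico (L / 3 + 1) (L + 1), Real.log 2 *
          (1 / (((L / 3 + 1 : ℕ) : ℝ) * Real.log ((L / 3 + 1 : ℕ) : ℝ))) := by
        refine Finset.sum_le_sum fun k hk => ?_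
        have h6 : ((L / 3 + 1 : ℕ) : ℝ) ≤ k := by exact_mod_cast (Finset.mem_Ico.1 hk).1
        have := Real.log_nonneg one_le_two
        rw [weight_eq]
        gcongr
    _ = ((L - L / 3 : ℕ) : ℝ) * (Real.log 2 *
          (1 / (((L / 3 + 1 : ℕ) : ℝ) * Real.log ((L / 3 + 1 : ℕ) : ℝ)))) := by
        rw [Finset.sum_const, Nat.card_Ico, nsmul_eq_mul,
          Nat.add_sub_add_right]
    _ ≤ (2 * ((L / 3 + 1 : ℕ) : ℝ)) * (Real.log 2 *
          (1 / (((L / 3 + 1 : ℕ) : ℝ) * Real.log ((L / 3 + 1 : ℕ) : ℝ)))) := by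
        have := Real.log_nonneg one_le_two
        gcongr
        exact_mod_cast (by omega : L - L / 3 ≤ 2 * (L / 3 + 1))
    _ = _ := by
        have : ((L / 3 + 1 : ℕ) : ℝ) ≠ 0 := by positivity
        field_simp

end Sums

section Characteristic

theorem abs_prod_sub_prod_le {ι : Type*} (s : Finset ι) (a b : ι → ℝ)
    (ha : ∀ i ∈ s, |a i| ≤ 1) (hb : ∀ i ∈ s, |b i| ≤ 1) :
    |∏ i ∈ s, a i - ∏ i ∈ s, b i| ≤ ∑ i ∈ s, |a i - b i| := by
  classical
  induction s using Finset.induction_on with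
  | empty => simp
  | insert i s hi ih =>
    rw [Finset.prod_insert hi, Finset.prod_insert hi, Finset.sum_insert hi]
    have h1 := ih (fun j hj => ha j (Finset.mem_insert_of_mem hj))
      fun j hj => hb j (Finset.mem_insert_of_mem hj)
    have h2 : |∏ j ∈ s, a j| ≤ 1 := by
      rw [Finset.abs_prod]
      exact Finset.prod_le_one (fun _ _ => abs_nonneg _)
        fun j hj => ha j (Finset.mem_insert_of_mem hj)
    calc |a i * ∏ j ∈ s, a j - b i * ∏ j ∈ s, b j|
        = |(a i - b i) * ∏ j ∈ s, a j + b i * (∏ j ∈ s, a j - ∏ j ∈ s, b j)| := by ring_nf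
      _ ≤ |a i - b i| * |∏ j ∈ s, a j| + |b i| * |∏ j ∈ s, a j - ∏ j ∈ s, b j| := by
          rw [← abs_mul, ← abs_mul]
          exact abs_add_le _ _
      _ ≤ |a i - b i| * 1 + 1 * ∑ j ∈ s, |a j - b j| := by
          gcongr
          exact hb i (Finset.mem_insert_self i s)
      _ = _ := by ring

theorem abs_pow_sub_pow_le_mul {a b : ℝ} (ha : |a| ≤ 1) (hb : |b| ≤ 1) (n : ℕ) :
    |a ^ n - b ^ n| ≤ n * |a - b| := by
  simpa using abs_prod_sub_prod_le (Finset.range n) (fun _ => a) (fun _ => b)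
    (fun _ _ => ha) fun _ _ => hb

theorem abs_one_sub_cos_sub_le (θ : ℝ) : |1 - Real.cos θ - θ ^ 2 / 2| ≤ θ ^ 4 / 2 := by
  have h1 := Real.one_sub_sq_div_two_le_cos (x := θ)
  have h4 : θ ^ 4 = (θ ^ 2) ^ 2 := by ring
  rcases le_or_gt |θ| 1 with h | h
  · have h2 := Real.cos_bound h
    rw [abs_sub_comm] at h2
    have h3 : |θ| ^ 4 = θ ^ 4 := by rw [pow_abs, abs_of_nonneg (by positivity)]
    rw [h3] at h2
    have h5 : 0 ≤ θ ^ 4 := by positivity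
    calc |1 - Real.cos θ - θ ^ 2 / 2| = |1 - θ ^ 2 / 2 - Real.cos θ| := by ring_nf
      _ ≤ _ := h2
      _ ≤ _ := by linarith
  · have h2 : 1 ≤ θ ^ 2 := by rw [← sq_abs]; nlinarith
    rw [abs_le]
    constructor
    · nlinarith [Real.cos_le_one θ]
    · nlinarith

theorem abs_exp_neg_sub_le {y : ℝ} (hy : 0 ≤ y) : |1 - y - Real.exp (-y)| ≤ y ^ 2 := by
  rcases le_or_gt y 1 with h | h
  · have := Real.abs_exp_sub_one_sub_id_le (x := -y) (by rw [abs_neg, abs_of_nonneg hy]; exact h)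
    rw [abs_sub_comm]
    calc |Real.exp (-y) - (1 - y)| = |Real.exp (-y) - 1 - -y| := by ring_nf
      _ ≤ _ := this
      _ = _ := by ring
  · have h1 := Real.exp_pos (-y)
    have h2 : Real.exp (-y) ≤ 1 := Real.exp_le_one_iff.2 (by linarith)
    rw [abs_le]
    constructor <;> nlinarith

theorem abs_charFactor_sub_exp_le {s θ : ℝ} (hs : 0 ≤ s) (hs1 : s ≤ 1) :
    |(1 - s * (1 - Real.cos θ)) - Real.exp (-(s * θ ^ 2 / 2))| ≤ s * θ ^ 4 := by
  have h1 := abs_one_sub_cos_sub_le θ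
  have h2 := abs_exp_neg_sub_le (y := s * θ ^ 2 / 2) (by positivity)
  have h4 : 0 ≤ θ ^ 4 := by positivity
  calc |(1 - s * (1 - Real.cos θ)) - Real.exp (-(s * θ ^ 2 / 2))|
      = |-(s * (1 - Real.cos θ - θ ^ 2 / 2)) +
          (1 - s * θ ^ 2 / 2 - Real.exp (-(s * θ ^ 2 / 2)))| := by ring_nf
    _ ≤ s * |1 - Real.cos θ - θ ^ 2 / 2| +
          |1 - s * θ ^ 2 / 2 - Real.exp (-(s * θ ^ 2 / 2))| := by
        refine (abs_add_le _ _).trans (le_of_eq ?_)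
        rw [abs_neg, abs_mul, abs_of_nonneg hs]
    _ ≤ s * (θ ^ 4 / 2) + (s * θ ^ 2 / 2) ^ 2 := by gcongr
    _ ≤ s * θ ^ 4 := by nlinarith [mul_nonneg hs h4, mul_nonneg (mul_nonneg hs h4) (sub_nonneg.2 hs1)]

theorem abs_charFactor_le_one {s θ : ℝ} (hs : 0 ≤ s) (hs1 : s ≤ 1) :
    |1 - s * (1 - Real.cos θ)| ≤ 1 := by
  have h1 := Real.cos_le_one θ
  have h2 := Real.neg_one_le_cos θ
  rw [abs_le]
  constructor <;> nlinarith

/-- The distance of the characteristic function of the main part to a Gaussian one. -/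
theorem abs_prod_charFactor_sub_exp_le (t : ℝ) {n K a : ℕ} (ha : 2 ≤ a) (hn : 2 ^ (3 * K) ≤ n) :
    |∏ k ∈ Finset.Ico a (K + 1),
        (1 - α k ^ 2 * (1 - Real.cos (t * (√(n : ℝ))⁻¹ * p k))) ^ (2 * n) -
      Real.exp (-(t ^ 2 * ∑ k ∈ Finset.Ico a (K + 1), weight k))| ≤
    2 * t ^ 4 * (K * (1 / 2) ^ K) := by
  have hn0 : (0 : ℝ) < n := by
    exact_mod_cast (Nat.pos_of_ne_zero (by positivity)).trans_le hn
  have hsq : (√(n : ℝ))⁻¹ ^ 2 = 1 / n := by rw [inv_pow, Real.sq_sqrt hn0.le, one_div]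
  have hexp : Real.exp (-(t ^ 2 * ∑ k ∈ Finset.Ico a (K + 1), weight k)) =
      ∏ k ∈ Finset.Ico a (K + 1),
        Real.exp (-(α k ^ 2 * (t * (√(n : ℝ))⁻¹ * p k) ^ 2 / 2)) ^ (2 * n) := by
    rw [Finset.mul_sum, ← Finset.sum_neg_distrib, Real.exp_sum]
    refine Finset.prod_congr rfl fun k hk => ?_
    have hk2 : 2 ≤ k := ha.trans (Finset.mem_Ico.1 hk).1
    rw [← Real.exp_nat_mul, ← p_mul_α_sq hk2]
    congr 1
    simp only [mul_pow, hsq]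
    push_cast
    field_simp
  rw [hexp]
  have hα : ∀ k ∈ Finset.Ico a (K + 1), 0 ≤ α k ^ 2 ∧ α k ^ 2 ≤ 1 := fun k hk =>
    ⟨sq_nonneg _, (α_sq_lt_one (ha.trans (Finset.mem_Ico.1 hk).1)).le⟩
  have he : ∀ y : ℝ, 0 ≤ y → |Real.exp (-y)| ≤ 1 := fun y hy => by
    rw [Real.abs_exp, Real.exp_le_one_iff]
    linarith
  have he' : ∀ k, |Real.exp (-(α k ^ 2 * (t * (√(n : ℝ))⁻¹ * p k) ^ 2 / 2))| ≤ 1 := fun k =>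
    he _ (by positivity)
  refine (abs_prod_sub_prod_le _ _ _ (fun k hk => ?_) fun k hk => ?_).trans ?_
  · rw [abs_pow]
    exact pow_le_one₀ (abs_nonneg _) (abs_charFactor_le_one (hα k hk).1 (hα k hk).2)
  · rw [abs_pow]
    exact pow_le_one₀ (abs_nonneg _) (he' k)
  have hterm : ∀ k ∈ Finset.Ico a (K + 1),
      |(1 - α k ^ 2 * (1 - Real.cos (t * (√(n : ℝ))⁻¹ * p k))) ^ (2 * n) -
        Real.exp (-(α k ^ 2 * (t * (√(n : ℝ))⁻¹ * p k) ^ 2 / 2)) ^ (2 * n)| ≤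
      2 * t ^ 4 * (1 / 2) ^ K := by
    intro k hk
    have hk2 : 2 ≤ k := ha.trans (Finset.mem_Ico.1 hk).1
    refine (abs_pow_sub_pow_le_mul (abs_charFactor_le_one (hα k hk).1 (hα k hk).2)
      (he' k) _).trans ?_
    have h1 := abs_charFactor_sub_exp_le (θ := t * (√(n : ℝ))⁻¹ * p k) (hα k hk).1 (hα k hk).2
    have h2 : (t * (√(n : ℝ))⁻¹ * p k) ^ 4 = t ^ 4 * (1 / n) ^ 2 * (p k : ℝ) ^ 4 := by
      rw [← hsq]
      ring
    have hw : weight k ≤ 1 := (weight_le hk2).trans (by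
      rw [div_le_one (by positivity)]
      exact_mod_cast (by omega : 1 ≤ k))
    have hp : (p k : ℝ) ≤ 2 ^ K := by
      exact_mod_cast (p_le_two_pow hk2).trans
        (Nat.pow_le_pow_right (by norm_num) (by have := (Finset.mem_Ico.1 hk).2; omega))
    have hn' : (2 : ℝ) ^ (3 * K) ≤ n := by exact_mod_cast hn
    calc ((2 * n : ℕ) : ℝ) * _ ≤ ((2 * n : ℕ) : ℝ) *
          (α k ^ 2 * (t * (√(n : ℝ))⁻¹ * p k) ^ 4) := by gcongr
      _ = 2 * t ^ 4 * (weight k * (p k : ℝ) ^ 2 / n) := by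
          rw [h2, ← p_mul_α_sq hk2]
          push_cast
          field_simp
      _ ≤ 2 * t ^ 4 * (1 * (2 ^ K) ^ 2 / 2 ^ (3 * K)) := by
          have := weight_nonneg k
          gcongr
      _ = 2 * t ^ 4 * (1 / 2) ^ K := by
          congr 1
          rw [div_eq_iff (by positivity), one_mul, ← pow_mul, one_div, inv_pow,
            eq_inv_mul_iff_mul_eq₀ (by positivity), ← pow_add]
          congr 1
          ring
  calc _ ≤ ∑ k ∈ Finset.Ico a (K + 1), 2 * t ^ 4 * (1 / 2) ^ K := Finset.sum_le_sum hterm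
    _ = ((K + 1 - a : ℕ) : ℝ) * (2 * t ^ 4 * (1 / 2) ^ K) := by
        rw [Finset.sum_const, Nat.card_Ico, nsmul_eq_mul]
    _ ≤ (K : ℝ) * (2 * t ^ 4 * (1 / 2) ^ K) := by
        gcongr
        omega
    _ = _ := by ring

/-- The lower end of the range of the blocks that determine the limit law of `S_n`. -/
def lowerIdx (n : ℕ) : ℕ := Nat.sqrt (Nat.log 2 n) + 2

/-- The upper end of the range of the blocks that determine the limit law of `S_n`. -/
def upperIdx (n : ℕ) : ℕ := Nat.log 2 n / 3 + 1

theorem tendsto_sum_weight : Tendsto (fun n : ℕ =>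
    ∑ k ∈ Finset.Ico (lowerIdx n) (upperIdx n), weight k) atTop (𝓝 (Real.log 2 ^ 2)) :=
  tendsto_sum_weight_main.comp tendsto_log_two

theorem tendsto_prod_charFactor (t : ℝ) : Tendsto (fun n : ℕ =>
    ∏ k ∈ Finset.Ico (lowerIdx n) (upperIdx n),
      (1 - α k ^ 2 * (1 - Real.cos (t * (√(n : ℝ))⁻¹ * p k))) ^ (2 * n)) atTop
    (𝓝 (Real.exp (-(t ^ 2 * Real.log 2 ^ 2)))) := by
  have h1 : Tendsto (fun n : ℕ =>
      Real.exp (-(t ^ 2 * ∑ k ∈ Finset.Ico (lowerIdx n) (upperIdx n), weight k))) atTop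
      (𝓝 (Real.exp (-(t ^ 2 * Real.log 2 ^ 2)))) :=
    (Real.continuous_exp.tendsto _).comp (tendsto_sum_weight.const_mul (t ^ 2)).neg
  have h2 : Tendsto (fun n : ℕ => 2 * t ^ 4 * (((Nat.log 2 n / 3 : ℕ) : ℝ) *
      (1 / 2) ^ (Nat.log 2 n / 3))) atTop (𝓝 0) := by
    have := (tendsto_self_mul_const_pow_of_lt_one (r := (1 / 2 : ℝ)) (by norm_num)
      (by norm_num)).comp ((Nat.tendsto_div_const_atTop three_ne_zero).comp tendsto_log_two)
    simpa using this.const_mul (2 * t ^ 4)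
  have h3 := squeeze_zero_norm' (a := fun n : ℕ => 2 * t ^ 4 * (((Nat.log 2 n / 3 : ℕ) : ℝ) *
      (1 / 2) ^ (Nat.log 2 n / 3))) (f := fun n : ℕ =>
    ∏ k ∈ Finset.Ico (lowerIdx n) (upperIdx n),
      (1 - α k ^ 2 * (1 - Real.cos (t * (√(n : ℝ))⁻¹ * p k))) ^ (2 * n) -
    Real.exp (-(t ^ 2 * ∑ k ∈ Finset.Ico (lowerIdx n) (upperIdx n), weight k))) ?_ h2
  · simpa using h3.add h1
  filter_upwards [eventually_ge_atTop 1] with n hn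
  refine abs_prod_charFactor_sub_exp_le t (Nat.le_add_left 2 _) ?_
  exact (Nat.pow_le_pow_right (by norm_num) (Nat.mul_div_le _ 3)).trans
    (Nat.pow_log_le_self 2 (by omega))

end Characteristic

end KosloffVolny

namespace KosloffVolny

section Indices

theorem le_d_sqrt_log_succ (n : ℕ) : n ≤ d (Nat.sqrt (Nat.log 2 n) + 1) := by
  refine (Nat.lt_pow_succ_log_self one_lt_two n).le.trans
    (Nat.pow_le_pow_right (by norm_num) ?_)
  have := Nat.lt_succ_sqrt (Nat.log 2 n)
  rw [pow_two]
  exact this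

theorem d_sqrt_log_le {n : ℕ} (hn : n ≠ 0) : d (Nat.sqrt (Nat.log 2 n)) ≤ n := by
  refine (Nat.pow_le_pow_right (by norm_num) ?_).trans (Nat.pow_log_le_self 2 hn)
  rw [pow_two]
  exact Nat.sqrt_le _

theorem le_d_of_lowerIdx_le {n k : ℕ} (hk : lowerIdx n ≤ k) : n ≤ d k :=
  (le_d_sqrt_log_succ n).trans (d_le_d (by unfold lowerIdx at hk; omega))

theorem two_le_lowerIdx (n : ℕ) : 2 ≤ lowerIdx n := Nat.le_add_left 2 _

theorem eventually_lowerIdx_le_upperIdx : ∀ᶠ n in atTop, lowerIdx n ≤ upperIdx n := by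
  filter_upwards [tendsto_log_two.eventually_ge_atTop 100] with n hn
  have h1 := Nat.sqrt_le (Nat.log 2 n)
  have h10 : 10 ≤ Nat.sqrt (Nat.log 2 n) := Nat.le_sqrt.2 (by omega)
  have : 3 * (Nat.sqrt (Nat.log 2 n) + 2) ≤
      Nat.sqrt (Nat.log 2 n) * Nat.sqrt (Nat.log 2 n) := by nlinarith
  unfold lowerIdx upperIdx
  omega

theorem p_mul_α_le_one {k : ℕ} (hk : 2 ≤ k) : p k * α k ≤ 1 := by
  refine (p_mul_α_le le_rfl hk).trans ?_
  rw [div_le_one (by positivity), Real.one_le_sqrt]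
  norm_num

theorem p_mul_α_nonneg (k : ℕ) : 0 ≤ p k * α k := mul_nonneg (Nat.cast_nonneg _) (α_nonneg k)

theorem mul_sqrt_half_pow_le {n m : ℕ} (hn : n ≤ 2 ^ m) : n * √(1 / 2 : ℝ) ^ m ≤ √n := by
  have h1 : (n : ℝ) = √n * √n := (Real.mul_self_sqrt (Nat.cast_nonneg n)).symm
  have h2 : √(n : ℝ) ≤ √2 ^ m := by
    rw [Real.sqrt_le_left (by positivity), ← pow_mul, mul_comm m 2, pow_mul,
      Real.sq_sqrt zero_le_two]
    exact_mod_cast hn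
  calc n * √(1 / 2 : ℝ) ^ m = √n * (√n * √(1 / 2 : ℝ) ^ m) := by rw [← mul_assoc, ← h1]
    _ ≤ √n * (√2 ^ m * √(1 / 2 : ℝ) ^ m) := by gcongr
    _ = √n := by
      rw [← mul_pow, ← Real.sqrt_mul (by norm_num)]
      norm_num

theorem sqrt_two_pow_le {n K : ℕ} (hn : 2 ^ (3 * K) ≤ n) :
    √((2 : ℝ) ^ K) ≤ √n * (1 / 2) ^ K := by
  rw [one_div, inv_pow, ← div_eq_mul_inv, le_div_iff₀ (by positivity)]
  refine Real.le_sqrt_of_sq_le ?_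
  rw [mul_pow, Real.sq_sqrt (by positivity), ← pow_mul, ← pow_add]
  have : K + K * 2 = 3 * K := by ring
  rw [this]
  exact_mod_cast hn

theorem sqrt_d_le {k r n : ℕ} (hk : k < r) (hn : d r ≤ n) : √(d k : ℝ) ≤ √n * (2 * (1 / 2) ^ r) := by
  have h1 : d k * (2 ^ (r - 1)) ^ 2 ≤ n := by
    refine le_trans ?_ hn
    unfold d
    rw [← pow_mul, ← pow_add]
    refine Nat.pow_le_pow_right (by norm_num) ?_
    obtain ⟨m, rfl⟩ : ∃ m, r = m + 1 := ⟨r - 1, by omega⟩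
    rw [Nat.add_sub_cancel]
    nlinarith
  have h2 : (2 : ℝ) * (1 / 2) ^ r = (2 ^ (r - 1))⁻¹ := by
    obtain ⟨m, rfl⟩ : ∃ m, r = m + 1 := ⟨r - 1, by omega⟩
    rw [Nat.add_sub_cancel, pow_succ, one_div, inv_pow]
    ring
  rw [h2, ← div_eq_mul_inv, le_div_iff₀ (by positivity)]
  refine Real.le_sqrt_of_sq_le ?_
  rw [mul_pow, Real.sq_sqrt (Nat.cast_nonneg _)]
  exact_mod_cast h1

end Indices

section Coding

variable {X : Type*} [MeasurableSpace X] {μ : Measure X} [IsProbabilityMeasure μ]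
  {T : X → X} {fbar : ℕ → X → ℤ}

variable (hT : MeasurePreserving T μ μ) (h : IsCodingSequence T μ fbar)
include hT h

theorem L2Le_sum_blockSum_low {n r : ℕ} (hr : 2 ≤ r) (hdn : d r ≤ n) (hnd : n ≤ d (r + 1)) :
    L2Le μ (fun x => ∑ k ∈ Finset.Ico 2 (r + 2), blockSum T fbar k n x)
      (√n * (4 * (r * (1 / 2) ^ r) + 4 / √r)) := by
  have h1 : ∀ k ∈ Finset.Ico 2 r, L2Le μ (blockSum T fbar k n) (4 * (√n * (1 / 2) ^ r)) := by
    intro k hk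
    obtain ⟨hk2, hkr⟩ := Finset.mem_Ico.1 hk
    refine (L2Le_blockSum hT h hk2 n).mono ?_
    calc 2 * (p k * (√(d k) * α k)) = 2 * ((p k * α k) * √(d k)) := by ring
      _ ≤ 2 * (1 * (√n * (2 * (1 / 2) ^ r))) := by
          have := p_mul_α_le_one hk2
          have := sqrt_d_le hkr hdn
          gcongr
      _ = _ := by ring
  have h2 : L2Le μ (blockSum T fbar r n) (√n * (2 / √r)) := by
    refine (L2Le_blockSum hT h hr n).mono ?_
    calc 2 * (p r * (√(d r) * α r)) = 2 * ((p r * α r) * √(d r)) := by ring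
      _ ≤ 2 * (1 / √r * √n) := by
          have := p_mul_α_le hr le_rfl
          gcongr
      _ = _ := by ring
  have h3 : L2Le μ (blockSum T fbar (r + 1) n) (√n * (2 / √r)) := by
    refine (L2Le_blockSum_of_le hT h (by omega) hnd).mono ?_
    calc 2 * (p (r + 1) * (√n * α (r + 1))) = 2 * ((p (r + 1) * α (r + 1)) * √n) := by ring
      _ ≤ 2 * (1 / √r * √n) := by
          have := p_mul_α_le hr (Nat.le_succ r)
          gcongr
      _ = _ := by ring
  have h4 := L2Le.sum h1 fun _ _ => by positivity
  have h5 := (h4.add h2 (Finset.sum_nonneg fun _ _ => by positivity) (by positivity)).add h3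
    (add_nonneg (Finset.sum_nonneg fun _ _ => by positivity) (by positivity)) (by positivity)
  refine (h5.mono ?_).congr (Eventually.of_forall fun x => ?_)
  · rw [Finset.sum_const, Nat.card_Ico, nsmul_eq_mul]
    have : ((r - 2 : ℕ) : ℝ) ≤ r := by exact_mod_cast Nat.sub_le r 2
    calc _ ≤ r * (4 * (√n * (1 / 2) ^ r)) + √n * (2 / √r) + √n * (2 / √r) := by gcongr
      _ = _ := by ring
  · dsimp only
    rw [Finset.sum_Ico_succ_top (by omega), Finset.sum_Ico_succ_top hr]

theorem L2Le_sum_blockSum_sub_mainSum {n a K : ℕ} (ha : 2 ≤ a) (hn : 2 ^ (3 * K) ≤ n) :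
    L2Le μ (fun x => ∑ k ∈ Finset.Ico a (K + 1), blockSum T fbar k n x -
      ∑ k ∈ Finset.Ico a (K + 1), mainSum T fbar k n x) (√n * (4 * (K * (1 / 2) ^ K))) := by
  have h1 : ∀ k ∈ Finset.Ico a (K + 1),
      L2Le μ (fun x => blockSum T fbar k n x - mainSum T fbar k n x)
        (4 * (√n * (1 / 2) ^ K)) := by
    intro k hk
    have hk2 := ha.trans (Finset.mem_Ico.1 hk).1
    refine (L2Le_blockSum_sub_mainSum hT h hk2 n).mono ?_
    have hp : (p k : ℝ) ≤ 2 ^ K := by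
      exact_mod_cast (p_le_two_pow hk2).trans
        (Nat.pow_le_pow_right (by norm_num) (by have := (Finset.mem_Ico.1 hk).2; omega))
    calc 4 * (p k * (√(p k) * α k)) = 4 * (√(p k) * (p k * α k)) := by ring
      _ ≤ 4 * (√(2 ^ K) * 1) := by
          have := p_mul_α_le_one hk2
          have := p_mul_α_nonneg k
          gcongr
      _ ≤ _ := by
          rw [mul_one]
          gcongr
          exact sqrt_two_pow_le hn
  refine ((L2Le.sum h1 fun _ _ => by positivity).mono ?_).congr
    (Eventually.of_forall fun x => Finset.sum_sub_distrib ..)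
  rw [Finset.sum_const, Nat.card_Ico, nsmul_eq_mul]
  have : ((K + 1 - a : ℕ) : ℝ) ≤ K := by exact_mod_cast (by omega : K + 1 - a ≤ K)
  calc _ ≤ K * (4 * (√n * (1 / 2) ^ K)) := by gcongr
    _ = _ := by ring

theorem L2Le_sum_blockSum_high {n a b : ℕ} (ha : 2 ≤ a) (hn : n ≤ d a) :
    L2Le μ (fun x => ∑ k ∈ Finset.Ico a b, blockSum T fbar k n x)
      (√n * (2 * √(∑ k ∈ Finset.Ico a b, weight k))) := by
  have hk : ∀ k ∈ Finset.Ico a b, 2 ≤ k ∧ n ≤ d k := fun k hk =>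
    ⟨ha.trans (Finset.mem_Ico.1 hk).1, hn.trans (d_le_d (Finset.mem_Ico.1 hk).1)⟩
  have h1 : ∀ k ∈ Finset.Ico a b, L2Le μ (blockSum T fbar k n) (2 * (p k * (√n * α k))) :=
    fun k hkk => L2Le_blockSum_of_le hT h (hk k hkk).1 (hk k hkk).2
  refine L2Le.of_integral_sq_le (memLp_finsetSum _ fun k hkk => (h1 k hkk).memLp)
    (by positivity) ?_
  rw [integral_sq_sum_of_orthogonal (fun k hkk => (h1 k hkk).memLp) fun i hi j hj hij =>
    integral_blockSum_mul_blockSum hT h (hk i hi).1 (hk j hj).1 hij (hk i hi).2 (hk j hj).2]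
  rw [mul_pow, mul_pow, Real.sq_sqrt (Nat.cast_nonneg n),
    Real.sq_sqrt (Finset.sum_nonneg fun k _ => weight_nonneg k), Finset.mul_sum, Finset.mul_sum]
  refine Finset.sum_le_sum fun k hkk => ((h1 k hkk).integral_sq_le ?_).trans (le_of_eq ?_)
  · have := α_nonneg k
    positivity
  · rw [← p_mul_α_sq (hk k hkk).1, mul_pow, mul_pow, mul_pow, mul_pow,
      Real.sq_sqrt (Nat.cast_nonneg n)]
    ring

/-- The bound on `‖S_n - ∑ mainSum‖₂ / √n`. -/
noncomputable def errorBound (n : ℕ) : ℝ :=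
  12 / √((Nat.log 2 n + 1 : ℕ) : ℝ) +
  ((4 * (Nat.sqrt (Nat.log 2 n) * (1 / 2) ^ Nat.sqrt (Nat.log 2 n)) +
    4 / √(Nat.sqrt (Nat.log 2 n) : ℝ)) +
  (4 * ((Nat.log 2 n / 3 : ℕ) * (1 / 2) ^ (Nat.log 2 n / 3)) +
  2 * √(∑ k ∈ Finset.Ico (Nat.log 2 n / 3 + 1) (Nat.log 2 n + 1), weight k)))

theorem L2Le_S_sub_mainSum : ∀ᶠ n in atTop, L2Le μ (fun x => S T fbar n x -
    ∑ k ∈ Finset.Ico (lowerIdx n) (upperIdx n), mainSum T fbar k n x) (√n * errorBound n) := by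
  filter_upwards [eventually_lowerIdx_le_upperIdx, tendsto_log_two.eventually_ge_atTop 100,
    eventually_ge_atTop 1] with n hlu hlog hn
  have hr : 2 ≤ Nat.sqrt (Nat.log 2 n) := Nat.le_sqrt.2 (by omega)
  have hul : upperIdx n ≤ Nat.log 2 n + 1 := by unfold upperIdx; omega
  have hn2 : 2 ^ (3 * (Nat.log 2 n / 3)) ≤ n :=
    (Nat.pow_le_pow_right (by norm_num) (Nat.mul_div_le _ 3)).trans
      (Nat.pow_log_le_self 2 (by omega))
  have h1 : L2Le μ _ (√n * (12 / √((Nat.log 2 n + 1 : ℕ) : ℝ))) :=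
    (L2Le_S_sub hT h (K := Nat.log 2 n + 1) (by omega) n).mono (by
      have := mul_sqrt_half_pow_le (Nat.lt_pow_succ_log_self one_lt_two n).le
      calc _ = (n * √(1 / 2 : ℝ) ^ (Nat.log 2 n + 1)) *
            (12 / √((Nat.log 2 n + 1 : ℕ) : ℝ)) := by ring
        _ ≤ _ := by gcongr)
  have h2 := L2Le_sum_blockSum_low hT h hr (d_sqrt_log_le (by omega)) (le_d_sqrt_log_succ n)
  have h3 := L2Le_sum_blockSum_sub_mainSum hT h (two_le_lowerIdx n) hn2
  have h4 := L2Le_sum_blockSum_high hT h (b := Nat.log 2 n + 1)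
    ((two_le_lowerIdx n).trans hlu) (le_d_of_lowerIdx_le hlu)
  have h5 := h1.add (h2.add (h3.add h4 (by positivity) (by positivity)) (by positivity)
    (by positivity)) (by positivity) (by positivity)
  rw [← mul_add, ← mul_add, ← mul_add] at h5
  refine h5.congr (Eventually.of_forall fun x => ?_)
  have e1 := Finset.sum_Ico_consecutive (fun k => blockSum T fbar k n x)
    (two_le_lowerIdx n) (hlu.trans hul)
  have e2 := Finset.sum_Ico_consecutive (fun k => blockSum T fbar k n x) hlu hul
  dsimp only
  rw [← e1, ← e2]
  unfold lowerIdx upperIdx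
  ring

end Coding

theorem tendsto_errorBound : Tendsto errorBound atTop (𝓝 0) := by
  have hhalf : Tendsto (fun m : ℕ => 4 * ((m : ℝ) * (1 / 2) ^ m)) atTop (𝓝 0) := by
    simpa using (tendsto_self_mul_const_pow_of_lt_one (r := (1 / 2 : ℝ)) (by norm_num)
      (by norm_num)).const_mul 4
  have hsqrt : Tendsto (fun m : ℕ => √(m : ℝ)) atTop atTop :=
    Real.tendsto_sqrt_atTop.comp tendsto_natCast_atTop_atTop
  have hr := tendsto_nat_sqrt.comp tendsto_log_two
  have h1 := ((hsqrt.comp (tendsto_add_atTop_nat 1)).comp tendsto_log_two).const_div_atTop 12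
  have h2 := (hhalf.comp hr).add ((hsqrt.comp hr).const_div_atTop 4)
  have h3 := (hhalf.comp (Nat.tendsto_div_const_atTop three_ne_zero)).comp tendsto_log_two
  have h4 := ((tendsto_sum_weight_tail.comp tendsto_log_two).sqrt).const_mul 2
  have := h1.add (h2.add (h3.add h4))
  simp only [Real.sqrt_zero, mul_zero, add_zero] at this
  exact this

end KosloffVolny

namespace KosloffVolny

section Coding

variable {X : Type*} [MeasurableSpace X] {μ : Measure X} [IsProbabilityMeasure μ]
  {T : X → X} {fbar : ℕ → X → ℤ}

/-- The normalized part of `S_n` that determines its limit law. -/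
noncomputable def normalizedMain (T : X → X) (fbar : ℕ → X → ℤ) (n : ℕ) (x : X) : ℝ :=
  (√(n : ℝ))⁻¹ * ∑ k ∈ Finset.Ico (lowerIdx n) (upperIdx n), mainSum T fbar k n x

variable (hT : MeasurePreserving T μ μ) (h : IsCodingSequence T μ fbar)
include hT h

theorem memLp_normalizedMain (n : ℕ) : MemLp (normalizedMain T fbar n) 2 μ :=
  (memLp_finsetSum _ fun _ hk => memLp_mainSum hT h
    ((two_le_lowerIdx n).trans (Finset.mem_Ico.1 hk).1) n).const_mul _

theorem memLp_S_div (n : ℕ) : MemLp (fun x => S T fbar n x / √(n : ℝ)) 2 μ := by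
  simpa only [div_eq_inv_mul] using (memLp_S hT h n).const_mul (√(n : ℝ))⁻¹

theorem L2Le_S_div_sub : ∀ᶠ n in atTop,
    L2Le μ (fun x => S T fbar n x / √(n : ℝ) - normalizedMain T fbar n x) (errorBound n) := by
  filter_upwards [L2Le_S_sub_mainSum hT h, eventually_ge_atTop 1] with n hn h1
  have h0 : 0 < √(n : ℝ) := Real.sqrt_pos.2 (by exact_mod_cast h1)
  refine ((hn.const_mul (inv_nonneg.2 h0.le)).mono (le_of_eq ?_)).congr
    (Eventually.of_forall fun x => ?_)
  · rw [inv_mul_cancel_left₀ h0.ne']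
  · dsimp only [normalizedMain]
    rw [mul_sub, div_eq_inv_mul]

theorem tendsto_integral_normalizedMain_sq : Tendsto (fun n => ∫ x, normalizedMain T fbar n x ^ 2 ∂μ)
    atTop (𝓝 (2 * Real.log 2 ^ 2)) := by
  refine (tendsto_sum_weight.const_mul 2).congr' ?_
  filter_upwards [eventually_ge_atTop 1] with n h1
  have hk : ∀ k ∈ Finset.Ico (lowerIdx n) (upperIdx n), 2 ≤ k ∧ n ≤ d k := fun k hk =>
    ⟨(two_le_lowerIdx n).trans (Finset.mem_Ico.1 hk).1,
      le_d_of_lowerIdx_le (Finset.mem_Ico.1 hk).1⟩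
  have hn : (n : ℝ) ≠ 0 := by exact_mod_cast (by omega : n ≠ 0)
  simp only [normalizedMain, mul_pow]
  rw [integral_const_mul, integral_sum_mainSum_sq hT h hk, inv_pow,
    Real.sq_sqrt (Nat.cast_nonneg n), inv_mul_cancel_left₀ hn, Finset.mul_sum]
  refine Finset.sum_congr rfl fun k hkk => ?_
  rw [← p_mul_α_sq (hk k hkk).1, mul_pow]

theorem tendsto_integral_S_sq_div : Tendsto (fun n : ℕ => (∫ x, S T fbar n x ^ 2 ∂μ) / (n : ℝ))
    atTop (𝓝 (2 * Real.log 2 ^ 2)) := by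
  have := tendsto_integral_sq_of_L2Le (memLp_S_div hT h) (memLp_normalizedMain hT h)
    tendsto_errorBound (L2Le_S_div_sub hT h) (tendsto_integral_normalizedMain_sq hT h)
  refine this.congr fun n => ?_
  simp only [div_pow, Real.sq_sqrt (Nat.cast_nonneg n)]
  rw [integral_div]

theorem tendstoInDistribution_normalizedMain : TendstoInDistribution (normalizedMain T fbar)
    atTop (id : ℝ → ℝ) (fun _ => μ) (gaussianReal 0 (2 * Real.log 2 ^ 2).toNNReal) where
  forall_aemeasurable n := (memLp_normalizedMain hT h n).1.aemeasurable
  tendsto := by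
    refine ProbabilityMeasure.tendsto_iff_tendsto_charFun.2 fun t => ?_
    rw! [Measure.map_id]
    have h1 : charFun (gaussianReal 0 (2 * Real.log 2 ^ 2).toNNReal) t =
        ((Real.exp (-(t ^ 2 * Real.log 2 ^ 2)) : ℝ) : ℂ) := by
      rw [charFun_gaussianReal, Complex.ofReal_exp]
      congr 1
      rw [Real.coe_toNNReal _ (by positivity)]
      push_cast
      ring
    change Tendsto (fun n => charFun (μ.map (normalizedMain T fbar n)) t) atTop
      (𝓝 (charFun (gaussianReal 0 (2 * Real.log 2 ^ 2).toNNReal) t))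
    rw [h1]
    refine ((Complex.continuous_ofReal.tendsto _).comp (tendsto_prod_charFactor t)).congr
      fun n => ?_
    exact (charFun_const_mul_sum_mainSum hT h (two_le_lowerIdx n)
      (le_d_of_lowerIdx_le le_rfl) _ t).symm

theorem tendstoInDistribution_S_div :
    TendstoInDistribution (fun (n : ℕ) (x : X) => S T fbar n x / √(n : ℝ))
      atTop (id : ℝ → ℝ) (fun _ => μ) (gaussianReal 0 (2 * Real.log 2 ^ 2).toNNReal) := by
  refine tendstoInDistribution_of_tendstoInMeasure_sub _ _
    (tendstoInDistribution_normalizedMain hT h) ?_ fun n => (memLp_S_div hT h n).1.aemeasurable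
  refine tendstoInMeasure_of_tendsto_eLpNorm two_ne_zero
    (fun n => (memLp_S_div hT h n).1.sub (memLp_normalizedMain hT h n).1)
    aestronglyMeasurable_const ?_
  have h1 := ENNReal.tendsto_ofReal tendsto_errorBound
  rw [ENNReal.ofReal_zero] at h1
  refine tendsto_of_tendsto_of_tendsto_of_le_of_le' tendsto_const_nhds h1
    (Eventually.of_forall fun _ => zero_le) ?_
  filter_upwards [L2Le_S_div_sub hT h] with n hn
  rw [sub_zero]
  exact hn.2

end Coding

end KosloffVolny

theorem mainTheorem4 {X : Type*} [MeasurableSpace X] (μ : Measure X) [IsProbabilityMeasure μ]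
    (T : X ≃ᵐ X) (hT : Ergodic T μ) (hap : KosloffVolny.Aperiodic T μ) :
    (∃ fbar : ℕ → X → ℤ, KosloffVolny.IsCodingSequence T μ fbar) ∧
    ∀ fbar : ℕ → X → ℤ, KosloffVolny.IsCodingSequence T μ fbar →
      MemLp (fun x => (KosloffVolny.f T fbar x : ℝ)) 2 μ ∧
      Tendsto (fun K : ℕ => eLpNorm (fun x => (KosloffVolny.f T fbar x : ℝ)
        - ∑ k ∈ Finset.Ico 2 K, (KosloffVolny.block T fbar k x : ℝ)) 2 μ) atTop (𝓝 0) ∧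
      Tendsto (fun n : ℕ =>
        (∫ x, (KosloffVolny.S T fbar n x) ^ 2 ∂μ) / (n : ℝ))
        atTop (𝓝 (2 * Real.log 2 ^ 2)) ∧
      TendstoInDistribution
        (fun (n : ℕ) (x : X) => KosloffVolny.S T fbar n x / √(n : ℝ))
        atTop (id : ℝ → ℝ) (fun _ => μ) (gaussianReal 0 (2 * Real.log 2 ^ 2).toNNReal) := by
  have hT' := hT.toMeasurePreserving
  exact ⟨KosloffVolny.exists_isCodingSequence hT hap, fun fbar h =>
    ⟨KosloffVolny.memLp_f hT' h, KosloffVolny.tendsto_eLpNorm_f_sub hT' h,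
      KosloffVolny.tendsto_integral_S_sq_div hT' h,
      KosloffVolny.tendstoInDistribution_S_div hT' h⟩⟩
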